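/- **Setting.** Let $F$ be a finite real abelian extension of $\mathbb{Q}$, let $\overline F$ be an algebraic closure of $F$, and let $M$ be an odd positive integer. Let $\mathbf r$ be the formal product of all odd primes $\ell\equiv 1 \bmod M$ that split completely in $F$. A divisor $\mathbf s$ of $\mathbf r$ is the formal product of a set of primes dividing $\mathbf r$; a positive integer divides $\mathbf s$ if it is squarefree and all its prime factors occur in $\mathbf s$. For a positive integer $r\mid\mathbf r$ let $F_r=F(\mu_r)\subset\overline F$, with ring of integers $\mathcal O_r$, and put $F_{\mathbf r}=\bigcup_{r\mid\mathbf r}F_r$, $\mathcal O_{\mathbf r}=\bigcup_{r\mid\mathbf r}\mathcal O_r$, $\mathcal O=\mathcal O_1$, $G=\mathrm{Gal}(F_{\mathbf r}/F)$. For a prime $\ell$, the subscript $(\ell)$ denotes localization at the elements prime to $\ell$. For a prime $\ell\mid\mathbf r$ let $G_\ell\subset G$ be the inertia subgroup at the places above $\ell$ (cyclic of order $\ell-1$), fix a generator $\sigma_\ell$ of $G_\ell$, put $N_\ell=\sum_{i=0}^{\ell-2}\sigma_\ell^i$, and let $\mathrm{Frob}_\ell\in G/G_\ell$ be the arithmetic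 Frobenius over $F$ at the places above $\ell$. **Universal side.** For a divisor $\mathbf s$ of $\mathbf r$ let $\frac1{\mathbf s}\mathbb Z/\mathbb Z=\bigcup_{s\mid\mathbf s}\frac1s\mathbb Z/\mathbb Z$ ($s$ ranging over positive integers). The group $G$ acts on $\frac1{\mathbf r}\mathbb Z/\mathbb Z$ by the rule $\phi(\sigma a)=\sigma\phi(a)$ for every injective homomorphism $\phi:\frac1{\mathbf r}\mathbb Z/\mathbb Z\to F_{\mathbf r}^\times$. Let $U_{\mathbf s}$ be the quotient of the free abelian group on the symbols $[a]$, $a\in\frac1{\mathbf s}\mathbb Z/\mathbb Z$, by the subgroup generated by the elements $[a]-\sum_{\ell b=a}[b]$ for primes $\ell\mid\mathbf s$ and $a\in\frac{\ell}{\mathbf s}\mathbb Z/\mathbb Z$, with the induced $G$-action, and put $U=U_{\mathbf r}$. The groups $U_{\mathbf s}$ are torsion-free, and the natural maps $U_{\mathbf s}\to U$ and $H^0(G,U_{\mathbf s}/MU_{\mathbf s})\to H^0(G,U/MU)$ are injective and are treated as inclusions. Since $G_\ell$ acts trivially on $U_{\mathbf r/\ell}$, the element $\mathrm{Frob}_\ell$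 acts on $U_{\mathbf r/\ell}$. For a prime $\ell\mid\mathbf r$ let $I_\ell\subset U$ be the subgroup generated by the classes of all $[a]-[b]$ with $a-b\in\frac1\ell\mathbb Z/\mathbb Z$, and let $$D_\ell:H^0(G,U/MU)\to H^0(G,U_{\mathbf r/\ell}/MU_{\mathbf r/\ell})$$ be the unique homomorphism such that, for $x\in U$ and $y\in U_{\mathbf r/\ell}$ representing classes in these groups, $D_\ell(x \bmod MU)=y \bmod MU_{\mathbf r/\ell}$ if and only if $$\frac{(\sigma_\ell-1)x}{M}\equiv\frac{(\ell-\mathrm{Frob}_\ell)y}{M}\pmod{I_\ell}.$$ A family $\{c_r\in H^0(G,U/MU)\}_{r\mid\mathbf r}$, indexed by the positive integers dividing $\mathbf r$, satisfies the *universal Kolyvagin recursion* if for all $r\mid\mathbf r$ one has $c_r\in H^0(G,U_r/MU_r)$, and $D_\ell c_r=c_{r/\ell}$ for all primes $\ell\mid r$. **Kolyvagin recursion.** For a prime $\ell\mid\mathbf r$ let $\mathcal I_\ell$ be the group of fractional $\mathcal O_{(\ell)}$-ideals and let $(\mathcal O/\ell)^\times_M$ be the $M$-torsion subgroup of $(\mathcal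 O/\ell)^\times$. Let $\nu_\ell:\mathcal O_{(\ell)}^\times/\mathcal O_{(\ell)}^{\times M}\to(\mathcal O/\ell)^\times_M$ be the homomorphism $x\mapsto x^{(\ell-1)/M}\bmod \ell$, let $[\cdot]_\ell:F^\times/F^{\times M}\to\mathcal I_\ell/\mathcal I_\ell^M$ be the homomorphism sending $x$ to the fractional ideal it generates, and let $\exp_\ell:\mathcal I_\ell/\mathcal I_\ell^M\to(\mathcal O/\ell)^\times_M$ be the unique isomorphism such that, for all $x\in F_\ell^\times$, $$\exp_\ell\big[x^{N_\ell}\big]_\ell\equiv\left(x^{1-\sigma_\ell}\right)^{(\ell-1)/M}\bmod\sqrt{\ell\,\mathcal O_{\ell,(\ell)}} .$$ A family $\{\lambda_r\in F^\times/F^{\times M}\}_{r\mid\mathbf r}$ satisfies the *Kolyvagin recursion* if for all positive integers $r\mid\mathbf r$ and all prime numbers $\ell$: * if $\ell\nmid r$, then $\lambda_r\in\mathcal O_{(\ell)}^\times/\mathcal O_{(\ell)}^{\times M}$ (viewed in $F^\times/F^{\times M}$); * if $\ell\mid r$, then $\exp_\ell[\lambda_r]_\ell=\nu_\ell\lambda_{r/\ell}$.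 **Proposition.** Let $\xi:U\to\mathcal O_{\mathbf r}^\times$ be any $G$-equivariant homomorphism such that $\xi I_\ell\subset1+\sqrt{\ell\,\mathcal O_{\mathbf r,(\ell)}}$ for all primes $\ell\mid\mathbf r$. The natural map $F^\times/F^{\times M}\to H^0(G,F_{\mathbf r}^\times/F_{\mathbf r}^{\times M})$ is treated as an identification (Hilbert's Satz 90), and $\xi$ induces a unique homomorphism $$\kappa:H^0(G,U/MU)\to H^0(G,F_{\mathbf r}^\times/F_{\mathbf r}^{\times M})=F^\times/F^{\times M}.$$ If $\{c_r\in H^0(G,U/MU)\}_{r\mid\mathbf r}$ is any family satisfying the universal Kolyvagin recursion, then the family $\{\kappa c_r\in F^\times/F^{\times M}\}_{r\mid\mathbf r}$ satisfies the Kolyvagin recursion. -/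

import Mathlib

open NumberField
open scoped nonZeroDivisors

namespace Kolyvagin

noncomputable section

/-! ### The supernatural number `𝐫` and its divisors -/

section Primes

variable (F : Type*) [Field F] (M : ℕ)

/-- The rational prime `ℓ` splits completely in `F`: every prime of `𝓞 F` above `ℓ` is unramified
over `ℤ` and of residue degree one. -/
def SplitsCompletely (ℓ : ℕ) : Prop :=
  ∀ P : Ideal (𝓞 F), P.IsPrime → (ℓ : 𝓞 F) ∈ P →
    P.ramificationIdx ℤ = 1 ∧ P.inertiaDeg ℤ = 1

/-- The prime numbers dividing `𝐫`, the formal product of all odd primes `ℓ ≡ 1 mod M` that split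
completely in `F`. -/
def IsRPrime (ℓ : ℕ) : Prop :=
  ℓ.Prime ∧ ℓ ≠ 2 ∧ ℓ ≡ 1 [MOD M] ∧ SplitsCompletely F ℓ

/-- The type of prime numbers dividing `𝐫`. -/
abbrev RPrime : Type := {ℓ : ℕ // IsRPrime F M ℓ}

/-- A supernatural number dividing `𝐫` is squarefree, so it is given by the set of its prime
factors. Thus `𝐫` is `Set.univ`, and `𝐬 / ℓ` is `𝐬 \ {ℓ}`. -/
abbrev SuperDiv : Type := Set (RPrime F M)

variable {F M} in
/-- The positive integer `n` divides the supernatural number `𝐬`. -/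
def Divides (n : ℕ) (s : SuperDiv F M) : Prop :=
  Squarefree n ∧ ∀ p : ℕ, p.Prime → p ∣ n → ∃ h : IsRPrime F M p, (⟨p, h⟩ : RPrime F M) ∈ s

/-- The type of positive integers dividing `𝐫`. -/
abbrev RDiv : Type := {r : ℕ // Divides (F := F) (M := M) r Set.univ}

variable {F M} in
/-- A positive integer `r` dividing `𝐫`, as a supernatural number. -/
def RDiv.toSuper (r : RDiv F M) : SuperDiv F M := {ℓ | (ℓ : ℕ) ∣ r.1}

variable {F M}

theorem Divides.ne_zero {n : ℕ} {s : SuperDiv F M} (h : Divides n s) : n ≠ 0 := h.1.ne_zero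

theorem Divides.mono {n : ℕ} {s t : SuperDiv F M} (h : Divides n s) (hst : s ⊆ t) :
    Divides n t :=
  ⟨h.1, fun p hp hpn => (h.2 p hp hpn).imp fun _ hm => hst hm⟩

theorem divides_one (s : SuperDiv F M) : Divides 1 s :=
  ⟨squarefree_one, fun _ hp h1 => absurd (Nat.dvd_one.1 h1) hp.ne_one⟩

theorem Divides.lcm {m n : ℕ} {s : SuperDiv F M} (hm : Divides m s) (hn : Divides n s) :
    Divides (m.lcm n) s := by
  refine ⟨?_, fun p hp hpn => ?_⟩
  · rw [Nat.squarefree_iff_prime_squarefree]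
    intro p hp h
    have h2 : p ^ 2 ∣ m.lcm n := by rwa [pow_two]
    have : p ^ 2 ∣ m ∨ p ^ 2 ∣ n := by
      rcases Nat.eq_zero_or_pos m with h0 | h0
      · exact absurd h0 hm.ne_zero
      rw [hp.pow_dvd_iff_le_factorization (Nat.lcm_ne_zero hm.ne_zero hn.ne_zero),
        Nat.factorization_lcm hm.ne_zero hn.ne_zero, Finsupp.sup_apply, le_sup_iff] at h2
      rwa [hp.pow_dvd_iff_le_factorization hm.ne_zero,
        hp.pow_dvd_iff_le_factorization hn.ne_zero]
    rcases this with h | h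
    · exact (Nat.squarefree_iff_prime_squarefree.1 hm.1) p hp (by rwa [← pow_two])
    · exact (Nat.squarefree_iff_prime_squarefree.1 hn.1) p hp (by rwa [← pow_two])
  · rcases (Nat.Prime.dvd_lcm hp).1 hpn with h | h
    · exact hm.2 p hp h
    · exact hn.2 p hp h

theorem Divides.prime_mul {n : ℕ} {s : SuperDiv F M} {ℓ : RPrime F M} (hℓ : ℓ ∈ s)
    (hn : Divides n (s \ {ℓ})) : Divides (ℓ.1 * n) s := by
  refine ⟨?_, fun p hp hpn => ?_⟩
  · refine (Nat.squarefree_mul_iff).2 ⟨?_, ℓ.2.1.squarefree, hn.1⟩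
    refine (Nat.Prime.coprime_iff_not_dvd ℓ.2.1).2 fun h => ?_
    obtain ⟨_, hm⟩ := hn.2 ℓ.1 ℓ.2.1 h
    exact hm.2 rfl
  · rcases (Nat.Prime.dvd_mul hp).1 hpn with h | h
    · have : p = ℓ.1 := (Nat.prime_dvd_prime_iff_eq hp ℓ.2.1).1 h
      subst this
      exact ⟨ℓ.2, hℓ⟩
    · exact (hn.2 p hp h).imp fun _ hm => hm.1

end Primes

/-! ### The fields `F_𝐫`, `F_r` and the group `G` -/

section Fields

variable (F : Type*) [Field F] (Fbar : Type*) [Field Fbar] [Algebra F Fbar] (M : ℕ)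

/-- The field `F_𝐫` generated over `F` by all roots of unity of order dividing `𝐫`. -/
def rField : IntermediateField F Fbar :=
  IntermediateField.adjoin F {ζ | ∃ n : ℕ, Divides (F := F) (M := M) n Set.univ ∧ ζ ^ n = 1}

/-- The field `F_𝐫` as a type. Its ring of integers `𝓞 F_𝐫` (the integral closure of `ℤ`) is the
union `𝒪_𝐫` of the rings `𝒪_r`. -/
abbrev FR : Type _ := ↥(rField F Fbar M)

/-- The group `G = Gal(F_𝐫 / F)`. -/
abbrev G : Type _ := FR F Fbar M ≃ₐ[F] FR F Fbar M

/-- The field `F_r` generated over `F` by the `r`-th roots of unity. -/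
def subField (r : ℕ) : IntermediateField F (FR F Fbar M) :=
  IntermediateField.adjoin F {ζ | ζ ^ r = 1}

/-- The places of `F_𝐫` above a prime number `ℓ`. -/
def placesAbove (ℓ : ℕ) : Set (Ideal (𝓞 (FR F Fbar M))) :=
  {P | P.IsMaximal ∧ (ℓ : 𝓞 (FR F Fbar M)) ∈ P}

/-- The inertia subgroup `G_ℓ` of `G`: the elements that lie in the inertia subgroup at every place
above `ℓ` (these inertia subgroups coincide, for `ℓ` dividing `𝐫`). -/
def inertiaGroup (ℓ : ℕ) : Subgroup (G F Fbar M) :=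
  ⨅ P ∈ placesAbove F Fbar M ℓ, P.inertia (G F Fbar M)

variable {F Fbar M} in
/-- `φ` is an arithmetic Frobenius over `F` at the places above `ℓ`, i.e. a representative in `G` of
the element `Frob_ℓ` of `G / G_ℓ`. -/
def IsFrob (ℓ : ℕ) (φ : G F Fbar M) : Prop :=
  ∀ P ∈ placesAbove F Fbar M ℓ, (RingOfIntegers.mapAlgHom (φ : FR F Fbar M →ₐ[F] FR F Fbar M)).IsArithFrobAt P

end Fields

/-! ### The torsion groups `(1/𝐬)ℤ/ℤ` and the action of `G` on them -/

section Torsion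

variable {F : Type*} [Field F] {M : ℕ}

/-- The group `(1/𝐬)ℤ/ℤ`, inside `ℚ/ℤ`: the union of the groups `(1/n)ℤ/ℤ` over the positive
integers `n` dividing `𝐬`. -/
def T (s : SuperDiv F M) : AddSubgroup (AddCircle (1 : ℚ)) where
  carrier := {a | ∃ n : ℕ, Divides n s ∧ n • a = 0}
  zero_mem' := ⟨1, divides_one s, smul_zero _⟩
  add_mem' := by
    rintro a b ⟨m, hm, ha⟩ ⟨n, hn, hb⟩
    refine ⟨m.lcm n, hm.lcm hn, ?_⟩
    obtain ⟨c, hc⟩ := Nat.dvd_lcm_left m n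
    obtain ⟨d, hd⟩ := Nat.dvd_lcm_right m n
    have h1 : m.lcm n • a = 0 := by rw [hc, mul_comm, mul_smul, ha, smul_zero]
    have h2 : m.lcm n • b = 0 := by rw [hd, mul_comm, mul_smul, hb, smul_zero]
    rw [smul_add, h1, h2, add_zero]
  neg_mem' := by
    rintro a ⟨m, hm, ha⟩
    exact ⟨m, hm, by rw [smul_neg, ha, neg_zero]⟩

theorem T_mono {s t : SuperDiv F M} (h : s ⊆ t) : T s ≤ T t :=
  fun _ ⟨n, hn, ha⟩ => ⟨n, hn.mono h, ha⟩

/-- The elements `b` of `(1/𝐬)ℤ/ℤ` with `ℓ b = a` are finite in number. -/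
theorem fiber_finite (s : SuperDiv F M) (ℓ : RPrime F M) (a : T s) :
    {b : T s | ℓ.1 • b = a}.Finite := by
  rcases Set.eq_empty_or_nonempty {b : T s | ℓ.1 • b = a} with h | ⟨b₀, hb₀⟩
  · rw [h]; exact Set.finite_empty
  have hfin := AddCircle.finite_torsion (1 : ℚ) ℓ.2.1.pos
  refine Set.Finite.of_injOn (f := fun b : T s => ((b - b₀ : T s) : AddCircle (1 : ℚ))) ?_ ?_ hfin
  · intro b hb
    have : ℓ.1 • (b - b₀) = 0 := by
      rw [smul_sub, show ℓ.1 • b = a from hb, show ℓ.1 • b₀ = a from hb₀, sub_self]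
    simpa using congrArg (fun x : T s => (x : AddCircle (1 : ℚ))) this
  · intro b _ c _ hbc
    exact sub_left_injective (Subtype.ext hbc)

theorem mem_T_of_smul {s : SuperDiv F M} {ℓ : RPrime F M} (hℓ : ℓ ∈ s) {a b : AddCircle (1 : ℚ)}
    (ha : a ∈ T (s \ {ℓ})) (hb : ℓ.1 • b = a) : b ∈ T s := by
  obtain ⟨n, hn, hna⟩ := ha
  exact ⟨ℓ.1 * n, hn.prime_mul hℓ, by rw [mul_comm, mul_smul, hb, hna]⟩

end Torsion

section Action

variable {F : Type*} [Field F] {Fbar : Type*} [Field Fbar] [Algebra F Fbar] {M : ℕ}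

theorem exists_galExp (σ : G F Fbar M) {n : ℕ} (hn : n ≠ 0) :
    ∃ k : ℤ, ∀ ζ : (FR F Fbar M)ˣ, ζ ^ n = 1 → σ ζ = ((ζ ^ k : (FR F Fbar M)ˣ) : FR F Fbar M) := by
  have : NeZero n := ⟨hn⟩
  obtain ⟨k, hk⟩ := rootsOfUnity.integer_power_of_ringEquiv' n (σ : FR F Fbar M ≃+* FR F Fbar M)
  exact ⟨k, fun ζ h => hk ζ ((mem_rootsOfUnity n ζ).2 h)⟩

/-- An integer `k` with `σ ζ = ζ ^ k` for all `n`-th roots of unity `ζ` in `F_𝐫`. -/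
def galExp (σ : G F Fbar M) (n : ℕ) : ℤ :=
  Classical.epsilon fun k : ℤ =>
    ∀ ζ : (FR F Fbar M)ˣ, ζ ^ n = 1 → σ ζ = ((ζ ^ k : (FR F Fbar M)ˣ) : FR F Fbar M)

theorem galExp_spec (σ : G F Fbar M) {n : ℕ} (hn : n ≠ 0) (ζ : (FR F Fbar M)ˣ) (h : ζ ^ n = 1) :
    σ ζ = ((ζ ^ galExp σ n : (FR F Fbar M)ˣ) : FR F Fbar M) :=
  Classical.epsilon_spec (exists_galExp σ hn) ζ h

theorem exists_primitiveRoot [NumberField F] [IsAlgClosure F Fbar] {n : ℕ}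
    (hn : Divides (F := F) (M := M) n Set.univ) :
    ∃ ζ : (FR F Fbar M)ˣ, IsPrimitiveRoot ζ n := by
  have : IsAlgClosed Fbar := IsAlgClosure.isAlgClosed F
  have : CharZero Fbar := charZero_of_injective_algebraMap (algebraMap F Fbar).injective
  have : NeZero n := ⟨hn.ne_zero⟩
  obtain ⟨z, hz⟩ := HasEnoughRootsOfUnity.exists_primitiveRoot Fbar n
  have hmem : z ∈ rField F Fbar M :=
    IntermediateField.subset_adjoin F _ ⟨n, hn, hz.pow_eq_one⟩
  have h1 : IsPrimitiveRoot (⟨z, hmem⟩ : FR F Fbar M) n :=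
    IsPrimitiveRoot.of_map_of_injective (f := (rField F Fbar M).val) hz
      (rField F Fbar M).val.injective
  exact ⟨(h1.isUnit hn.ne_zero).unit, IsPrimitiveRoot.coe_units_iff.1 h1⟩

variable [NumberField F] [IsAlgClosure F Fbar]

theorem galExp_smul_eq (σ : G F Fbar M) {n : ℕ} (hn : Divides (F := F) (M := M) n Set.univ)
    {a : AddCircle (1 : ℚ)} (ha : n • a = 0) {k : ℤ}
    (hk : ∀ ζ : (FR F Fbar M)ˣ, ζ ^ n = 1 → σ ζ = ((ζ ^ k : (FR F Fbar M)ˣ) : FR F Fbar M)) :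
    galExp σ (addOrderOf a) • a = k • a := by
  obtain ⟨ζ, hζ⟩ := exists_primitiveRoot (Fbar := Fbar) hn
  have hd : addOrderOf a ∣ n := addOrderOf_dvd_of_nsmul_eq_zero ha
  have hd0 : addOrderOf a ≠ 0 := fun h => hn.ne_zero (Nat.eq_zero_of_zero_dvd (h ▸ hd))
  obtain ⟨c, hc⟩ := hd
  have hη : IsPrimitiveRoot (ζ ^ c) (addOrderOf a) :=
    hζ.pow (Nat.pos_of_ne_zero hn.ne_zero) (by rw [hc, mul_comm])
  have h1 := galExp_spec σ hd0 (ζ ^ c) hη.pow_eq_one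
  have h2 := hk (ζ ^ c) (by rw [← pow_mul, mul_comm, pow_mul, hζ.pow_eq_one, one_pow])
  have h3 : (ζ ^ c) ^ (galExp σ (addOrderOf a)) = (ζ ^ c) ^ k := Units.ext (h1.symm.trans h2)
  have h4 : (ζ ^ c) ^ (galExp σ (addOrderOf a) - k) = 1 := by
    rw [zpow_sub, h3, mul_inv_cancel]
  have h5 := (hη.zpow_eq_one_iff_dvd _).1 h4
  have h6 := (addOrderOf_dvd_iff_zsmul_eq_zero).1 h5
  rwa [sub_smul, sub_eq_zero] at h6

/-- The action of `G` on `(1/𝐬)ℤ/ℤ`: an element `a` of order `n` is sent to `k a` where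
`σ ζ = ζ ^ k` for all `n`-th roots of unity `ζ`. Equivalently, `φ (σ a) = σ (φ a)` for all injective
homomorphisms `φ` from `(1/𝐫)ℤ/ℤ` to the multiplicative group of `F_𝐫`. -/
def galT (s : SuperDiv F M) : G F Fbar M →* AddMonoid.End (T s) where
  toFun σ :=
    { toFun := fun a => ⟨galExp σ (addOrderOf (a : AddCircle (1 : ℚ))) • (a : AddCircle (1 : ℚ)),
        (T s).zsmul_mem a.2 _⟩
      map_zero' := Subtype.ext (smul_zero _)
      map_add' := by
        rintro ⟨a, m, hm, ha⟩ ⟨b, n, hn, hb⟩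
        apply Subtype.ext
        have hl : Divides (m.lcm n) (Set.univ : SuperDiv F M) :=
          (hm.lcm hn).mono (Set.subset_univ s)
        obtain ⟨c, hc⟩ := Nat.dvd_lcm_left m n
        obtain ⟨d, hd⟩ := Nat.dvd_lcm_right m n
        have h1 : m.lcm n • a = 0 := by rw [hc, mul_comm, mul_smul, ha, smul_zero]
        have h2 : m.lcm n • b = 0 := by rw [hd, mul_comm, mul_smul, hb, smul_zero]
        have h3 : m.lcm n • (a + b) = 0 := by rw [smul_add, h1, h2, add_zero]
        have hk := galExp_spec σ hl.ne_zero
        change galExp σ (addOrderOf (a + b)) • (a + b) =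
          galExp σ (addOrderOf a) • a + galExp σ (addOrderOf b) • b
        rw [galExp_smul_eq σ hl h1 hk, galExp_smul_eq σ hl h2 hk, galExp_smul_eq σ hl h3 hk,
          smul_add] }
  map_one' := by
    ext ⟨a, n, hn, ha⟩
    have := galExp_smul_eq (1 : G F Fbar M) (hn.mono (Set.subset_univ s)) ha (k := 1)
      (fun ζ _ => by simp)
    exact this.trans (one_smul ℤ a)
  map_mul' σ τ := by
    ext ⟨a, n, hn, ha⟩
    have hn' : Divides n (Set.univ : SuperDiv F M) := hn.mono (Set.subset_univ s)
    have hτ := galExp_smul_eq τ hn' ha (galExp_spec τ hn'.ne_zero)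
    have hb : n • (galExp τ n • a) = 0 := by rw [smul_comm, ha, smul_zero]
    have hσ := galExp_smul_eq σ hn' hb (galExp_spec σ hn'.ne_zero)
    have hστ := galExp_smul_eq (σ * τ) hn' ha (k := galExp σ n * galExp τ n) (fun ζ h => by
      have h1 : (ζ ^ galExp τ n) ^ n = 1 := by
        rw [← zpow_natCast, ← zpow_mul, mul_comm, zpow_mul, zpow_natCast, h, one_zpow]
      rw [AlgEquiv.mul_apply, galExp_spec τ hn'.ne_zero ζ h,
        galExp_spec σ hn'.ne_zero _ h1, ← zpow_mul, mul_comm])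
    change galExp (σ * τ) (addOrderOf a) • a = galExp σ (addOrderOf (galExp τ (addOrderOf a) • a)) •
      (galExp τ (addOrderOf a) • a)
    rw [hτ, hσ, hστ, mul_smul]

theorem coe_galT (s : SuperDiv F M) (σ : G F Fbar M) (a : T s) :
    ((galT s σ a : T s) : AddCircle (1 : ℚ)) =
      galExp σ (addOrderOf (a : AddCircle (1 : ℚ))) • (a : AddCircle (1 : ℚ)) := rfl

/-- The rule `σ [a] = [b] ↔ σ (φ a) = φ b` holds for the action just defined. -/
theorem galT_eq_iff (σ : G F Fbar M) (a b : T (Set.univ : SuperDiv F M))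
    (φ : Multiplicative (T (Set.univ : SuperDiv F M)) →* (FR F Fbar M)ˣ)
    (hφ : Function.Injective φ) :
    galT Set.univ σ a = b ↔
      σ (φ (Multiplicative.ofAdd a)) = (φ (Multiplicative.ofAdd b) : FR F Fbar M) := by
  obtain ⟨n, hn, ha⟩ := a.2
  have hd : addOrderOf (a : AddCircle (1 : ℚ)) ≠ 0 := fun h =>
    hn.ne_zero (Nat.eq_zero_of_zero_dvd (h ▸ addOrderOf_dvd_of_nsmul_eq_zero ha))
  have h0 : addOrderOf (a : AddCircle (1 : ℚ)) • a = 0 :=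
    Subtype.ext (addOrderOf_nsmul_eq_zero (a : AddCircle (1 : ℚ)))
  have h1 : φ (Multiplicative.ofAdd a) ^ addOrderOf (a : AddCircle (1 : ℚ)) = 1 := by
    rw [← map_pow, ← ofAdd_nsmul, h0, ofAdd_zero, map_one]
  have h2 : σ (φ (Multiplicative.ofAdd a)) =
      (φ (Multiplicative.ofAdd (galT Set.univ σ a)) : FR F Fbar M) := by
    rw [galExp_spec σ hd _ h1, ← map_zpow, ← ofAdd_zsmul]
    rfl
  rw [h2, Units.val_inj, hφ.eq_iff]
  exact Iff.rfl

/-! ### The universal ordinary distribution -/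

variable (F M) in
/-- The free abelian group `𝒜(𝐬)` on the symbols `[a]` with `a` in `(1/𝐬)ℤ/ℤ`. -/
abbrev A (s : SuperDiv F M) : Type := FreeAbelianGroup (T s)

/-- The element `[a] - ∑_{ℓ b = a} [b]` of `𝒜(𝐬)`. -/
def distRel (s : SuperDiv F M) (ℓ : RPrime F M) (a : T s) : A F M s :=
  FreeAbelianGroup.of a - ∑ b ∈ (fiber_finite s ℓ a).toFinset, FreeAbelianGroup.of b

/-- The subgroup of `𝒜(𝐬)` generated by the elements `[a] - ∑_{ℓ b = a} [b]`, for `ℓ` a prime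
dividing `𝐬` and `a` in `(ℓ/𝐬)ℤ/ℤ`. -/
def relations (s : SuperDiv F M) : AddSubgroup (A F M s) :=
  AddSubgroup.closure
    {x | ∃ ℓ ∈ s, ∃ a : T s, (a : AddCircle (1 : ℚ)) ∈ T (s \ {ℓ}) ∧ x = distRel s ℓ a}

variable (F M) in
/-- The group `U_𝐬`, the target of the universal ordinary distribution of level `𝐬`. -/
abbrev U (s : SuperDiv F M) : Type := A F M s ⧸ relations s

/-- The class in `U_𝐬` of the symbol `[a]`. -/
def U.of {s : SuperDiv F M} (a : T s) : U F M s := QuotientAddGroup.mk (FreeAbelianGroup.of a)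

/-- The action of `G` on `𝒜(𝐬)`. -/
def galA (s : SuperDiv F M) : G F Fbar M →* AddMonoid.End (A F M s) where
  toFun σ := FreeAbelianGroup.map (galT s σ)
  map_one' := by
    refine FreeAbelianGroup.lift_ext _ _ fun a => ?_
    rw [FreeAbelianGroup.map_of_apply, map_one]
    rfl
  map_mul' σ τ := by
    refine FreeAbelianGroup.lift_ext _ _ fun a => ?_
    rw [FreeAbelianGroup.map_of_apply, map_mul]
    change _ = FreeAbelianGroup.map (galT s σ) (FreeAbelianGroup.map (galT s τ) _)
    rw [FreeAbelianGroup.map_of_apply, FreeAbelianGroup.map_of_apply]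
    rfl

theorem galT_inv_apply (s : SuperDiv F M) (σ : G F Fbar M) (a : T s) :
    galT s σ⁻¹ (galT s σ a) = a := by
  change (galT s σ⁻¹ * galT s σ) a = a
  rw [← map_mul, inv_mul_cancel, map_one]
  rfl

theorem galA_distRel (s : SuperDiv F M) (σ : G F Fbar M) (ℓ : RPrime F M) (a : T s) :
    galA s σ (distRel s ℓ a) = distRel s ℓ (galT s σ a) := by
  have hof : ∀ b : T s, galA s σ (FreeAbelianGroup.of b) = FreeAbelianGroup.of (galT s σ b) :=
    fun b => FreeAbelianGroup.map_of_apply b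
  rw [distRel, distRel, map_sub, hof, map_sum]
  congr 1
  refine Finset.sum_bij' (fun b _ => galT s σ b) (fun b _ => galT s σ⁻¹ b) ?_ ?_ ?_ ?_ ?_
  · intro b hb
    simp only [Set.Finite.mem_toFinset, Set.mem_ofPred_eq] at hb ⊢
    rw [← map_nsmul, hb]
  · intro b hb
    simp only [Set.Finite.mem_toFinset, Set.mem_ofPred_eq] at hb ⊢
    rw [← map_nsmul, hb, galT_inv_apply]
  · intro b _
    exact galT_inv_apply s σ b
  · intro b _
    simpa using galT_inv_apply s σ⁻¹ b
  · intro b _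
    exact hof b

theorem galA_relations (s : SuperDiv F M) (σ : G F Fbar M) :
    relations s ≤ (relations s).comap (galA s σ) := by
  rw [relations, AddSubgroup.closure_le]
  rintro _ ⟨ℓ, hℓ, a, ha, rfl⟩
  refine AddSubgroup.subset_closure ⟨ℓ, hℓ, galT s σ a, ?_, galA_distRel s σ ℓ a⟩
  exact (T (s \ {ℓ})).zsmul_mem ha _

/-- The action of `G` on `U_𝐬`. -/
def galU (s : SuperDiv F M) : G F Fbar M →* AddMonoid.End (U F M s) where
  toFun σ := QuotientAddGroup.map _ _ (galA s σ) (galA_relations s σ)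
  map_one' := by
    refine AddMonoidHom.ext fun x => ?_
    obtain ⟨x, rfl⟩ := QuotientAddGroup.mk_surjective x
    exact congrArg QuotientAddGroup.mk (DFunLike.congr_fun (map_one (galA s)) x)
  map_mul' σ τ := by
    refine AddMonoidHom.ext fun x => ?_
    obtain ⟨x, rfl⟩ := QuotientAddGroup.mk_surjective x
    exact congrArg QuotientAddGroup.mk (DFunLike.congr_fun (map_mul (galA s) σ τ) x)

/-- The inclusion of `(1/𝐬)ℤ/ℤ` into `(1/𝐫)ℤ/ℤ`. -/
def inclT (s : SuperDiv F M) : T s →+ T (Set.univ : SuperDiv F M) :=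
  AddSubgroup.inclusion (T_mono (Set.subset_univ s))

theorem inclA_relations (s : SuperDiv F M) :
    relations s ≤ (relations (Set.univ : SuperDiv F M)).comap (FreeAbelianGroup.map (inclT s)) := by
  rw [relations, AddSubgroup.closure_le]
  rintro _ ⟨ℓ, hℓ, a, ha, rfl⟩
  refine AddSubgroup.subset_closure ⟨ℓ, Set.mem_univ _, inclT s a,
    T_mono (Set.sdiff_subset_sdiff_left (Set.subset_univ s)) ha, ?_⟩
  rw [distRel, distRel, map_sub, FreeAbelianGroup.map_of_apply, map_sum]
  congr 1
  refine Finset.sum_bij (fun b _ => inclT s b) ?_ ?_ ?_ ?_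
  · intro b hb
    simp only [Set.Finite.mem_toFinset, Set.mem_ofPred_eq] at hb ⊢
    rw [← map_nsmul, hb]
  · intro b _ c _ h
    exact AddSubgroup.inclusion_injective _ h
  · intro b hb
    simp only [Set.Finite.mem_toFinset, Set.mem_ofPred_eq] at hb
    have hb' : ℓ.1 • (b : AddCircle (1 : ℚ)) = a := congrArg Subtype.val hb
    refine ⟨⟨b, mem_T_of_smul hℓ ha hb'⟩, ?_, rfl⟩
    simp only [Set.Finite.mem_toFinset, Set.mem_ofPred_eq]
    exact Subtype.ext hb'
  · intro b _
    exact FreeAbelianGroup.map_of_apply b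

/-- The map `U_𝐬 → U` induced by the inclusion of `𝒜(𝐬)` in `𝒜`. -/
def inclU (s : SuperDiv F M) : U F M s →+ U F M Set.univ :=
  QuotientAddGroup.map _ _ (FreeAbelianGroup.map (inclT s)) (inclA_relations s)

theorem inclU_galU (s : SuperDiv F M) (σ : G F Fbar M) (x : U F M s) :
    inclU s (galU s σ x) = galU Set.univ σ (inclU s x) := by
  obtain ⟨x, rfl⟩ := QuotientAddGroup.mk_surjective x
  have : ((FreeAbelianGroup.map (inclT s)).comp (galA s σ) : A F M s →+ A F M Set.univ) =
      AddMonoidHom.comp (galA Set.univ σ) (FreeAbelianGroup.map (inclT s)) := by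
    refine FreeAbelianGroup.lift_ext _ _ fun a => ?_
    change FreeAbelianGroup.map (inclT s) (FreeAbelianGroup.map (galT s σ) _) =
      FreeAbelianGroup.map (galT Set.univ σ) _
    simp only [FreeAbelianGroup.map_of_apply]
    rfl
  exact congrArg QuotientAddGroup.mk (DFunLike.congr_fun this x)

/-! ### The groups `H⁰(G, U_𝐬 / M U_𝐬)` -/

variable (F M) in
/-- The quotient `U_𝐬 / M U_𝐬`. -/
abbrev UM (s : SuperDiv F M) : Type := U F M s ⧸ (nsmulAddMonoidHom (α := U F M s) M).range

theorem map_range_nsmul {B C : Type*} [AddCommGroup B] [AddCommGroup C] (f : B →+ C) (m : ℕ) :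
    (nsmulAddMonoidHom (α := B) m).range ≤ ((nsmulAddMonoidHom (α := C) m).range).comap f := by
  rintro _ ⟨x, rfl⟩
  exact ⟨f x, by simp⟩

/-- The action of `σ` on `U_𝐬 / M U_𝐬`. -/
def galUM (s : SuperDiv F M) (σ : G F Fbar M) : UM F M s →+ UM F M s :=
  QuotientAddGroup.map _ _ (galU s σ) (map_range_nsmul _ M)

variable (F Fbar M) in
/-- The group `H⁰(G, U_𝐬 / M U_𝐬)` of invariants. -/
def H0 (s : SuperDiv F M) : AddSubgroup (UM F M s) where
  carrier := {c | ∀ σ : G F Fbar M, galUM s σ c = c}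
  zero_mem' σ := map_zero _
  add_mem' hc hd σ := by rw [map_add, hc σ, hd σ]
  neg_mem' hc σ := by rw [map_neg, hc σ]

/-- `x` represents the class `c`. -/
def Represents {s : SuperDiv F M} (x : U F M s) (c : H0 F Fbar M s) : Prop :=
  (QuotientAddGroup.mk x : UM F M s) = c

/-- The map `U_𝐬 / M U_𝐬 → U / M U`. -/
def inclUM (s : SuperDiv F M) : UM F M s →+ UM F M Set.univ :=
  QuotientAddGroup.map _ _ (inclU s) (map_range_nsmul _ M)

theorem inclUM_galUM (s : SuperDiv F M) (σ : G F Fbar M) (x : UM F M s) :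
    inclUM s (galUM s σ x) = galUM Set.univ σ (inclUM s x) := by
  obtain ⟨x, rfl⟩ := QuotientAddGroup.mk_surjective x
  exact congrArg QuotientAddGroup.mk (inclU_galU s σ x)

variable (Fbar) in
/-- The map `H⁰(G, U_𝐬 / M U_𝐬) → H⁰(G, U / M U)`. -/
def inclH0 (s : SuperDiv F M) : H0 F Fbar M s →+ H0 F Fbar M Set.univ :=
  ((inclUM s).comp (H0 F Fbar M s).subtype).codRestrict _ fun c σ => by
    rw [AddMonoidHom.comp_apply, ← inclUM_galUM]
    exact congrArg _ (c.2 σ)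

/-! ### The subgroup `I_ℓ`, the operator `D_ℓ` and the universal Kolyvagin recursion -/

/-- The subgroup `I_ℓ` of `U` generated by the classes of `[a] - [b]` with `a - b` in
`(1/ℓ)ℤ/ℤ`. -/
def Isub (ℓ : RPrime F M) : AddSubgroup (U F M Set.univ) :=
  AddSubgroup.closure
    {x | ∃ a b : T (Set.univ : SuperDiv F M), ℓ.1 • (a - b) = 0 ∧ x = U.of a - U.of b}

/-- The relation `D_ℓ c = d` between `c` in `H⁰(G, U / M U)` and `d` in
`H⁰(G, U_{𝐫/ℓ} / M U_{𝐫/ℓ})`: for representatives `x` of `c` and `y` of `d`,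
`(σ_ℓ - 1) x / M ≡ (ℓ - Frob_ℓ) y / M` modulo `I_ℓ`. The quotients `u` and `v` by `M` are taken in
the torsion-free groups `U` and `U_{𝐫/ℓ}`. The operator `D_ℓ` is by definition the map with this
graph; the validity of the congruence does not depend on the choices of `x`, `y` and of the
representative `φ` of `Frob_ℓ`. -/
def IsD (ℓ : RPrime F M) (σ : G F Fbar M) (c : H0 F Fbar M Set.univ)
    (d : H0 F Fbar M (Set.univ \ {ℓ})) : Prop :=
  ∃ φ : G F Fbar M, IsFrob ℓ.1 φ ∧
    ∃ (x : U F M Set.univ) (y : U F M (Set.univ \ {ℓ})), Represents x c ∧ Represents y d ∧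
      ∃ (u : U F M Set.univ) (v : U F M (Set.univ \ {ℓ})),
        M • u = galU Set.univ σ x - x ∧ M • v = ℓ.1 • y - galU _ φ y ∧
          u - inclU _ v ∈ Isub ℓ

/-- The universal Kolyvagin recursion, for a choice of generators `σ ℓ` of the groups `G_ℓ`: one has
`c_r ∈ H⁰(G, U_r / M U_r)`, and `D_ℓ c_r = c_{r/ℓ}` if `ℓ` divides `r`. -/
def UniversalKolyvaginRecursion (σ : RPrime F M → G F Fbar M)
    (c : RDiv F M → H0 F Fbar M Set.univ) : Prop :=
  (∀ r : RDiv F M, c r ∈ (inclH0 Fbar r.toSuper).range) ∧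
  ∀ (r r' : RDiv F M) (ℓ : RPrime F M), r.1 = ℓ.1 * r'.1 →
    ∃ d : H0 F Fbar M (Set.univ \ {ℓ}), IsD ℓ (σ ℓ) (c r) d ∧ inclH0 Fbar _ d = c r'

end Action

/-! ### Localization at `ℓ` -/

section Local

/-- The localization of the ring of integers of `K` by the elements prime to `ℓ`, inside `K`. -/
def locAt (K : Type*) [Field K] (ℓ : ℕ) : Subring K where
  carrier := {z | ∃ a b : 𝓞 K, IsCoprime b (ℓ : 𝓞 K) ∧ (b : K) ≠ 0 ∧ z = (a : K) / b}
  zero_mem' := ⟨0, 1, isCoprime_one_left, by simp, by simp⟩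
  one_mem' := ⟨1, 1, isCoprime_one_left, by simp, by simp⟩
  add_mem' := by
    rintro _ _ ⟨a, b, hb, hb0, rfl⟩ ⟨c, d, hd, hd0, rfl⟩
    exact ⟨a * d + b * c, b * d, hb.mul_left hd, by push_cast; exact mul_ne_zero hb0 hd0,
      by push_cast; exact div_add_div _ _ hb0 hd0⟩
  mul_mem' := by
    rintro _ _ ⟨a, b, hb, hb0, rfl⟩ ⟨c, d, hd, hd0, rfl⟩
    exact ⟨a * c, b * d, hb.mul_left hd, by push_cast; exact mul_ne_zero hb0 hd0,
      by push_cast; exact div_mul_div_comm _ _ _ _⟩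
  neg_mem' := by
    rintro _ ⟨a, b, hb, hb0, rfl⟩
    exact ⟨-a, b, hb, hb0, by push_cast; exact (neg_div _ _).symm⟩

theorem algebraMap_mem_locAt (K : Type*) [Field K] (ℓ : ℕ) (a : 𝓞 K) : (a : K) ∈ locAt K ℓ :=
  ⟨a, 1, isCoprime_one_left, by simp, by simp⟩

instance (F : Type*) [Field F] [NumberField F] (ℓ : ℕ) : IsFractionRing (locAt F ℓ) F := by
  refine IsFractionRing.of_field (locAt F ℓ) F fun z => ?_
  obtain ⟨a, b, _, rfl⟩ := IsFractionRing.div_surjective (𝓞 F) z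
  exact ⟨⟨a, algebraMap_mem_locAt F ℓ a⟩, ⟨b, algebraMap_mem_locAt F ℓ b⟩, rfl⟩

/-- The radical of the ideal generated by `ℓ` in the localization of `𝓞 K` at `ℓ`. -/
def radicalAt (K : Type*) [Field K] (ℓ : ℕ) : Ideal (locAt K ℓ) :=
  (Ideal.span {(ℓ : locAt K ℓ)}).radical

/-- Elements `x` and `y` of an extension of `K` are congruent modulo `radicalAt K ℓ`. -/
def RadCongr (K : Type*) [Field K] {L : Type*} [Field L] [Algebra K L] (ℓ : ℕ) (x y : L) : Prop :=
  ∃ w ∈ radicalAt K ℓ, x - y = algebraMap K L w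

/-- The quotient of a commutative group by the subgroup of `M`-th powers. -/
abbrev ModPow (B : Type*) [CommGroup B] (M : ℕ) : Type _ := B ⧸ (powMonoidHom (α := B) M).range

/-- The homomorphism of quotients by `M`-th powers induced by a homomorphism. -/
def ModPow.map {B C : Type*} [CommGroup B] [CommGroup C] (f : B →* C) (M : ℕ) :
    ModPow B M →* ModPow C M :=
  QuotientGroup.map _ _ f (by
    rintro _ ⟨x, rfl⟩
    exact ⟨f x, by simp⟩)

variable (F : Type*) [Field F] [NumberField F] (M : ℕ)

/-- The group of (invertible) fractional ideals of the localization of `𝓞 F` at `ℓ`. -/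
abbrev FracGroup (ℓ : ℕ) : Type _ := (FractionalIdeal (locAt F ℓ)⁰ F)ˣ

/-- The residue ring `𝓞 F / ℓ`, as a quotient of the localization of `𝓞 F` at `ℓ`. -/
abbrev ResRing (ℓ : ℕ) : Type _ := locAt F ℓ ⧸ Ideal.span {(ℓ : locAt F ℓ)}

/-- The subgroup of `M`-torsion in the units of `𝓞 F / ℓ`. -/
abbrev ResTors (ℓ : ℕ) : Subgroup (ResRing F ℓ)ˣ := (powMonoidHom (α := (ResRing F ℓ)ˣ) M).ker

/-- The homomorphism `[·]_ℓ` from `Fˣ` modulo `M`-th powers to fractional ideals modulo `M`-th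
powers that sends an element to the fractional ideal it generates. -/
def bracket (ℓ : ℕ) : ModPow Fˣ M →* ModPow (FracGroup F ℓ) M :=
  ModPow.map (toPrincipalIdeal (locAt F ℓ) F) M

/-- The homomorphism `ν_ℓ`, on the units of the localization of `𝓞 F` at `ℓ`: it sends `x` to
`x ^ ((ℓ - 1) / M)` modulo `ℓ`. -/
def nu (ℓ : ℕ) : (locAt F ℓ)ˣ →* (ResRing F ℓ)ˣ :=
  (powMonoidHom (α := (ResRing F ℓ)ˣ) ((ℓ - 1) / M)).comp
    (Units.map (Ideal.Quotient.mk (Ideal.span {(ℓ : locAt F ℓ)})).toMonoidHom)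

/-- The class in `Fˣ` modulo `M`-th powers of a unit of the localization of `𝓞 F` at `ℓ`. -/
def unitClass (ℓ : ℕ) : (locAt F ℓ)ˣ →* ModPow Fˣ M :=
  (QuotientGroup.mk' _).comp (Units.map (locAt F ℓ).subtype.toMonoidHom)

end Local

/-! ### The map `exp_ℓ`, the Kolyvagin recursion and the map `κ` -/

section Recursion

variable {F : Type*} [Field F] [NumberField F] {Fbar : Type*} [Field Fbar] [Algebra F Fbar] {M : ℕ}

/-- The property that defines the isomorphism `exp_ℓ`: for `x ∈ F_ℓˣ` it sends the class of the
fractional ideal generated by `x ^ N_ℓ = ∏_{i < ℓ - 1} σ_ℓ ^ i x` (an element of `F`) to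
`(x / σ_ℓ x) ^ ((ℓ - 1) / M)` modulo the radical of `ℓ` in `𝒪_{ℓ,(ℓ)}`. As every fractional ideal
is generated by some such `x ^ N_ℓ`, this determines `exp_ℓ`. -/
def IsExp (ℓ : RPrime F M) (σ : G F Fbar M)
    (e : ModPow (FracGroup F ℓ.1) M ≃* ResTors F M ℓ.1) : Prop :=
  ∀ (x : (FR F Fbar M)ˣ) (a : Fˣ) (b : locAt F ℓ.1), (x : FR F Fbar M) ∈ subField F Fbar M ℓ.1 →
    algebraMap F (FR F Fbar M) a = ∏ i ∈ Finset.range (ℓ.1 - 1), (σ ^ i) (x : FR F Fbar M) →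
    Ideal.Quotient.mk (Ideal.span {(ℓ.1 : locAt F ℓ.1)}) b =
      ((e (bracket F M ℓ.1 (QuotientGroup.mk a)) : (ResRing F ℓ.1)ˣ) : ResRing F ℓ.1) →
    RadCongr (subField F Fbar M ℓ.1) ℓ.1
      (((x : FR F Fbar M) / σ x) ^ ((ℓ.1 - 1) / M)) (algebraMap F (FR F Fbar M) b)

/-- The Kolyvagin recursion, for a choice of generators `σ ℓ` of the groups `G_ℓ`: the class `λ_r`
comes from a unit at every prime number `ℓ` prime to `r`, and `exp_ℓ [λ_r]_ℓ = ν_ℓ λ_{r/ℓ}` for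
every prime number `ℓ` dividing `r`. -/
def KolyvaginRecursion (σ : RPrime F M → G F Fbar M) (lam : RDiv F M → ModPow Fˣ M) : Prop :=
  (∀ (r : RDiv F M) (ℓ : ℕ), ℓ.Prime → ℓ.Coprime r.1 → lam r ∈ (unitClass F M ℓ).range) ∧
  ∀ ℓ : RPrime F M, ∃ e : ModPow (FracGroup F ℓ.1) M ≃* ResTors F M ℓ.1, IsExp ℓ (σ ℓ) e ∧
    ∀ r r' : RDiv F M, r.1 = ℓ.1 * r'.1 →
      ∀ b : (locAt F ℓ.1)ˣ, unitClass F M ℓ.1 b = lam r' →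
        (e (bracket F M ℓ.1 (lam r)) : (ResRing F ℓ.1)ˣ) = nu F M ℓ.1 b

variable [IsAlgClosure F Fbar]

/-- The homomorphism from `U` to the units of `𝒪_𝐫` is `G`-equivariant. -/
def IsEquivariant (ξ : U F M Set.univ →+ Additive (𝓞 (FR F Fbar M))ˣ) : Prop :=
  ∀ (τ : G F Fbar M) (x : U F M Set.univ),
    (((ξ (galU Set.univ τ x)).toMul : 𝓞 (FR F Fbar M)) : FR F Fbar M) =
      τ (((ξ x).toMul : 𝓞 (FR F Fbar M)) : FR F Fbar M)

/-- The homomorphism `κ` from `H⁰(G, U / M U)` to `Fˣ` modulo `M`-th powers is induced by `ξ`: the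
image of `κ c` in `F_𝐫ˣ` modulo `M`-th powers is the class of `ξ x`, for `x` representing `c`. -/
def IsInduced (ξ : U F M Set.univ →+ Additive (𝓞 (FR F Fbar M))ˣ)
    (κ : H0 F Fbar M Set.univ →+ Additive (ModPow Fˣ M)) : Prop :=
  ∀ (c : H0 F Fbar M Set.univ) (x : U F M Set.univ), Represents x c →
    ModPow.map (Units.map (algebraMap F (FR F Fbar M)).toMonoidHom) M (κ c).toMul =
      QuotientGroup.mk (Units.map (algebraMap (𝓞 (FR F Fbar M)) (FR F Fbar M)).toMonoidHom
        (ξ x).toMul)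

end Recursion

end

end Kolyvagin

/-!
Everything is checked place by place. Write `Ω = F_𝐫`, let `P` be a prime of `𝓞 Ω` above a prime `ℓ`
dividing `𝐫`, and let `U¹_P` be the group of principal units of the (non-discrete) valuation ring
`𝓞 Ω` localized at `P`. An element of an intermediate field lies in the radical of `ℓ` in the
localization at `ℓ` if and only if its valuation is `< 1` at all such `P`
(`mem_radicalAt_of_placeVal_lt_one`, `placeVal_lt_one_of_mem_radicalAt`), and a unit at `ℓ` of `F`
is trivial modulo `ℓ` if and only if it lies in all `U¹_P` (`unitRed_eq_one_iff`).

*Ramification.* Adjoining roots of unity of order prime to `ℓ` is unramified at `ℓ`, and adjoining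
a primitive `ℓ`-th root of unity `ζ` after that is totally ramified with uniformizer `1 - ζ`
(`minpoly_eq_cyclotomic`, `valuation_map_sub_lt_one`). Hence the inertia group `G_ℓ` acts on `ζ`
through all of `(ℤ/ℓ)ˣ`, and `σ_ℓ ζ = ζ ^ k` for a primitive root `k` modulo `ℓ`
(`exists_primitiveRoot_modulo`). Moreover a root of unity of odd order `M` in `Ω` descends through
the levels to the totally real field `F`, so it is trivial (`eq_one_of_pow_eq_one`).

*The map `κ`.* As `M`-th roots in `Ω` are unique when they exist, Hilbert's Theorem 90 at a finite
level gives `Fˣ / M ≃ H⁰(G, Ωˣ / M)`, hence `κ` (`existsUnique_isInduced`). For `c` at level `r` and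
`ξ x = a z ^ M` with `x` representing `c`, the unit `ξ x` and then `z` lie in `F_r`, which is
unramified away from `r`; so the orders of `a` at primes away from `r` are divisible by `M`
(`mem_range_unitClass`).

*The tame character.* If `y` has the valuation of `(1 - ζ) ^ n` at `P`, then
`y / σ_ℓ y ≡ k ^ (-n)` modulo `U¹_P` (`div_galUnits_mul_zpow_mem_U1`). So the defining property of
`exp_ℓ` says that the ideal generated by `a` goes to a unit congruent to
`k ^ (-((ℓ - 1) / M) ord_v a)` at every prime `v` above `ℓ`. This prescription and the homomorphism
`a ↦ [a]_ℓ` are both surjective with kernel `{a | M ∣ ord_v a for all v}`, which produces `exp_ℓ`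
(`exists_tameHom`, `exists_exp`, `isExp_of_tameHom`).

*The recursion at `ℓ`.* Let `D_ℓ c = c'`, and write `ξ x = a z ^ M` and `ξ y = b w ^ M` for
representatives `x` and `y`. The quotients by `M` in the definition of `D_ℓ` are sent by `ξ` to
`σ_ℓ z / z` and `b ^ ((ℓ - 1) / M) w ^ ℓ / φ w`, where `φ` is a Frobenius. They are congruent modulo
`U¹_P` by the hypothesis on `I_ℓ`; also `w ^ ℓ ≡ φ w` because `ℓ` splits completely in `F`, and the
tame character evaluates `σ_ℓ z / z` in terms of `ord_v a`. This is `exp_ℓ [a]_ℓ = ν_ℓ b`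
(`unitRed_tameHom_eq_nu`).
-/

namespace Kolyvagin

noncomputable section

/-! ### Places of an algebraic extension of a number field -/

section Places

open IsDedekindDomain

theorem le_one_iff_not_lt_one_of_mul_eq_one {Γ : Type*} [LinearOrderedCommGroupWithZero Γ]
    {a b : Γ} (hab : a * b = 1) (hb : b ≤ 1) : a ≤ 1 ↔ ¬ b < 1 := by
  constructor
  · intro ha hb'
    exact ((mul_le_of_le_one_left' ha).trans_lt hb').ne hab
  · intro hb'
    rw [le_antisymm hb (not_lt.1 hb'), mul_one] at hab
    exact hab.le

/-- In the fraction field of a Dedekind domain, an element or its inverse is a fraction with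
denominator outside a given prime `Q`. -/
theorem exists_mul_eq_or_mul_eq_of_isDedekindDomain {R K : Type*} [CommRing R] [IsDedekindDomain R]
    [Field K] [Algebra R K] [IsFractionRing R K] (Q : Ideal R) [hQ : Q.IsPrime] (x : K) :
    ∃ n d : R, d ∉ Q ∧ (x * algebraMap R K d = algebraMap R K n ∨
      x * algebraMap R K n = algebraMap R K d) := by
  by_cases h0 : Q = ⊥
  · obtain ⟨a, b, hb, rfl⟩ := IsFractionRing.div_surjective (A := R) x
    have hb0 : b ≠ 0 := nonZeroDivisors.ne_zero hb
    refine ⟨a, b, by simpa [h0] using hb0, Or.inl ?_⟩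
    rw [div_mul_cancel₀]
    simpa using hb0
  · obtain ⟨n, d, h⟩ := HeightOneSpectrum.exists_primeCompl_mul_eq_or_mul_eq ⟨Q, hQ, h0⟩ x
    exact ⟨n, d, d.2, h⟩

theorem natCast_notMem_of_coprime {R : Type*} [CommRing R] {I : Ideal R} [I.IsPrime] {ℓ n : ℕ}
    (h : n.Coprime ℓ) (hℓ : (ℓ : R) ∈ I) : (n : R) ∉ I := fun hn => by
  obtain ⟨u, v, huv⟩ := Nat.isCoprime_iff_coprime.2 h
  refine I.one_notMem ?_
  have h1 : ((u * n + v * ℓ : ℤ) : R) = 1 := by rw [huv]; simp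
  rw [← h1]
  push_cast
  exact I.add_mem (I.mul_mem_left _ hn) (I.mul_mem_left _ hℓ)

variable (F : Type*) {Ω : Type*} [Field F] [NumberField F] [Field Ω] [Algebra F Ω]

theorem numberField_intermediateField (K : IntermediateField F Ω) [FiniteDimensional F K] :
    NumberField K :=
  { to_charZero := inferInstance
    to_finiteDimensional := Module.Finite.trans F K }

variable [Algebra.IsAlgebraic F Ω]

include F in
theorem exists_mul_eq_or_mul_eq (P : Ideal (𝓞 Ω)) [P.IsPrime] (x : Ω) :
    ∃ n d : 𝓞 Ω, d ∉ P ∧ (x * d = n ∨ x * n = d) := by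
  let K := IntermediateField.adjoin F {x}
  have : FiniteDimensional F K :=
    IntermediateField.adjoin.finiteDimensional (Algebra.IsIntegral.isIntegral x)
  have : NumberField K := numberField_intermediateField F K
  obtain ⟨n, d, hd, h⟩ := exists_mul_eq_or_mul_eq_of_isDedekindDomain
    (P.comap (algebraMap (𝓞 K) (𝓞 Ω))) (⟨x, IntermediateField.mem_adjoin_simple_self F x⟩ : K)
  refine ⟨algebraMap _ _ n, algebraMap _ _ d, hd, h.imp (fun h => ?_) (fun h => ?_)⟩
  · exact congrArg (algebraMap K Ω) h
  · exact congrArg (algebraMap K Ω) h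

/-- The local ring at a prime `P` of `𝓞 Ω`, as a valuation ring of `Ω`. The extension `Ω / F` may be
infinite, so that `𝓞 Ω` need not be a Dedekind domain; but every element of `Ω` lies in a number
field. -/
def placeRing (P : Ideal (𝓞 Ω)) [hP : P.IsPrime] : ValuationSubring Ω where
  carrier := {x | ∃ n d : 𝓞 Ω, d ∉ P ∧ x * d = n}
  zero_mem' := ⟨0, 1, P.one_notMem, by simp⟩
  one_mem' := ⟨1, 1, P.one_notMem, by simp⟩
  add_mem' := by
    rintro x y ⟨a, b, hb, hx⟩ ⟨c, d, hd, hy⟩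
    exact ⟨a * d + c * b, b * d, hP.mul_notMem hb hd, by
      change (x + y) * ((b : Ω) * (d : Ω)) = (a : Ω) * (d : Ω) + (c : Ω) * (b : Ω)
      rw [← hx, ← hy]; ring⟩
  mul_mem' := by
    rintro x y ⟨a, b, hb, hx⟩ ⟨c, d, hd, hy⟩
    exact ⟨a * c, b * d, hP.mul_notMem hb hd, by
      change x * y * ((b : Ω) * (d : Ω)) = (a : Ω) * (c : Ω)
      rw [← hx, ← hy]; ring⟩
  neg_mem' := by
    rintro x ⟨a, b, hb, hx⟩
    exact ⟨-a, b, hb, by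
      change -x * (b : Ω) = -(a : Ω)
      rw [← hx]; ring⟩
  mem_or_inv_mem' x := by
    rcases eq_or_ne x 0 with rfl | hx
    · exact Or.inl ⟨0, 1, P.one_notMem, by simp⟩
    obtain ⟨n, d, hd, h | h⟩ := exists_mul_eq_or_mul_eq F P x
    · exact Or.inl ⟨n, d, hd, h⟩
    · exact Or.inr ⟨n, d, hd, by rw [← h, inv_mul_cancel_left₀ hx]⟩

/-- The valuation of `Ω` at a prime `P` of `𝓞 Ω`. -/
abbrev placeVal (P : Ideal (𝓞 Ω)) [P.IsPrime] : Valuation Ω (placeRing F P).ValueGroup :=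
  (placeRing F P).valuation

variable {P : Ideal (𝓞 Ω)} [hP : P.IsPrime]

theorem placeVal_le_one_iff {x : Ω} :
    placeVal F P x ≤ 1 ↔ ∃ n d : 𝓞 Ω, d ∉ P ∧ x * d = n :=
  (placeRing F P).valuation_le_one_iff x

theorem placeVal_integer_le_one (a : 𝓞 Ω) : placeVal F P a ≤ 1 :=
  (placeVal_le_one_iff F).2 ⟨a, 1, P.one_notMem, by simp⟩

theorem placeVal_integer_lt_one_iff {a : 𝓞 Ω} : placeVal F P a < 1 ↔ a ∈ P := by
  rw [(placeVal_integer_le_one F a).lt_iff_ne, not_iff_comm]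
  constructor
  · intro h
    refine le_antisymm (placeVal_integer_le_one F a) ?_
    have ha : (a : Ω) ≠ 0 := fun h0 => h (by
      rw [show a = 0 from RingOfIntegers.ext h0]; exact P.zero_mem)
    have : placeVal F P (a : Ω)⁻¹ ≤ 1 :=
      (placeVal_le_one_iff F).2 ⟨1, a, h, by rw [inv_mul_cancel₀ ha]; simp⟩
    rw [map_inv₀] at this
    exact (inv_le_one₀ (zero_lt_iff.2 ((map_ne_zero _).2 ha))).1 this
  · intro h ha
    have ha0 : (a : Ω) ≠ 0 := fun h0 => by rw [h0, map_zero] at h; exact zero_ne_one h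
    have : placeVal F P (a : Ω)⁻¹ ≤ 1 := by rw [map_inv₀, h, inv_one]
    obtain ⟨n, d, hd, h'⟩ := (placeVal_le_one_iff F).1 this
    refine hd ?_
    have : d = n * a := RingOfIntegers.ext (by
      change (d : Ω) = (n : Ω) * (a : Ω)
      rw [← h', mul_comm, mul_inv_cancel_left₀ ha0])
    rw [this]
    exact P.mul_mem_left _ ha

theorem placeVal_integer_eq_one_iff {a : 𝓞 Ω} : placeVal F P a = 1 ↔ a ∉ P := by
  rw [← placeVal_integer_lt_one_iff F, not_lt, le_antisymm_iff]
  exact and_iff_right (placeVal_integer_le_one F a)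

theorem placeVal_lt_one_iff {x : Ω} :
    placeVal F P x < 1 ↔ ∃ n d : 𝓞 Ω, n ∈ P ∧ d ∉ P ∧ x * d = n := by
  constructor
  · intro h
    obtain ⟨n, d, hd, h'⟩ := (placeVal_le_one_iff F).1 h.le
    refine ⟨n, d, ?_, hd, h'⟩
    rw [← placeVal_integer_lt_one_iff F, ← h', map_mul, (placeVal_integer_eq_one_iff F).2 hd,
      mul_one]
    exact h
  · rintro ⟨n, d, hn, hd, h⟩
    rw [← placeVal_integer_lt_one_iff F, ← h, map_mul, (placeVal_integer_eq_one_iff F).2 hd,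
      mul_one] at hn
    exact hn

theorem placeVal_natCast_lt_one_iff {n : ℕ} : placeVal F P (n : Ω) < 1 ↔ (n : 𝓞 Ω) ∈ P := by
  rw [← placeVal_integer_lt_one_iff F]
  simp

theorem placeVal_unit (u : (𝓞 Ω)ˣ) : placeVal F P ((u : 𝓞 Ω) : Ω) = 1 :=
  (placeVal_integer_eq_one_iff F).2 fun h => hP.ne_top (P.eq_top_of_isUnit_mem h u.isUnit)

/-- A natural number prime to the residue characteristic is a unit at `P`. -/
theorem placeVal_natCast_eq_one {ℓ n : ℕ} (hℓ : (ℓ : 𝓞 Ω) ∈ P) (h : n.Coprime ℓ) :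
    placeVal F P (n : Ω) = 1 := by
  have : (n : 𝓞 Ω) ∉ P := natCast_notMem_of_coprime h hℓ
  rw [← placeVal_integer_eq_one_iff F] at this
  simpa using this

theorem placeVal_intCast_lt_one_iff {ℓ : ℕ} (hp : ℓ.Prime) (hℓ : (ℓ : 𝓞 Ω) ∈ P) {n : ℤ} :
    placeVal F P (n : Ω) < 1 ↔ (ℓ : ℤ) ∣ n := by
  constructor
  · intro h
    by_contra hn
    have hc : n.natAbs.Coprime ℓ := by
      rw [Nat.coprime_comm, Nat.Prime.coprime_iff_not_dvd hp]
      rwa [← Int.natCast_dvd]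
    have := placeVal_natCast_eq_one F hℓ hc
    have hn1 : placeVal F P (n : Ω) = 1 := by
      rcases Int.natAbs_eq n with h' | h' <;> rw [h'] <;> simpa using this
    exact h.ne hn1
  · rintro ⟨c, rfl⟩
    have h1 : placeVal F P (ℓ : Ω) < 1 := (placeVal_natCast_lt_one_iff F).2 hℓ
    have h2 : placeVal F P (c : Ω) ≤ 1 := by
      rw [← map_intCast (algebraMap (𝓞 Ω) Ω)]
      exact placeVal_integer_le_one F _
    push_cast
    rw [map_mul]
    exact mul_lt_one_of_lt_of_le h1 h2

section Below

variable {K : Type*} [Field K] [Algebra K Ω]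

/-- The valuation at `P` restricts to the valuation at the prime below it. -/
theorem placeVal_isEquiv [NumberField K] (Q : HeightOneSpectrum (𝓞 K))
    (hQ : P.comap (algebraMap (𝓞 K) (𝓞 Ω)) = Q.asIdeal) :
    ((placeVal F P).comap (algebraMap K Ω)).IsEquiv (Q.valuation K) := by
  have hmem : ∀ a : 𝓞 K, algebraMap (𝓞 K) (𝓞 Ω) a ∈ P ↔ a ∈ Q.asIdeal := fun a => by
    rw [← hQ]; rfl
  rw [Valuation.isEquiv_iff_val_le_one]
  intro x
  rw [Valuation.comap_apply]
  obtain ⟨n, d, h⟩ := Q.exists_primeCompl_mul_eq_or_mul_eq x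
  have hd1 : Q.valuation K (algebraMap (𝓞 K) K d) = 1 := Q.valuation_eq_one_iff_notMem.2 d.2
  have hd2 : placeVal F P (algebraMap K Ω (algebraMap (𝓞 K) K d)) = 1 :=
    (placeVal_integer_eq_one_iff F (a := algebraMap (𝓞 K) (𝓞 Ω) d)).2 fun h => d.2 ((hmem _).1 h)
  have hn1 : Q.valuation K (algebraMap (𝓞 K) K n) ≤ 1 := Q.valuation_le_one n
  have hn2 : placeVal F P (algebraMap K Ω (algebraMap (𝓞 K) K n)) ≤ 1 :=
    placeVal_integer_le_one F (algebraMap (𝓞 K) (𝓞 Ω) n)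
  have hn3 : placeVal F P (algebraMap K Ω (algebraMap (𝓞 K) K n)) < 1 ↔
      Q.valuation K (algebraMap (𝓞 K) K n) < 1 := by
    rw [Q.valuation_lt_one_iff_mem, ← hmem]
    exact placeVal_integer_lt_one_iff F (a := algebraMap (𝓞 K) (𝓞 Ω) n)
  rcases h with h | h
  · have e1 := congrArg (Q.valuation K) h
    have e2 := congrArg (fun y => placeVal F P (algebraMap K Ω y)) h
    simp only [map_mul] at e1 e2
    rw [hd1, mul_one] at e1
    rw [hd2, mul_one] at e2
    rw [e1, e2]
    exact iff_of_true hn2 hn1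
  · have e1 := congrArg (Q.valuation K) h
    have e2 := congrArg (fun y => placeVal F P (algebraMap K Ω y)) h
    simp only [map_mul] at e1 e2
    rw [hd1] at e1
    rw [hd2] at e2
    rw [le_one_iff_not_lt_one_of_mul_eq_one e1 hn1, le_one_iff_not_lt_one_of_mul_eq_one e2 hn2, hn3]

variable (Ω) in
theorem exists_place_over [Algebra.IsAlgebraic K Ω] (Λ : Ideal (𝓞 K)) [Λ.IsPrime] :
    ∃ P : Ideal (𝓞 Ω), P.IsPrime ∧ P.comap (algebraMap (𝓞 K) (𝓞 Ω)) = Λ := by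
  obtain ⟨P, _, hP, h⟩ := Ideal.exists_ideal_over_prime_of_isIntegral (S := 𝓞 Ω) Λ ⊥ (by
    rw [← RingHom.ker_eq_comap_bot,
      (RingHom.injective_iff_ker_eq_bot _).1 (FaithfulSMul.algebraMap_injective (𝓞 K) (𝓞 Ω))]
    exact bot_le)
  exact ⟨P, hP, h⟩

theorem isMaximal_of_natCast_mem {ℓ : ℕ} (hp : ℓ.Prime) (Λ : Ideal (𝓞 K)) [hΛ : Λ.IsPrime]
    (h : (ℓ : 𝓞 K) ∈ Λ) : Λ.IsMaximal := by
  refine Ideal.isMaximal_of_isIntegral_of_isMaximal_comap (R := ℤ) Λ ?_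
  refine (hΛ.comap _).isMaximal fun h0 => ?_
  have : (ℓ : ℤ) ∈ Λ.comap (algebraMap ℤ (𝓞 K)) := by simpa using h
  rw [h0] at this
  exact hp.ne_zero (by simpa using this)

theorem exists_prime_natCast_mem (K : Type*) [Field K] [CharZero K] {ℓ : ℕ} (hp : ℓ.Prime) :
    ∃ Λ : Ideal (𝓞 K), Λ.IsPrime ∧ (ℓ : 𝓞 K) ∈ Λ := by
  have : (Ideal.span {(ℓ : ℤ)}).IsPrime :=
    (Ideal.span_singleton_prime (by simpa using hp.ne_zero)).2 (Nat.prime_iff_prime_int.1 hp)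
  obtain ⟨Λ, _, hΛ, h⟩ := Ideal.exists_ideal_over_prime_of_isIntegral (S := 𝓞 K)
    (Ideal.span {(ℓ : ℤ)}) ⊥ (by
      rw [← RingHom.ker_eq_comap_bot,
        (RingHom.injective_iff_ker_eq_bot _).1 (FaithfulSMul.algebraMap_injective ℤ (𝓞 K))]
      exact bot_le)
  refine ⟨Λ, hΛ, ?_⟩
  have : (ℓ : ℤ) ∈ Λ.comap (algebraMap ℤ (𝓞 K)) := h ▸ Ideal.mem_span_singleton_self _
  simpa using this

theorem ne_zero_of_isCoprime [CharZero K] {ℓ : ℕ} (hp : ℓ.Prime) {b : 𝓞 K}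
    (h : IsCoprime b (ℓ : 𝓞 K)) : (b : K) ≠ 0 := by
  intro h0
  obtain ⟨Λ, hΛ, hm⟩ := exists_prime_natCast_mem K hp
  rw [show b = 0 from RingOfIntegers.ext h0, isCoprime_zero_left] at h
  exact hΛ.ne_top (Λ.eq_top_of_isUnit_mem hm h)

theorem notMem_of_isCoprime {ℓ : ℕ} {b : 𝓞 K} (h : IsCoprime b (ℓ : 𝓞 K)) {Λ : Ideal (𝓞 K)}
    [hΛ : Λ.IsPrime] (hℓ : (ℓ : 𝓞 K) ∈ Λ) : b ∉ Λ := by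
  obtain ⟨u, v, huv⟩ := h
  exact fun hb => Λ.one_notMem (huv ▸ Λ.add_mem (Λ.mul_mem_left _ hb) (Λ.mul_mem_left _ hℓ))

/-- An element that is integral at every prime above `ℓ` lies in the localization at `ℓ`: its
denominators form an ideal prime to `ℓ`. -/
theorem mem_locAt_of_forall [CharZero K] {ℓ : ℕ} (hp : ℓ.Prime) {d : K}
    (h : ∀ Λ : Ideal (𝓞 K), Λ.IsPrime → (ℓ : 𝓞 K) ∈ Λ → ∃ n m : 𝓞 K, m ∉ Λ ∧ d * m = n) :
    d ∈ locAt K ℓ := by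
  let J : Ideal (𝓞 K) :=
    { carrier := {b | ∃ a : 𝓞 K, d * b = a}
      zero_mem' := ⟨0, mul_zero d⟩
      add_mem' := by
        rintro b c ⟨a, ha⟩ ⟨a', ha'⟩
        refine ⟨a + a', ?_⟩
        change d * ((b : K) + (c : K)) = (a : K) + (a' : K)
        rw [← ha, ← ha', mul_add]
      smul_mem' := by
        rintro c b ⟨a, ha⟩
        refine ⟨c * a, ?_⟩
        change d * ((c : K) * (b : K)) = (c : K) * (a : K)
        rw [← ha, mul_left_comm] }
  have hJ : J ⊔ Ideal.span {(ℓ : 𝓞 K)} = ⊤ := by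
    by_contra hne
    obtain ⟨Λ, hΛ, hle⟩ := Ideal.exists_le_maximal _ hne
    have hℓ : (ℓ : 𝓞 K) ∈ Λ :=
      hle (Ideal.mem_sup_right (Ideal.mem_span_singleton_self _))
    obtain ⟨n, m, hm, hnm⟩ := h Λ hΛ.isPrime hℓ
    exact hm (hle (Ideal.mem_sup_left ⟨n, hnm⟩))
  obtain ⟨b, ⟨a, hab⟩, c, hc, hbc⟩ := Submodule.mem_sup.1 ((Ideal.eq_top_iff_one _).1 hJ)
  obtain ⟨e, rfl⟩ := Ideal.mem_span_singleton'.1 hc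
  have hcop : IsCoprime b (ℓ : 𝓞 K) := ⟨1, e, by rw [one_mul]; exact hbc⟩
  have hb0 := ne_zero_of_isCoprime hp hcop
  exact ⟨a, b, hcop, hb0, by rw [← hab, mul_div_cancel_right₀ _ hb0]⟩

theorem placeVal_algebraMap_eq_one {Λ : Ideal (𝓞 K)}
    (h : P.comap (algebraMap (𝓞 K) (𝓞 Ω)) = Λ) {m : 𝓞 K} (hm : m ∉ Λ) :
    placeVal F P (algebraMap K Ω m) = 1 :=
  (placeVal_integer_eq_one_iff F (a := algebraMap (𝓞 K) (𝓞 Ω) m)).2 fun h' => hm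
    (by rw [← h]; exact h')

theorem placeVal_le_one_of_mem_locAt {ℓ : ℕ} (hP : (ℓ : 𝓞 Ω) ∈ P) {d : K} (h : d ∈ locAt K ℓ) :
    placeVal F P (algebraMap K Ω d) ≤ 1 := by
  obtain ⟨a, b, hb, hb0, rfl⟩ := h
  have hℓ : (ℓ : 𝓞 K) ∈ P.comap (algebraMap (𝓞 K) (𝓞 Ω)) := by simpa using hP
  rw [map_div₀, map_div₀, placeVal_algebraMap_eq_one F rfl (notMem_of_isCoprime hb hℓ), div_one]
  exact placeVal_integer_le_one F (algebraMap (𝓞 K) (𝓞 Ω) a)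

theorem placeVal_lt_one_of_mem_radicalAt {ℓ : ℕ} (hP : (ℓ : 𝓞 Ω) ∈ P) {w : locAt K ℓ}
    (h : w ∈ radicalAt K ℓ) : placeVal F P (algebraMap K Ω w) < 1 := by
  obtain ⟨n, hn⟩ := h
  obtain ⟨c, hc⟩ := Ideal.mem_span_singleton'.1 hn
  have h1 : algebraMap K Ω (w : K) ^ n = algebraMap K Ω c * ℓ := by
    rw [← map_pow, ← Subring.coe_pow, ← hc]
    simp
  have h2 : placeVal F P (algebraMap K Ω w) ^ n < 1 := by
    rw [← map_pow, h1, map_mul]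
    exact (mul_le_of_le_one_left' (placeVal_le_one_of_mem_locAt F hP c.2)).trans_lt
      ((placeVal_natCast_lt_one_iff F).2 hP)
  by_contra h3
  exact h2.not_ge (one_le_pow₀ (not_lt.1 h3))

section

variable [CharZero K] [Algebra F K] [Algebra.IsAlgebraic F K] [Algebra.IsAlgebraic K Ω]

/-- An element that is integral at all places above `ℓ` is in the localization at `ℓ`. -/
theorem mem_locAt_of_placeVal_le_one {ℓ : ℕ} (hp : ℓ.Prime) {d : K}
    (h : ∀ (P : Ideal (𝓞 Ω)) [P.IsPrime], (ℓ : 𝓞 Ω) ∈ P → placeVal F P (algebraMap K Ω d) ≤ 1) :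
    d ∈ locAt K ℓ := by
  refine mem_locAt_of_forall hp fun Λ hΛ hℓ => ?_
  obtain ⟨P, hP, hPΛ⟩ := exists_place_over Ω Λ
  have hm : (ℓ : 𝓞 Ω) ∈ P := by
    have : (ℓ : 𝓞 K) ∈ P.comap (algebraMap (𝓞 K) (𝓞 Ω)) := by rwa [hPΛ]
    simpa using this
  have h1 := h P hm
  obtain ⟨n, m, hmΛ, h2 | h2⟩ := exists_mul_eq_or_mul_eq F Λ d
  · exact ⟨n, m, hmΛ, h2⟩
  · refine ⟨m, n, fun hn => ?_, h2⟩
    have h3 : placeVal F P (algebraMap K Ω n) < 1 :=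
      (placeVal_integer_lt_one_iff F (a := algebraMap (𝓞 K) (𝓞 Ω) n)).2 (by
        rw [← hPΛ] at hn; exact hn)
    have h4 := congrArg (fun y => placeVal F P (algebraMap K Ω y)) h2
    simp only [map_mul, placeVal_algebraMap_eq_one F hPΛ hmΛ] at h4
    exact ((mul_le_of_le_one_left' h1).trans_lt h3).ne h4

/-- An element that is integral at the places above `ℓ` and vanishes at all of them is in the
radical of `ℓ`. -/
theorem mem_radicalAt_of_placeVal_lt_one {ℓ : ℕ} (hp : ℓ.Prime) {d : K}
    (h : ∀ (P : Ideal (𝓞 Ω)) [P.IsPrime], (ℓ : 𝓞 Ω) ∈ P → placeVal F P (algebraMap K Ω d) < 1) :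
    ∃ w ∈ radicalAt K ℓ, (w : K) = d := by
  have hd : d ∈ locAt K ℓ := mem_locAt_of_placeVal_le_one F hp fun P _ hP => (h P hP).le
  refine ⟨⟨d, hd⟩, ?_, rfl⟩
  obtain ⟨a, b, hb, hb0, hdab⟩ := hd
  rw [radicalAt, Ideal.radical_eq_sInf, Ideal.mem_sInf]
  rintro q ⟨hq, hqp⟩
  have hℓq : (ℓ : locAt K ℓ) ∈ q := hq (Ideal.mem_span_singleton_self _)
  let ι : 𝓞 K →+* locAt K ℓ :=
    (algebraMap (𝓞 K) K).codRestrict (locAt K ℓ) (algebraMap_mem_locAt K ℓ)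
  have hℓ : (ℓ : 𝓞 K) ∈ q.comap ι := by simpa using hℓq
  obtain ⟨P, hP, hPΛ⟩ := exists_place_over Ω (q.comap ι)
  have hm : (ℓ : 𝓞 Ω) ∈ P := by
    have : (ℓ : 𝓞 K) ∈ P.comap (algebraMap (𝓞 K) (𝓞 Ω)) := by rwa [hPΛ]
    simpa using this
  have hbΛ : b ∉ q.comap ι := notMem_of_isCoprime hb hℓ
  have hda : d * b = a := by rw [hdab, div_mul_cancel₀ _ hb0]
  have haΛ : a ∈ q.comap ι := by
    have h3 := h P hm
    have h4 := congrArg (fun y => placeVal F P (algebraMap K Ω y)) hda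
    simp only [map_mul, placeVal_algebraMap_eq_one F hPΛ hbΛ, mul_one] at h4
    rw [h4] at h3
    rw [← hPΛ]
    exact (placeVal_integer_lt_one_iff F (a := algebraMap (𝓞 K) (𝓞 Ω) a)).1 h3
  refine (hqp.mem_or_mem (x := ⟨d, ⟨a, b, hb, hb0, hdab⟩⟩) (y := ι b) ?_).resolve_right hbΛ
  have : (⟨d, ⟨a, b, hb, hb0, hdab⟩⟩ : locAt K ℓ) * ι b = ι a := Subtype.ext hda
  rw [this]
  exact haΛ

end

end Below

/-- An automorphism in the inertia group at `P` acts trivially modulo the maximal ideal of the local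
ring at `P`. -/
theorem placeVal_sub_lt_one_of_inertia (g : Ω ≃ₐ[F] Ω)
    (hg : ∀ x : 𝓞 Ω, RingOfIntegers.mapAlgEquiv g x - x ∈ P) {t : Ω} (ht : placeVal F P t ≤ 1) :
    placeVal F P (g t - t) < 1 := by
  obtain ⟨n, d, hd, h⟩ := (placeVal_le_one_iff F).1 ht
  set n' := RingOfIntegers.mapAlgEquiv g n with hn'
  set d' := RingOfIntegers.mapAlgEquiv g d with hd'
  have hd1 : d' ∉ P := fun h' => hd (by
    have := P.sub_mem h' (hg d)
    rwa [sub_sub_cancel] at this)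
  have h' : g t * d' = n' := by
    have := congrArg g h
    rwa [map_mul] at this
  refine (placeVal_lt_one_iff F).2
    ⟨(n' - n) * d - n * (d' - d), d' * d, ?_, hP.mul_notMem hd1 hd, ?_⟩
  · exact P.sub_mem (P.mul_mem_right _ (hg n)) (P.mul_mem_left _ (hg d))
  · change (g t - t) * ((d' : Ω) * (d : Ω)) =
      ((n' : Ω) - (n : Ω)) * (d : Ω) - (n : Ω) * ((d' : Ω) - (d : Ω))
    rw [← h, ← h']
    ring

end Places

/-! ### Ramification in cyclotomic extensions -/

section Ramification

open IsDedekindDomain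

/-- Distinct `n`-th roots of unity stay distinct modulo an ideal prime to `n`. -/
theorem natCast_mem_of_pow_eq_one {R : Type*} [CommRing R] [IsDomain R] {I : Ideal R} {n : ℕ}
    {ξ : R} (h : ξ ^ n = 1) (h1 : ξ ≠ 1) (hI : ξ - 1 ∈ I) : (n : R) ∈ I := by
  have hs : ∑ i ∈ Finset.range n, ξ ^ i = 0 := by
    have := mul_geom_sum ξ n
    rw [h, sub_self] at this
    exact (mul_eq_zero.1 this).resolve_left (sub_ne_zero.2 h1)
  have h2 := congrArg (Ideal.Quotient.mk I) hs
  have h3 : Ideal.Quotient.mk I ξ = 1 := by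
    rw [← map_one (Ideal.Quotient.mk I)]
    exact Ideal.Quotient.eq.2 hI
  rw [map_sum] at h2
  simp only [map_pow, h3, one_pow, Finset.sum_const, Finset.card_range, map_zero] at h2
  rw [← Ideal.Quotient.eq_zero_iff_mem]
  simpa using h2

variable {F K : Type*} [Field F] [NumberField F] [Field K] [NumberField K] [Algebra F K]

/-- The extension generated by the `n`-th roots of unity is unramified at primes not dividing `n`:
the inertia group fixes all these roots of unity. -/
theorem ramificationIdx_eq_one_of_adjoin [IsGalois F K] {n : ℕ} (hn0 : n ≠ 0)
    (hK : IntermediateField.adjoin F {ζ : K | ζ ^ n = 1} = ⊤) (v : HeightOneSpectrum (𝓞 F))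
    (Q : HeightOneSpectrum (𝓞 K)) [Q.asIdeal.LiesOver v.asIdeal] (hn : (n : 𝓞 K) ∉ Q.asIdeal) :
    v.asIdeal.ramificationIdx' Q.asIdeal = 1 := by
  have hfin : Finite (𝓞 F ⧸ v.asIdeal) := Ideal.finiteQuotientOfFreeOfNeBot v.asIdeal v.ne_bot
  have hI : Q.asIdeal.inertia (K ≃ₐ[F] K) = ⊥ := by
    rw [eq_bot_iff]
    intro g hg
    rw [Subgroup.mem_bot]
    have hroot : ∀ ζ : K, ζ ^ n = 1 → g ζ = ζ := by
      intro ζ hζ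
      by_contra hne
      have hζ0 : ζ ≠ 0 := fun h0 => by rw [h0, zero_pow hn0] at hζ; exact zero_ne_one hζ
      have hint : ∀ y : K, y ^ n = 1 → IsIntegral ℤ y := fun y hy =>
        IsIntegral.of_pow (Nat.pos_of_ne_zero hn0) (hy ▸ isIntegral_one)
      have hinv : (ζ⁻¹) ^ n = 1 := by rw [inv_pow, hζ, inv_one]
      let z : 𝓞 K := ⟨ζ, hint ζ hζ⟩
      let w : 𝓞 K := ⟨ζ⁻¹, hint _ hinv⟩
      have hzw : z * w = 1 := RingOfIntegers.ext (mul_inv_cancel₀ hζ0)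
      refine hn (natCast_mem_of_pow_eq_one (ξ := (g • z) * w) ?_ ?_ ?_)
      · refine RingOfIntegers.ext ?_
        change (g ζ * ζ⁻¹) ^ n = 1
        rw [mul_pow, ← map_pow, hζ, hinv, map_one, one_mul]
      · intro h
        have h' : g ζ * ζ⁻¹ = 1 := congrArg (fun y : 𝓞 K => (y : K)) h
        exact hne ((mul_inv_eq_one₀ hζ0).1 h')
      · have := Q.asIdeal.mul_mem_right w (hg z)
        rwa [sub_mul, hzw] at this
    have hle : (⊤ : IntermediateField F K) ≤ IntermediateField.fixedField (Subgroup.zpowers g) := by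
      rw [← hK, IntermediateField.adjoin_le_iff]
      intro ζ hζ
      rw [SetLike.mem_coe, IntermediateField.mem_fixedField_iff]
      intro f hf
      have : Subgroup.zpowers g ≤ MulAction.stabilizer (K ≃ₐ[F] K) ζ := by
        rw [Subgroup.zpowers_le]
        exact hroot ζ hζ
      exact this hf
    refine AlgEquiv.ext fun x => ?_
    exact (IntermediateField.mem_fixedField_iff _ x).1 (hle IntermediateField.mem_top) g
      (Subgroup.mem_zpowers g)
  have : Finite v.asIdeal.ResidueField := Finite.of_surjective _
    (Ideal.bijective_algebraMap_quotient_residueField v.asIdeal).surjective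
  have h1 := Ideal.card_inertia_eq_ramificationIdxIn (G := K ≃ₐ[F] K) v.asIdeal Q.asIdeal
  rw [hI, Subgroup.card_bot,
    Ideal.ramificationIdxIn_eq_ramificationIdx v.asIdeal Q.asIdeal (K ≃ₐ[F] K)] at h1
  rw [Ideal.ramificationIdx'_eq_ramificationIdx v.asIdeal Q.asIdeal v.ne_bot, ← h1]

theorem valuation_algebraMap_of_adjoin [IsGalois F K] {n : ℕ} (hn0 : n ≠ 0)
    (hK : IntermediateField.adjoin F {ζ : K | ζ ^ n = 1} = ⊤) (v : HeightOneSpectrum (𝓞 F))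
    (Q : HeightOneSpectrum (𝓞 K)) (hQ : Q.asIdeal.comap (algebraMap (𝓞 F) (𝓞 K)) = v.asIdeal)
    (hn : (n : 𝓞 K) ∉ Q.asIdeal) (x : F) :
    Q.valuation K (algebraMap F K x) = v.valuation F x := by
  have : Q.asIdeal.LiesOver v.asIdeal := ⟨hQ.symm⟩
  rw [← HeightOneSpectrum.valuation_liesOver K v Q, ramificationIdx_eq_one_of_adjoin hn0 hK v Q hn,
    pow_one]

/-- A prime number that is unramified in `F` is a uniformizer at the primes of `F` above it. -/
theorem valuation_natCast_of_ramificationIdx {ℓ : ℕ} (hp : ℓ.Prime) (v : HeightOneSpectrum (𝓞 F))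
    (hℓ : (ℓ : 𝓞 F) ∈ v.asIdeal) (h : v.asIdeal.ramificationIdx ℤ = 1) :
    v.valuation F (ℓ : F) = WithZero.exp (-1 : ℤ) := by
  have h0 : (ℓ : 𝓞 F) ≠ 0 := by exact_mod_cast hp.ne_zero
  have hprime : (Ideal.span {(ℓ : ℤ)}).IsPrime :=
    (Ideal.span_singleton_prime (by simpa using hp.ne_zero)).2 (Nat.prime_iff_prime_int.1 hp)
  have hmax : (Ideal.span {(ℓ : ℤ)}).IsMaximal :=
    hprime.isMaximal (by simpa using hp.ne_zero)
  have hover : v.asIdeal.LiesOver (Ideal.span {(ℓ : ℤ)}) := by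
    refine ⟨hmax.eq_of_le (Ideal.IsPrime.comap (algebraMap ℤ (𝓞 F))).ne_top ?_⟩
    rw [Ideal.span_singleton_le_iff_mem]
    simpa using hℓ
  have hmap : (Ideal.span {(ℓ : ℤ)}).map (algebraMap ℤ (𝓞 F)) = Ideal.span {(ℓ : 𝓞 F)} := by
    rw [Ideal.map_span, Set.image_singleton]
    simp
  rw [Ideal.IsDedekindDomain.ramificationIdx_eq_multiplicity (Ideal.span {(ℓ : ℤ)}) v.asIdeal
    (by rw [hmap]; simpa using hp.ne_zero), hmap] at h
  have := v.intValuation_eq_exp_neg_multiplicity h0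
  rw [h] at this
  rw [← map_natCast (algebraMap (𝓞 F) F), v.valuation_of_algebraMap, this]
  rfl

end Ramification

/-! ### Totally ramified cyclotomic extensions -/

section TotallyRamified

open Polynomial

variable {F Ω Γ : Type*} [Field F] [Field Ω] [Algebra F Ω] [LinearOrderedCommGroupWithZero Γ]
  (v : Valuation Ω Γ)

theorem valuation_eq_one_of_pow_eq_one {ζ : Ω} {n : ℕ} (hn : n ≠ 0) (h : ζ ^ n = 1) : v ζ = 1 := by
  have := congrArg v h
  rw [map_pow, map_one] at this
  exact (pow_eq_one_iff_of_nonneg zero_le hn).1 this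

theorem valuation_one_sub_pow_le {ζ : Ω} (h : v ζ ≤ 1) (k : ℕ) : v (1 - ζ ^ k) ≤ v (1 - ζ) := by
  rw [← mul_neg_geom_sum ζ k, map_mul]
  refine mul_le_of_le_one_right' (v.map_sum_le fun i _ => ?_)
  rw [map_pow]
  exact pow_le_one₀ zero_le h

variable {v} {ℓ : ℕ} (hp : ℓ.Prime) {ζ : Ω} (hζ : IsPrimitiveRoot ζ ℓ)

include hp hζ

theorem valuation_one_sub_eq {μ : Ω} (hμ : IsPrimitiveRoot μ ℓ) : v (1 - μ) = v (1 - ζ) := by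
  have key : ∀ {x y : Ω}, IsPrimitiveRoot x ℓ → IsPrimitiveRoot y ℓ → v (1 - y) ≤ v (1 - x) := by
    intro x y hx hy
    have : NeZero ℓ := ⟨hp.ne_zero⟩
    obtain ⟨k, _, rfl⟩ := hx.eq_pow_of_pow_eq_one hy.pow_eq_one
    exact valuation_one_sub_pow_le v
      (valuation_eq_one_of_pow_eq_one v hp.ne_zero hx.pow_eq_one).le k
  exact le_antisymm (key hζ hμ) (key hμ hζ)

theorem valuation_one_sub_pow_eq : v (1 - ζ) ^ (ℓ - 1) = v ℓ := by
  have : Fact ℓ.Prime := ⟨hp⟩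
  have h1 : (∏ μ ∈ primitiveRoots ℓ Ω, (1 - μ)) = ℓ := by
    have := eval_one_cyclotomic_prime (R := Ω) (p := ℓ)
    rw [cyclotomic_eq_prod_X_sub_primitiveRoots hζ, eval_prod] at this
    simpa using this
  rw [← h1, map_prod, Finset.prod_congr rfl (fun μ hμ =>
    valuation_one_sub_eq hp hζ (isPrimitiveRoot_of_mem_primitiveRoots hμ)), Finset.prod_const,
    hζ.card_primitiveRoots, Nat.totient_prime hp]

variable (hℓ : v ℓ < 1) (E : IntermediateField F Ω) (hE : ∀ x ∈ E, v x < 1 → v x ≤ v ℓ)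

include hℓ in
theorem valuation_one_sub_lt_one : v (1 - ζ) < 1 := by
  by_contra h
  rw [← valuation_one_sub_pow_eq hp hζ] at hℓ
  exact hℓ.not_ge (one_le_pow₀ (not_lt.1 h))

include hℓ hE

theorem valuation_mul_pow_ne {i j : ℕ} (hij : i < j) (hj : j < ℓ - 1) {c d : Ω} (hc : c ∈ E)
    (hd : d ∈ E) (hd0 : d ≠ 0) (hζ1 : v (1 - ζ) ≠ 0) :
    v (c * (1 - ζ) ^ i) ≠ v (d * (1 - ζ) ^ j) := by
  intro h
  have hlt := valuation_one_sub_lt_one hp hζ hℓ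
  have hvd : v d ≠ 0 := (map_ne_zero v).2 hd0
  have h1 : v (c / d) = v (1 - ζ) ^ (j - i) := by
    rw [map_div₀, div_eq_iff hvd]
    rw [map_mul, map_mul, map_pow, map_pow, ← Nat.sub_add_cancel hij.le, pow_add, ← mul_assoc] at h
    rw [mul_right_cancel₀ (pow_ne_zero _ hζ1) h, mul_comm]
  have h2 := hE _ (div_mem hc hd) (by
    rw [h1]
    exact pow_lt_one₀ zero_le hlt (by omega))
  rw [h1, ← valuation_one_sub_pow_eq hp hζ] at h2
  exact h2.not_gt (pow_lt_pow_right_of_lt_one₀ (zero_lt_iff.2 hζ1) hlt (by omega))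

/-- If `ℓ` is a uniformizer of `E`, then the terms of an expression of degree less than `ℓ - 1` in
`1 - ζ` have distinct valuations, so none of them exceeds the sum. -/
theorem valuation_term_le_sum {c : ℕ → Ω} (hc : ∀ i, c i ∈ E) (hζ1 : v (1 - ζ) ≠ 0)
    {j : ℕ} (hj : j < ℓ - 1) :
    v (c j * (1 - ζ) ^ j) ≤ v (∑ i ∈ Finset.range (ℓ - 1), c i * (1 - ζ) ^ i) := by
  obtain ⟨m, hm, hmax⟩ := Finset.exists_max_image (Finset.range (ℓ - 1))
    (fun i => v (c i * (1 - ζ) ^ i)) ⟨j, Finset.mem_range.2 hj⟩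
  refine (hmax j (Finset.mem_range.2 hj)).trans ?_
  rcases eq_or_ne (v (c m * (1 - ζ) ^ m)) 0 with h0 | h0
  · rw [h0]
    exact zero_le
  refine (v.map_sum_eq_of_lt (f := fun i => c i * (1 - ζ) ^ i) hm fun i hi => ?_).ge
  rw [Finset.mem_sdiff, Finset.mem_singleton] at hi
  refine lt_of_le_of_ne (hmax i hi.1) fun heq => ?_
  have hcm : c m ≠ 0 := fun h => h0 (by simp [h])
  have hci : c i ≠ 0 := fun h => h0 (by rw [← heq]; simp [h])
  rcases lt_or_gt_of_ne hi.2 with h | h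
  · exact valuation_mul_pow_ne hp hζ hℓ E hE h (Finset.mem_range.1 hm) (hc i) (hc m) hcm hζ1 heq
  · exact valuation_mul_pow_ne hp hζ hℓ E hE h (Finset.mem_range.1 hi.1) (hc m) (hc i) hci hζ1
      heq.symm

theorem valuation_term_lt_one {c : ℕ → Ω} (hc : ∀ i, c i ∈ E) (hζ1 : v (1 - ζ) ≠ 0)
    (h : v (∑ i ∈ Finset.range (ℓ - 1), c i * (1 - ζ) ^ i) ≤ 1) {j : ℕ} (hj0 : 0 < j)
    (hj : j < ℓ - 1) : v (c j * (1 - ζ) ^ j) < 1 := by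
  refine lt_of_le_of_ne ((valuation_term_le_sum hp hζ hℓ E hE hc hζ1 hj).trans h) fun h1 => ?_
  have hcj : c j ≠ 0 := fun h => by rw [h, zero_mul, map_zero] at h1; exact zero_ne_one h1
  exact valuation_mul_pow_ne hp hζ hℓ E hE hj0 hj E.one_mem (hc j) hcj hζ1 (by rw [h1]; simp)

/-- The cyclotomic polynomial of prime order `ℓ` stays irreducible over a field in which `ℓ` is a
uniformizer. -/
theorem minpoly_eq_cyclotomic (hζ1 : v (1 - ζ) ≠ 0) : minpoly E ζ = cyclotomic ℓ E := by
  have hroot : aeval ζ (cyclotomic ℓ E) = 0 := by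
    rw [aeval_def, eval₂_eq_eval_map, map_cyclotomic]
    exact hζ.isRoot_cyclotomic hp.pos
  have hint : IsIntegral E ζ := ⟨_, cyclotomic.monic ℓ E, hroot⟩
  refine (Polynomial.eq_of_monic_of_dvd_of_natDegree_le (minpoly.monic hint)
    (cyclotomic.monic ℓ E) (minpoly.dvd E ζ hroot) ?_).symm
  rw [natDegree_cyclotomic, Nat.totient_prime hp]
  by_contra! hlt
  set q := (minpoly E ζ).comp (1 - X) with hq
  have hd1 : (1 - X : E[X]).natDegree = 1 := by
    rw [natDegree_sub_eq_right_of_natDegree_lt] <;> simp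
  have hqdeg : q.natDegree = (minpoly E ζ).natDegree := by
    rw [hq, natDegree_comp, hd1, mul_one]
  have hq0 : q ≠ 0 := by
    intro h0
    have h1 : (q.comp (1 - X)) = minpoly E ζ := by
      rw [hq, comp_assoc]
      simp
    rw [h0, zero_comp] at h1
    exact minpoly.ne_zero hint h1.symm
  have hqr : aeval (1 - ζ) q = 0 := by
    rw [hq, aeval_comp]
    simp
  rw [aeval_eq_sum_range' (hqdeg.trans_lt hlt)] at hqr
  simp only [Algebra.smul_def] at hqr
  refine hq0 (Polynomial.ext fun j => ?_)
  rw [coeff_zero]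
  rcases lt_or_ge j (ℓ - 1) with hj | hj
  · have := valuation_term_le_sum hp hζ hℓ E hE (c := fun i => algebraMap E Ω (q.coeff i))
      (fun i => (q.coeff i).2) hζ1 hj
    rw [hqr, map_zero, le_zero_iff, map_mul, map_pow, mul_eq_zero,
      or_iff_left (pow_ne_zero _ hζ1), map_eq_zero, map_eq_zero] at this
    exact this
  · exact coeff_eq_zero_of_natDegree_lt ((hqdeg.trans_lt hlt).trans_le hj)

omit hℓ hE in
theorem exists_sum_of_mem_adjoin {t : Ω} (ht : t ∈ IntermediateField.adjoin E {ζ}) :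
    ∃ c : ℕ → Ω, (∀ i, c i ∈ E) ∧ t = ∑ i ∈ Finset.range (ℓ - 1), c i * (1 - ζ) ^ i := by
  have hroot : aeval ζ (cyclotomic ℓ E) = 0 := by
    rw [aeval_def, eval₂_eq_eval_map, map_cyclotomic]
    exact hζ.isRoot_cyclotomic hp.pos
  have hmon := cyclotomic.monic ℓ E
  have hint : IsIntegral E ζ := ⟨_, hmon, hroot⟩
  rw [← IntermediateField.mem_toSubalgebra,
    IntermediateField.adjoin_simple_toSubalgebra_of_isAlgebraic hint.isAlgebraic,
    Algebra.adjoin_singleton_eq_range_aeval] at ht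
  obtain ⟨p, rfl⟩ := ht
  set q := (p %ₘ cyclotomic ℓ E).comp (1 - X) with hq
  have hd1 : (1 - X : E[X]).natDegree = 1 := by
    rw [natDegree_sub_eq_right_of_natDegree_lt] <;> simp
  have hqdeg : q.natDegree < ℓ - 1 := by
    rw [hq, natDegree_comp, hd1, mul_one]
    refine (natDegree_modByMonic_lt _ hmon ?_).trans_eq ?_
    · intro h
      have := congrArg natDegree h
      rw [natDegree_cyclotomic, natDegree_one, Nat.totient_eq_zero] at this
      exact hp.ne_zero this
    · rw [natDegree_cyclotomic, Nat.totient_prime hp]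
  refine ⟨fun i => algebraMap E Ω (q.coeff i), fun i => (q.coeff i).2, ?_⟩
  have h1 : aeval ζ p = aeval (1 - ζ) q := by
    rw [hq, aeval_comp]
    simp only [map_sub, map_one, aeval_X, sub_sub_cancel]
    conv_lhs => rw [← modByMonic_add_div p (cyclotomic ℓ E)]
    rw [map_add, map_mul, hroot, zero_mul, add_zero]
  change aeval ζ p = _
  rw [h1, aeval_eq_sum_range' hqdeg]
  simp only [Algebra.smul_def]

/-- If `ℓ` is a uniformizer of `E`, then the extension `E(ζ) / E` is totally ramified at `ℓ`: its
automorphisms act trivially on the residue field. -/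
theorem valuation_map_sub_lt_one (hζ1 : v (1 - ζ) ≠ 0) (g : Ω →+* Ω) (hg : ∀ x ∈ E, g x = x) {t : Ω}
    (ht : t ∈ IntermediateField.adjoin E {ζ}) (hvt : v t ≤ 1) : v (g t - t) < 1 := by
  obtain ⟨c, hc, rfl⟩ := exists_sum_of_mem_adjoin hp hζ E ht
  rw [map_sum, ← Finset.sum_sub_distrib]
  refine v.map_sum_lt one_ne_zero fun i hi => ?_
  rcases Nat.eq_zero_or_pos i with rfl | hi0
  · rw [pow_zero, mul_one, hg _ (hc 0), sub_self, map_zero]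
    exact zero_lt_one
  have h1 := valuation_term_lt_one hp hζ hℓ E hE hc hζ1 hvt hi0 (Finset.mem_range.1 hi)
  have h2 : v (g (c i * (1 - ζ) ^ i)) = v (c i * (1 - ζ) ^ i) := by
    rw [map_mul, hg _ (hc i), map_pow, map_sub, map_one, map_mul, map_pow,
      valuation_one_sub_eq hp hζ (hζ.map_of_injective g.injective), ← map_pow, ← map_mul]
  exact (v.map_sub _ _).trans_lt (max_lt (h2.trans_lt h1) h1)

end TotallyRamified

/-! ### The Galois theory of `F_𝐫` -/

section GaloisTheory

set_option linter.unusedSectionVars false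

open IsDedekindDomain

variable {F : Type*} [Field F] [NumberField F] {Fbar : Type*} [Field Fbar] [Algebra F Fbar]
  [IsAlgClosure F Fbar] {M : ℕ}

/-- An intermediate field generated by a set that is stable under all automorphisms is normal. -/
theorem normal_adjoin_of_stable {K L : Type*} [Field K] [Field L] [Algebra K L] [Normal K L]
    (S : Set L) (hS : ∀ (σ : L ≃ₐ[K] L), ∀ x ∈ S, σ x ∈ S) :
    Normal K (IntermediateField.adjoin K S) := by
  rw [IntermediateField.normal_iff_forall_map_le']
  intro σ
  rw [IntermediateField.adjoin_map, IntermediateField.adjoin_le_iff]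
  rintro _ ⟨x, hx, rfl⟩
  exact IntermediateField.subset_adjoin K S (hS σ x hx)

instance normal_FR : Normal F (FR F Fbar M) := by
  have : Normal F Fbar := IsAlgClosure.normal F Fbar
  refine normal_adjoin_of_stable _ fun σ x hx => ?_
  obtain ⟨n, hn, h⟩ := hx
  exact ⟨n, hn, by rw [← map_pow, h, map_one]⟩

instance isGalois_FR : IsGalois F (FR F Fbar M) := {}

instance normal_subField (n : ℕ) : Normal F (subField F Fbar M n) :=
  normal_adjoin_of_stable _ fun σ x hx => by
    rw [Set.mem_ofPred_eq] at hx ⊢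
    rw [← map_pow, hx, map_one]

instance isGalois_subField (n : ℕ) : IsGalois F (subField F Fbar M n) := {}

theorem finiteDimensional_subField {n : ℕ} (hn : n ≠ 0) :
    FiniteDimensional F (subField F Fbar M n) := by
  have hfin : Finite {ζ : FR F Fbar M | ζ ^ n = 1} := by
    classical
    refine Set.Finite.subset
      (Polynomial.X ^ n - 1 : Polynomial (FR F Fbar M)).roots.toFinset.finite_toSet ?_
    intro ζ hζ
    rw [Set.mem_ofPred_eq] at hζ
    have : (Polynomial.X ^ n - 1 : Polynomial (FR F Fbar M)) ≠ 0 :=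
      Polynomial.X_pow_sub_C_ne_zero (Nat.pos_of_ne_zero hn) 1
    simp [this, hζ]
  exact IntermediateField.finiteDimensional_adjoin fun x _ => Algebra.IsIntegral.isIntegral x

theorem numberField_subField {n : ℕ} (hn : n ≠ 0) : NumberField (subField F Fbar M n) := by
  have := finiteDimensional_subField (F := F) (Fbar := Fbar) (M := M) hn
  exact numberField_intermediateField F _

theorem adjoin_subField_eq_top (n : ℕ) :
    IntermediateField.adjoin F {ζ : subField F Fbar M n | ζ ^ n = 1} = ⊤ := by
  apply IntermediateField.lift_injective
  rw [IntermediateField.lift_top, IntermediateField.lift_adjoin]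
  refine congrArg (IntermediateField.adjoin F) (Set.ext fun ζ => ⟨?_, fun h => ?_⟩)
  · rintro ⟨z, hz, rfl⟩
    exact congrArg Subtype.val hz
  · exact ⟨⟨ζ, IntermediateField.subset_adjoin F _ h⟩, Subtype.ext h, rfl⟩

theorem subField_mono {m n : ℕ} (h : m ∣ n) : subField F Fbar M m ≤ subField F Fbar M n := by
  refine IntermediateField.adjoin.mono F _ _ fun ζ hζ => ?_
  obtain ⟨c, rfl⟩ := h
  rw [Set.mem_ofPred_eq] at hζ ⊢
  rw [pow_mul, hζ, one_pow]

variable (Fbar) in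
/-- The field `F_𝐬` generated over `F` by all roots of unity of order dividing `𝐬`. -/
def superField (s : SuperDiv F M) : IntermediateField F (FR F Fbar M) :=
  IntermediateField.adjoin F {ζ | ∃ n : ℕ, Divides n s ∧ ζ ^ n = 1}

theorem subField_le_superField {n : ℕ} {s : SuperDiv F M} (h : Divides n s) :
    subField F Fbar M n ≤ superField Fbar s :=
  IntermediateField.adjoin.mono F _ _ fun _ hζ => ⟨n, h, hζ⟩

theorem superField_univ : superField Fbar (Set.univ : SuperDiv F M) = ⊤ := by
  apply IntermediateField.lift_injective
  rw [IntermediateField.lift_top]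
  unfold superField
  rw [IntermediateField.lift_adjoin]
  refine congrArg (IntermediateField.adjoin F) (Set.ext fun ζ => ⟨?_, fun h => ?_⟩)
  · rintro ⟨z, ⟨n, hn, hz⟩, rfl⟩
    exact ⟨n, hn, congrArg Subtype.val hz⟩
  · have h' := h
    obtain ⟨n, hn, hz⟩ := h
    exact ⟨⟨ζ, IntermediateField.subset_adjoin F _ h'⟩, ⟨n, hn, Subtype.ext hz⟩, rfl⟩

/-- Every element of `F_𝐬` lies at a finite level. -/
theorem exists_mem_subField {s : SuperDiv F M} {x : FR F Fbar M} (hx : x ∈ superField Fbar s) :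
    ∃ n, Divides n s ∧ x ∈ subField F Fbar M n := by
  have hmono : ∀ {m n : ℕ} {y : FR F Fbar M}, y ∈ subField F Fbar M m → m ∣ n →
      y ∈ subField F Fbar M n := fun hy h => subField_mono h hy
  induction hx using IntermediateField.adjoin_induction with
  | mem x hx =>
    obtain ⟨n, hn, h⟩ := hx
    exact ⟨n, hn, IntermediateField.subset_adjoin F _ h⟩
  | algebraMap x => exact ⟨1, divides_one s, IntermediateField.algebraMap_mem _ x⟩
  | add x y _ _ hx hy =>
    obtain ⟨m, hm, hxm⟩ := hx
    obtain ⟨n, hn, hyn⟩ := hy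
    exact ⟨m.lcm n, hm.lcm hn, add_mem (hmono hxm (Nat.dvd_lcm_left m n))
      (hmono hyn (Nat.dvd_lcm_right m n))⟩
  | inv x _ hx =>
    obtain ⟨m, hm, hxm⟩ := hx
    exact ⟨m, hm, inv_mem hxm⟩
  | mul x y _ _ hx hy =>
    obtain ⟨m, hm, hxm⟩ := hx
    obtain ⟨n, hn, hyn⟩ := hy
    exact ⟨m.lcm n, hm.lcm hn, mul_mem (hmono hxm (Nat.dvd_lcm_left m n))
      (hmono hyn (Nat.dvd_lcm_right m n))⟩

/-- Galois descent in `F_𝐫 / K`. -/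
theorem mem_of_forall_fixed (K : IntermediateField F (FR F Fbar M)) {x : FR F Fbar M}
    (h : ∀ g : G F Fbar M, (∀ y ∈ K, g y = y) → g x = x) : x ∈ K := by
  rw [← InfiniteGalois.fixedField_fixingSubgroup K, IntermediateField.mem_fixedField_iff]
  intro g hg
  refine h g fun y hy => ?_
  exact (IntermediateField.mem_fixingSubgroup_iff K g).1 hg y hy

theorem mem_range_of_forall_fixed {x : FR F Fbar M} (h : ∀ g : G F Fbar M, g x = x) :
    ∃ a : F, algebraMap F (FR F Fbar M) a = x := by
  have := mem_of_forall_fixed (⊥ : IntermediateField F (FR F Fbar M)) (x := x) fun g _ => h g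
  exact IntermediateField.mem_bot.1 this

theorem map_mem_of_normal (K : IntermediateField F (FR F Fbar M)) [Normal F K] (g : G F Fbar M)
    {x : FR F Fbar M} (hx : x ∈ K) : g x ∈ K :=
  IntermediateField.normal_iff_forall_map_le'.1 ‹_› g ⟨x, hx, rfl⟩

/-! ### Ramification in `F_𝐫` -/

/-- The prime of a subfield `K` below a place above `ℓ`. -/
def primeBelow (K : Type*) [Field K] [CharZero K] {Ω : Type*} [Field Ω] [Algebra K Ω]
    (P : Ideal (𝓞 Ω)) [hP : P.IsPrime] {ℓ : ℕ} (hp : ℓ.Prime) (hℓ : (ℓ : 𝓞 Ω) ∈ P) :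
    HeightOneSpectrum (𝓞 K) where
  asIdeal := P.comap (algebraMap (𝓞 K) (𝓞 Ω))
  isPrime := hP.comap _
  ne_bot h := by
    have : (ℓ : 𝓞 K) ∈ P.comap (algebraMap (𝓞 K) (𝓞 Ω)) := by simpa using hℓ
    rw [h, Ideal.mem_bot] at this
    exact hp.ne_zero (by exact_mod_cast this)

theorem natCast_mem_primeBelow (K : Type*) [Field K] [CharZero K] {Ω : Type*} [Field Ω]
    [Algebra K Ω] (P : Ideal (𝓞 Ω)) [hP : P.IsPrime] {ℓ : ℕ} (hp : ℓ.Prime)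
    (hℓ : (ℓ : 𝓞 Ω) ∈ P) : (ℓ : 𝓞 K) ∈ (primeBelow K P hp hℓ).asIdeal := by
  change algebraMap (𝓞 K) (𝓞 Ω) ℓ ∈ P
  simpa using hℓ

theorem valuation_natCast_RPrime (ℓ : RPrime F M) (v : HeightOneSpectrum (𝓞 F))
    (h : (ℓ.1 : 𝓞 F) ∈ v.asIdeal) : v.valuation F (ℓ.1 : F) = WithZero.exp (-1 : ℤ) :=
  valuation_natCast_of_ramificationIdx ℓ.2.1 v h (ℓ.2.2.2.2 _ v.isPrime h).1

/-- At finite levels prime to `ℓ`, the prime `ℓ` is a uniformizer. -/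
theorem placeVal_le_natCast_of_mem_subField (ℓ : RPrime F M) (P : Ideal (𝓞 (FR F Fbar M)))
    [P.IsPrime] (hℓ : (ℓ.1 : 𝓞 (FR F Fbar M)) ∈ P) {n : ℕ} (hn : n.Coprime ℓ.1)
    {x : FR F Fbar M} (hx : x ∈ subField F Fbar M n) (hx1 : placeVal F P x < 1) :
    placeVal F P x ≤ placeVal F P (ℓ.1 : FR F Fbar M) := by
  have hn0 : n ≠ 0 := by
    rintro rfl
    exact ℓ.2.1.ne_one (by simpa using hn)
  have := numberField_subField (F := F) (Fbar := Fbar) (M := M) hn0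
  set K := subField F Fbar M n
  set Q := primeBelow K P ℓ.2.1 hℓ with hQ
  set v := primeBelow F P ℓ.2.1 hℓ with hv
  have hQv : Q.asIdeal.comap (algebraMap (𝓞 F) (𝓞 K)) = v.asIdeal := by
    change (P.comap _).comap _ = P.comap _
    rw [Ideal.comap_comap]
    rfl
  have he := placeVal_isEquiv F Q rfl
  have h1 : Q.valuation K (algebraMap F K (ℓ.1 : F)) = WithZero.exp (-1 : ℤ) := by
    rw [valuation_algebraMap_of_adjoin hn0 (adjoin_subField_eq_top n) v Q hQv
      (natCast_notMem_of_coprime hn (natCast_mem_primeBelow K P ℓ.2.1 hℓ))]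
    exact valuation_natCast_RPrime ℓ v (natCast_mem_primeBelow F P ℓ.2.1 hℓ)
  have h2 : Q.valuation K ⟨x, hx⟩ < 1 := (he.lt_one_iff_lt_one (x := ⟨x, hx⟩)).1 hx1
  have h3 : Q.valuation K ⟨x, hx⟩ ≤ Q.valuation K (algebraMap F K (ℓ.1 : F)) := by
    rw [h1]
    rcases eq_or_ne (Q.valuation K ⟨x, hx⟩) 0 with h0 | h0
    · rw [h0]; exact zero_le
    · rw [← WithZero.exp_log h0, ← WithZero.exp_zero, WithZero.exp_lt_exp] at h2
      rw [← WithZero.exp_log h0, WithZero.exp_le_exp]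
      omega
  have h4 := (he _ _).2 h3
  simpa using h4

/-- At level `𝐫 / ℓ`, the prime `ℓ` is a uniformizer. -/
theorem placeVal_le_natCast_of_mem_superField (ℓ : RPrime F M) (P : Ideal (𝓞 (FR F Fbar M)))
    [P.IsPrime] (hℓ : (ℓ.1 : 𝓞 (FR F Fbar M)) ∈ P) {x : FR F Fbar M}
    (hx : x ∈ superField Fbar (Set.univ \ {ℓ})) (hx1 : placeVal F P x < 1) :
    placeVal F P x ≤ placeVal F P (ℓ.1 : FR F Fbar M) := by
  obtain ⟨n, hn, hxn⟩ := exists_mem_subField hx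
  refine placeVal_le_natCast_of_mem_subField ℓ P hℓ ?_ hxn hx1
  rw [Nat.coprime_comm, Nat.Prime.coprime_iff_not_dvd ℓ.2.1]
  intro h
  obtain ⟨_, hm⟩ := hn.2 ℓ.1 ℓ.2.1 h
  exact hm.2 rfl

/-- Roots of unity of order dividing `ℓ m`, for `ℓ` and `m` coprime, are products of roots of unity
of orders dividing `ℓ` and `m`. -/
theorem mem_of_pow_mul_eq_one {Ω S : Type*} [Field Ω] [SetLike S Ω] [SubfieldClass S Ω] (E : S)
    {ℓ m : ℕ} (h : ℓ.Coprime m) (hE : ∀ y : Ω, y ^ ℓ = 1 ∨ y ^ m = 1 → y ∈ E) {x : Ω}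
    (hx : x ^ (ℓ * m) = 1) : x ∈ E := by
  obtain ⟨u, v, huv⟩ := Nat.isCoprime_iff_coprime.2 h
  rcases eq_or_ne x 0 with rfl | hx0
  · exact zero_mem E
  have : x = (x ^ ℓ) ^ u * (x ^ m) ^ v := by
    rw [← zpow_natCast, ← zpow_natCast, ← zpow_mul, ← zpow_mul, ← zpow_add₀ hx0, mul_comm,
      mul_comm (m : ℤ), huv, zpow_one]
  rw [this]
  refine mul_mem (zpow_mem (hE _ (Or.inr ?_)) _) (zpow_mem (hE _ (Or.inl ?_)) _)
  · rw [← pow_mul, hx]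
  · rw [← pow_mul, mul_comm, hx]

theorem mem_adjoin_of_pow_eq_one {E : IntermediateField F (FR F Fbar M)} {ℓ m : ℕ} (hp : ℓ.Prime)
    (h : ℓ.Coprime m) {ζ : FR F Fbar M} (hζ : IsPrimitiveRoot ζ ℓ) (hE : subField F Fbar M m ≤ E)
    {x : FR F Fbar M} (hx : x ^ (ℓ * m) = 1) : x ∈ IntermediateField.adjoin E {ζ} := by
  refine mem_of_pow_mul_eq_one _ h (fun y hy => ?_) hx
  rcases hy with hy | hy
  · have : NeZero ℓ := ⟨hp.ne_zero⟩
    obtain ⟨i, _, rfl⟩ := hζ.eq_pow_of_pow_eq_one hy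
    exact pow_mem (IntermediateField.mem_adjoin_simple_self E ζ) i
  · exact (IntermediateField.adjoin E {ζ}).algebraMap_mem
      ⟨y, hE (IntermediateField.subset_adjoin F _ hy)⟩

theorem subField_mul_le {ℓ m : ℕ} (hp : ℓ.Prime) (h : ℓ.Coprime m) {ζ : FR F Fbar M}
    (hζ : IsPrimitiveRoot ζ ℓ) {x : FR F Fbar M} (hx : x ∈ subField F Fbar M (ℓ * m)) :
    x ∈ IntermediateField.adjoin (subField F Fbar M m) {ζ} := by
  have : subField F Fbar M (ℓ * m) ≤
      (IntermediateField.adjoin (subField F Fbar M m) {ζ}).restrictScalars F := by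
    unfold subField
    rw [IntermediateField.adjoin_le_iff]
    intro y hy
    exact mem_adjoin_of_pow_eq_one hp h hζ le_rfl hy
  exact this hx

theorem mem_adjoin_superField (ℓ : RPrime F M) {ζ : FR F Fbar M} (hζ : IsPrimitiveRoot ζ ℓ.1)
    (x : FR F Fbar M) : x ∈ IntermediateField.adjoin (superField Fbar (Set.univ \ {ℓ})) {ζ} := by
  have : superField Fbar (Set.univ : SuperDiv F M) ≤
      (IntermediateField.adjoin (superField Fbar (Set.univ \ {ℓ})) {ζ}).restrictScalars F := by
    rw [superField, IntermediateField.adjoin_le_iff]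
    rintro y ⟨n, hn, hy⟩
    by_cases hℓn : ℓ.1 ∣ n
    · obtain ⟨m, rfl⟩ := hℓn
      have hcop := (Nat.squarefree_mul_iff.1 hn.1).1
      have hm : Divides m (Set.univ \ {ℓ} : SuperDiv F M) := by
        refine ⟨hn.1.of_mul_right, fun p hp hpm => ?_⟩
        obtain ⟨h, _⟩ := hn.2 p hp (hpm.mul_left _)
        refine ⟨h, Set.mem_univ _, fun heq => ?_⟩
        have : p = ℓ.1 := congrArg Subtype.val heq
        exact (Nat.Prime.coprime_iff_not_dvd ℓ.2.1).1 hcop (this ▸ hpm)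
      exact mem_adjoin_of_pow_eq_one ℓ.2.1 hcop hζ (subField_le_superField hm) hy
    · have hm : Divides n (Set.univ \ {ℓ} : SuperDiv F M) := by
        refine ⟨hn.1, fun p hp hpm => ?_⟩
        obtain ⟨h, _⟩ := hn.2 p hp hpm
        refine ⟨h, Set.mem_univ _, fun heq => ?_⟩
        have : p = ℓ.1 := congrArg Subtype.val heq
        exact hℓn (this ▸ hpm)
      exact IntermediateField.algebraMap_mem _
        (⟨y, subField_le_superField hm (IntermediateField.subset_adjoin F _ hy)⟩ :
          superField Fbar (Set.univ \ {ℓ}))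
  exact this (superField_univ.ge IntermediateField.mem_top)

theorem exists_isPrimitiveRoot (ℓ : RPrime F M) : ∃ ζ : FR F Fbar M, IsPrimitiveRoot ζ ℓ.1 := by
  have hd : Divides ℓ.1 (Set.univ : SuperDiv F M) := by
    refine ⟨ℓ.2.1.squarefree, fun p hp h => ?_⟩
    have : p = ℓ.1 := (Nat.prime_dvd_prime_iff_eq hp ℓ.2.1).1 h
    subst this
    exact ⟨ℓ.2, Set.mem_univ _⟩
  obtain ⟨ζ, hζ⟩ := exists_primitiveRoot (Fbar := Fbar) hd
  exact ⟨ζ, IsPrimitiveRoot.coe_units_iff.2 hζ⟩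

theorem one_sub_ne_zero {Ω : Type*} [Field Ω] {ℓ : ℕ} (hp : ℓ.Prime) {ζ : Ω}
    (hζ : IsPrimitiveRoot ζ ℓ) : (1 : Ω) - ζ ≠ 0 := by
  intro h
  exact hζ.ne_one hp.one_lt (sub_eq_zero.1 h).symm

theorem mem_inertiaGroup_iff {ℓ : ℕ} {g : G F Fbar M} : g ∈ inertiaGroup F Fbar M ℓ ↔
    ∀ P ∈ placesAbove F Fbar M ℓ, ∀ x, RingOfIntegers.mapAlgEquiv g x - x ∈ P := by
  simp only [inertiaGroup, Subgroup.mem_iInf]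
  rfl

theorem mem_placesAbove {ℓ : ℕ} (hp : ℓ.Prime) (P : Ideal (𝓞 (FR F Fbar M))) [P.IsPrime]
    (hℓ : (ℓ : 𝓞 (FR F Fbar M)) ∈ P) : P ∈ placesAbove F Fbar M ℓ :=
  ⟨isMaximal_of_natCast_mem hp P hℓ, hℓ⟩

/-- The automorphisms that are trivial at level `𝐫 / ℓ` lie in the inertia group at `ℓ`. -/
theorem mem_inertiaGroup_of_fixed (ℓ : RPrime F M) {g : G F Fbar M}
    (hg : ∀ x ∈ superField Fbar (Set.univ \ {ℓ}), g x = x) : g ∈ inertiaGroup F Fbar M ℓ.1 := by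
  rw [mem_inertiaGroup_iff]
  rintro P ⟨hP, hℓ⟩ x
  have := hP.isPrime
  obtain ⟨ζ, hζ⟩ := exists_isPrimitiveRoot (Fbar := Fbar) ℓ
  rw [← placeVal_integer_lt_one_iff F]
  exact valuation_map_sub_lt_one ℓ.2.1 hζ ((placeVal_natCast_lt_one_iff F).2 hℓ) _
    (fun y hy h => placeVal_le_natCast_of_mem_superField ℓ P hℓ hy h)
    ((map_ne_zero _).2 (one_sub_ne_zero ℓ.2.1 hζ)) (g : FR F Fbar M →+* FR F Fbar M) hg
    (mem_adjoin_superField ℓ hζ _) (placeVal_integer_le_one F x)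

/-- The cyclotomic character is surjective on the inertia group at `ℓ`. -/
theorem exists_mem_inertiaGroup (ℓ : RPrime F M) {ζ ζ' : FR F Fbar M} (hζ : IsPrimitiveRoot ζ ℓ.1)
    (hζ' : IsPrimitiveRoot ζ' ℓ.1) : ∃ g ∈ inertiaGroup F Fbar M ℓ.1, g ζ = ζ' := by
  obtain ⟨P, hP, hℓ⟩ := exists_prime_natCast_mem (FR F Fbar M) ℓ.2.1
  set E := superField Fbar (Set.univ \ {ℓ} : SuperDiv F M)
  have key : ∀ {z : FR F Fbar M}, IsPrimitiveRoot z ℓ.1 →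
      minpoly E z = Polynomial.cyclotomic ℓ.1 E := fun hz =>
    minpoly_eq_cyclotomic ℓ.2.1 hz ((placeVal_natCast_lt_one_iff F).2 hℓ) _
      (fun y hy h => placeVal_le_natCast_of_mem_superField ℓ P hℓ hy h)
      ((map_ne_zero _).2 (one_sub_ne_zero ℓ.2.1 hz))
  obtain ⟨g, hg⟩ := (isConjRoot_iff_exists_algEquiv (K := E) (x := ζ') (y := ζ)).1
    ((key hζ').trans (key hζ).symm)
  exact ⟨g.restrictScalars F, mem_inertiaGroup_of_fixed ℓ fun x hx => g.commutes ⟨x, hx⟩, hg⟩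

/-- Two roots of unity of order prime to the residue characteristic that agree modulo a place are
equal. -/
theorem eq_of_placeVal_sub_lt_one {Ω : Type*} [Field Ω] [Algebra F Ω] [Algebra.IsAlgebraic F Ω]
    {P : Ideal (𝓞 Ω)} [P.IsPrime] {n : ℕ} (hn0 : n ≠ 0) (hn : (n : 𝓞 Ω) ∉ P) {x y : Ω}
    (hx : x ^ n = 1) (hy : y ^ n = 1) (h : placeVal F P (x - y) < 1) : x = y := by
  by_contra hne
  have hy0 : y ≠ 0 := fun h0 => by rw [h0, zero_pow hn0] at hy; exact zero_ne_one hy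
  have hξ : (x / y) ^ n = 1 := by rw [div_pow, hx, hy, div_one]
  let ξ : 𝓞 Ω := ⟨x / y, IsIntegral.of_pow (Nat.pos_of_ne_zero hn0) (hξ ▸ isIntegral_one)⟩
  refine hn (natCast_mem_of_pow_eq_one (ξ := ξ) (RingOfIntegers.ext hξ) (fun h1 => hne ?_) ?_)
  · have : x / y = 1 := congrArg (fun z : 𝓞 Ω => (z : Ω)) h1
    exact (div_eq_one_iff_eq hy0).1 this
  · rw [← placeVal_integer_lt_one_iff F]
    change placeVal F P (x / y - 1) < 1
    rwa [div_sub_one hy0, map_div₀, valuation_eq_one_of_pow_eq_one _ hn0 hy, div_one]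

theorem coprime_of_RPrime (ℓ : RPrime F M) : M.Coprime ℓ.1 := by
  have h := ℓ.2.2.2.1
  have := h.gcd_eq
  rw [Nat.gcd_one_left] at this
  rw [Nat.coprime_comm]
  exact this

/-- A root of unity of odd order `M` in `F_𝐫` is trivial. If it lies in `F_{ℓ m}`, then it lies in
`F_m`, since the automorphisms over `F_m` do not change it modulo the places above `ℓ`; so it lies in
the totally real field `F`. -/
theorem eq_one_of_pow_eq_one [IsTotallyReal F] (hM : Odd M) {x : FR F Fbar M} (hx : x ^ M = 1) :
    x = 1 := by
  have hM0 : M ≠ 0 := hM.pos.ne'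
  have hmain : ∀ n : ℕ, Divides n (Set.univ : SuperDiv F M) → x ∈ subField F Fbar M n →
      x ∈ subField F Fbar M 1 := by
    intro n
    induction n using Nat.strong_induction_on with
    | _ n ih =>
      intro hn hxn
      rcases eq_or_ne n 1 with rfl | hn1
      · exact hxn
      obtain ⟨p, hp, m, rfl⟩ := Nat.exists_prime_and_dvd hn1
      obtain ⟨hℓ, _⟩ := hn.2 p hp (dvd_mul_right p m)
      let ℓ : RPrime F M := ⟨p, hℓ⟩
      have hcop := (Nat.squarefree_mul_iff.1 hn.1).1
      have hm : Divides m (Set.univ : SuperDiv F M) :=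
        ⟨hn.1.of_mul_right, fun q hq hqm => hn.2 q hq (hqm.mul_left _)⟩
      refine ih m (lt_mul_left (Nat.pos_of_ne_zero hm.ne_zero) hp.one_lt) hm ?_
      obtain ⟨ζ, hζ⟩ := exists_isPrimitiveRoot (Fbar := Fbar) ℓ
      obtain ⟨P, hP, hℓP⟩ := exists_prime_natCast_mem (FR F Fbar M) hp
      refine mem_of_forall_fixed _ fun g hg => ?_
      refine eq_of_placeVal_sub_lt_one (F := F) (P := P) hM0
        (natCast_notMem_of_coprime (coprime_of_RPrime ℓ) hℓP)
        (by rw [← map_pow, hx, map_one]) hx ?_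
      exact valuation_map_sub_lt_one hp hζ ((placeVal_natCast_lt_one_iff F).2 hℓP) _
        (fun y hy h => placeVal_le_natCast_of_mem_subField ℓ P hℓP hcop.symm hy h)
        ((map_ne_zero _).2 (one_sub_ne_zero hp hζ)) (g : FR F Fbar M →+* FR F Fbar M) hg
        (subField_mul_le hp hcop hζ hxn) (valuation_eq_one_of_pow_eq_one _ hM0 hx).le
  obtain ⟨n, hn, hxn⟩ := exists_mem_subField
    (superField_univ.ge (IntermediateField.mem_top (x := x)))
  have h1 := hmain n hn hxn
  have h2 : subField F Fbar M 1 ≤ ⊥ := by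
    rw [subField, IntermediateField.adjoin_le_iff]
    intro y hy
    rw [Set.mem_ofPred_eq, pow_one] at hy
    rw [hy]
    exact one_mem _
  obtain ⟨a, ha⟩ := IntermediateField.mem_bot.1 (h2 h1)
  obtain ⟨w⟩ := (inferInstance : Nonempty (InfinitePlace F))
  let f : F →+* ℝ := w.embedding_of_isReal (IsTotallyReal.isReal w)
  have h3 : a ^ M = 1 := (algebraMap F (FR F Fbar M)).injective (by rw [map_pow, ha, hx, map_one])
  have h4 : f a = 1 := by
    have : f a ^ M = 1 ^ M := by rw [← map_pow, h3, map_one, one_pow]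
    exact hM.strictMono_pow.injective this
  rw [← ha, f.injective (h4.trans (map_one f).symm), map_one]

end GaloisTheory

/-! ### Descent of invariant classes and the map `κ` -/

section Descent

set_option linter.unusedSectionVars false

/-- Hilbert's Theorem 90 for a cocycle of a finite extension, in terms of elements of the field. -/
theorem exists_coboundary {F K : Type*} [Field F] [Field K] [Algebra F K] [FiniteDimensional F K]
    (f : (K ≃ₐ[F] K) → Kˣ) (h : ∀ s t, (f (s * t) : K) = s (f t) * f s) :
    ∃ w : Kˣ, ∀ s : K ≃ₐ[F] K, s w = w * f s := by
  obtain ⟨w, hw⟩ := groupCohomology.isMulCoboundary₁_of_isMulCocycle₁_of_aut_to_units f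
    (fun s t => Units.ext (h s t))
  refine ⟨w, fun s => ?_⟩
  have h2 : s • w / w = f s := hw s
  rw [div_eq_iff_eq_mul] at h2
  have h3 := congrArg Units.val h2
  rw [mul_comm] at h3
  exact h3

variable {F : Type*} [Field F] [NumberField F] {Fbar : Type*} [Field Fbar] [Algebra F Fbar]
  [IsAlgClosure F Fbar] {M : ℕ}

section RootsOfUnity

variable [IsTotallyReal F] (hM : Odd M)

include hM

theorem eq_of_pow_eq_pow {x y : FR F Fbar M} (h : x ^ M = y ^ M) : x = y := by
  rcases eq_or_ne y 0 with rfl | hy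
  · rw [zero_pow hM.pos.ne'] at h
    exact pow_eq_zero_iff hM.pos.ne' |>.1 h
  · have : x / y = 1 := eq_one_of_pow_eq_one hM (by rw [div_pow, h, div_self (pow_ne_zero _ hy)])
    exact (div_eq_one_iff_eq hy).1 this

theorem fixed_of_pow_fixed (g : G F Fbar M) {z : FR F Fbar M} (h : g (z ^ M) = z ^ M) : g z = z :=
  eq_of_pow_eq_pow hM (by rw [← map_pow, h])

theorem mem_of_pow_mem (K : IntermediateField F (FR F Fbar M)) {z : FR F Fbar M}
    (h : z ^ M ∈ K) : z ∈ K :=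
  mem_of_forall_fixed K fun g hg => fixed_of_pow_fixed hM g (hg _ h)

theorem modPow_map_injective : Function.Injective
    (ModPow.map (Units.map (algebraMap F (FR F Fbar M)).toMonoidHom) M) := by
  rw [injective_iff_map_eq_one]
  intro a ha
  obtain ⟨a, rfl⟩ := QuotientGroup.mk_surjective a
  change (QuotientGroup.mk (Units.map (algebraMap F (FR F Fbar M)).toMonoidHom a) :
    ModPow (FR F Fbar M)ˣ M) = 1 at ha
  rw [QuotientGroup.eq_one_iff] at ha ⊢
  obtain ⟨z, hz⟩ := ha
  have hz' : (z : FR F Fbar M) ^ M = algebraMap F (FR F Fbar M) a := congrArg Units.val hz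
  obtain ⟨b, hb⟩ := mem_range_of_forall_fixed (x := (z : FR F Fbar M)) fun g =>
    fixed_of_pow_fixed hM g (by rw [hz', g.commutes])
  have hb0 : b ≠ 0 := by
    rintro rfl
    exact z.ne_zero (by rw [← hb, map_zero])
  refine ⟨Units.mk0 b hb0, Units.ext ((algebraMap F (FR F Fbar M)).injective ?_)⟩
  change algebraMap F (FR F Fbar M) (b ^ M) = _
  rw [map_pow, hb, hz']

/-- Hilbert's Theorem 90: an element of `F_𝐫` whose class modulo `M`-th powers is invariant comes
from `F`. The cocycle of `M`-th roots is unique, as there are no `M`-th roots of unity. -/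
theorem exists_eq_mul_pow {α : FR F Fbar M} (hα0 : α ≠ 0)
    (hα : ∀ g : G F Fbar M, ∃ β : FR F Fbar M, g α = α * β ^ M) :
    ∃ (a : Fˣ) (w : (FR F Fbar M)ˣ), α = algebraMap F (FR F Fbar M) a * (w : FR F Fbar M) ^ M := by
  obtain ⟨n, hn, hαn⟩ := exists_mem_subField
    (superField_univ.ge (IntermediateField.mem_top (x := α)))
  set K := subField F Fbar M n
  have := finiteDimensional_subField (F := F) (Fbar := Fbar) (M := M) hn.ne_zero
  let αK : K := ⟨α, hαn⟩
  have hαK0 : αK ≠ 0 := fun h => hα0 (congrArg Subtype.val h)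
  have hex : ∀ s : K ≃ₐ[F] K, ∃ β : Kˣ, s αK = αK * (β : K) ^ M := by
    intro s
    obtain ⟨g, rfl⟩ := AlgEquiv.restrictNormalHom_surjective (F := F) (K₁ := K) (FR F Fbar M) s
    obtain ⟨β, hβ⟩ := hα g
    have hres : ((AlgEquiv.restrictNormalHom K g αK : K) : FR F Fbar M) = g α :=
      AlgEquiv.restrictNormal_commutes g K αK
    have hβK : β ∈ K := by
      refine mem_of_pow_mem hM K ?_
      have : β ^ M = g α / α := by rw [hβ, mul_div_cancel_left₀ _ hα0]
      rw [this, ← hres]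
      exact div_mem (SetLike.coe_mem _) hαn
    have hβ0 : β ≠ 0 := by
      rintro rfl
      rw [zero_pow hM.pos.ne', mul_zero, map_eq_zero] at hβ
      exact hα0 hβ
    refine ⟨Units.mk0 ⟨β, hβK⟩ fun h => hβ0 (congrArg Subtype.val h), Subtype.ext ?_⟩
    rw [hres, hβ]
    rfl
  choose f hf using hex
  have hinj : ∀ x y : K, x ^ M = y ^ M → x = y := fun x y h =>
    Subtype.ext (eq_of_pow_eq_pow hM (congrArg Subtype.val h))
  obtain ⟨w, hw⟩ := exists_coboundary f fun s t => by
    refine hinj _ _ (mul_left_cancel₀ hαK0 ?_)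
    rw [← hf, AlgEquiv.mul_apply, hf t, map_mul, hf s, map_pow, mul_pow]
    ring
  have hfix : ∀ g : G F Fbar M, g (α / ((w : K) : FR F Fbar M) ^ M) =
      α / ((w : K) : FR F Fbar M) ^ M := by
    intro g
    have hres : ∀ x : K, ((AlgEquiv.restrictNormalHom K g x : K) : FR F Fbar M) = g x :=
      fun x => AlgEquiv.restrictNormal_commutes g K x
    set s := AlgEquiv.restrictNormalHom K g
    have hw0 : ((w : K) : FR F Fbar M) ≠ 0 := fun h => w.ne_zero (Subtype.ext h)
    have hfs0 : (((f s : Kˣ) : K) : FR F Fbar M) ≠ 0 := fun h => (f s).ne_zero (Subtype.ext h)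
    have e1 : g α = α * (((f s : Kˣ) : K) : FR F Fbar M) ^ M :=
      (hres αK).symm.trans (congrArg Subtype.val (hf s))
    have e2 : g ((w : K) : FR F Fbar M) =
        ((w : K) : FR F Fbar M) * (((f s : Kˣ) : K) : FR F Fbar M) :=
      (hres w).symm.trans (congrArg Subtype.val (hw s))
    rw [map_div₀, map_pow, e1, e2, mul_pow, mul_div_mul_right _ _ (pow_ne_zero _ hfs0)]
  obtain ⟨a, ha⟩ := mem_range_of_forall_fixed hfix
  have hw0 : ((w : K) : FR F Fbar M) ≠ 0 := fun h => w.ne_zero (Subtype.ext h)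
  have ha0 : a ≠ 0 := by
    rintro rfl
    rw [map_zero] at ha
    exact div_ne_zero hα0 (pow_ne_zero _ hw0) ha.symm
  refine ⟨Units.mk0 a ha0, Units.mk0 _ hw0, ?_⟩
  rw [Units.val_mk0, Units.val_mk0, ha, div_mul_cancel₀ _ (pow_ne_zero _ hw0)]

end RootsOfUnity

variable (ξ : U F M Set.univ →+ Additive (𝓞 (FR F Fbar M))ˣ)

/-- The homomorphism `ξ`, with values in the units of the field `F_𝐫`. -/
def xiField : U F M Set.univ →+ Additive (FR F Fbar M)ˣ :=
  (Units.map (algebraMap (𝓞 (FR F Fbar M)) (FR F Fbar M)).toMonoidHom).toAdditive.comp ξ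

theorem coe_xiField (x : U F M Set.univ) : ((xiField ξ x).toMul : FR F Fbar M) =
    (((ξ x).toMul : 𝓞 (FR F Fbar M)) : FR F Fbar M) := rfl

theorem xiField_galU {ξ : U F M Set.univ →+ Additive (𝓞 (FR F Fbar M))ˣ} (hξ : IsEquivariant ξ)
    (g : G F Fbar M) (x : U F M Set.univ) :
    ((xiField ξ (galU Set.univ g x)).toMul : FR F Fbar M) = g ((xiField ξ x).toMul : FR F Fbar M) :=
  hξ g x

theorem xiField_nsmul (n : ℕ) (x : U F M Set.univ) :
    ((xiField ξ (n • x)).toMul : FR F Fbar M) = ((xiField ξ x).toMul : FR F Fbar M) ^ n := by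
  rw [map_nsmul]
  rfl

theorem xiField_sub (x y : U F M Set.univ) : ((xiField ξ (x - y)).toMul : FR F Fbar M) =
    ((xiField ξ x).toMul : FR F Fbar M) / ((xiField ξ y).toMul : FR F Fbar M) := by
  rw [map_sub, toMul_sub, Units.val_div_eq_div_val]

/-- The homomorphism induced by `ξ` modulo `M`-th powers. -/
def xiMod : UM F M Set.univ →+ Additive (ModPow (FR F Fbar M)ˣ M) :=
  QuotientAddGroup.lift _ ((QuotientGroup.mk' _).toAdditive.comp (xiField ξ)) (by
    rintro _ ⟨x, rfl⟩
    change Additive.ofMul (QuotientGroup.mk (xiField ξ (M • x)).toMul) = 0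
    rw [map_nsmul]
    refine congrArg Additive.ofMul ((QuotientGroup.eq_one_iff _).2 ⟨(xiField ξ x).toMul, rfl⟩))

theorem isInduced_iff {κ : H0 F Fbar M Set.univ →+ Additive (ModPow Fˣ M)} : IsInduced ξ κ ↔
    ∀ c : H0 F Fbar M Set.univ,
      ModPow.map (Units.map (algebraMap F (FR F Fbar M)).toMonoidHom) M (κ c).toMul =
        (xiMod ξ (c : UM F M Set.univ)).toMul := by
  constructor
  · intro h c
    obtain ⟨x, hx⟩ := QuotientAddGroup.mk_surjective (c : UM F M Set.univ)
    rw [h c x hx, ← hx]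
    rfl
  · intro h c x hx
    rw [h c, ← show _ = (c : UM F M Set.univ) from hx]
    rfl

theorem exists_galU_sub {x : U F M Set.univ} {c : H0 F Fbar M Set.univ} (h : Represents x c)
    (g : G F Fbar M) : ∃ u : U F M Set.univ, M • u = galU Set.univ g x - x := by
  have h1 : (QuotientAddGroup.mk (galU Set.univ g x) : UM F M Set.univ) = QuotientAddGroup.mk x := by
    rw [show (QuotientAddGroup.mk x : UM F M Set.univ) = c from h, ← c.2 g, ← h]
    rfl
  obtain ⟨u, hu⟩ := (QuotientAddGroup.eq.1 h1.symm : _)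
  exact ⟨u, by rw [show M • u = nsmulAddMonoidHom (α := U F M Set.univ) M u from rfl, hu]; abel⟩

theorem existsUnique_isInduced [IsTotallyReal F] (hM : Odd M) (hξ : IsEquivariant ξ) :
    ∃! κ : H0 F Fbar M Set.univ →+ Additive (ModPow Fˣ M), IsInduced ξ κ := by
  have hinj := modPow_map_injective (F := F) (Fbar := Fbar) hM
  have hex : ∀ c : H0 F Fbar M Set.univ, ∃ a : ModPow Fˣ M,
      ModPow.map (Units.map (algebraMap F (FR F Fbar M)).toMonoidHom) M a =
        (xiMod ξ (c : UM F M Set.univ)).toMul := by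
    intro c
    obtain ⟨x, hx⟩ := QuotientAddGroup.mk_surjective (c : UM F M Set.univ)
    obtain ⟨a, w, h⟩ := exists_eq_mul_pow hM (α := ((xiField ξ x).toMul : FR F Fbar M))
      (Units.ne_zero _) (fun g => by
        obtain ⟨u, hu⟩ := exists_galU_sub hx g
        refine ⟨((xiField ξ u).toMul : FR F Fbar M), ?_⟩
        rw [← xiField_nsmul, hu, xiField_sub, xiField_galU hξ, mul_div_cancel₀ _ (Units.ne_zero _)])
    refine ⟨QuotientGroup.mk a, ?_⟩
    rw [← hx]
    refine (QuotientGroup.eq.2 ⟨w, Units.ext ?_⟩ : (QuotientGroup.mk (Units.map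
      (algebraMap F (FR F Fbar M)).toMonoidHom a) : ModPow (FR F Fbar M)ˣ M) =
        QuotientGroup.mk (xiField ξ x).toMul)
    rw [Units.val_mul, Units.val_inv_eq_inv_val, h]
    change (w : FR F Fbar M) ^ M = (algebraMap F (FR F Fbar M) a)⁻¹ * _
    rw [inv_mul_cancel_left₀]
    exact (map_ne_zero _).2 a.ne_zero
  choose k hk using hex
  refine ⟨AddMonoidHom.mk' (fun c => Additive.ofMul (k c)) fun c d => ?_, ?_, fun κ hκ => ?_⟩
  · have : k (c + d) = k c * k d := hinj (by
      rw [map_mul, hk, hk, hk, AddSubgroup.coe_add, map_add, toMul_add])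
    exact congrArg Additive.ofMul this
  · exact (isInduced_iff ξ).2 hk
  · refine AddMonoidHom.ext fun c => congrArg Additive.ofMul (hinj ?_)
    exact ((isInduced_iff ξ).1 hκ c).trans (hk c).symm

/-- A representative in `Fˣ` of the value of `κ`. -/
theorem exists_eq_mul_pow_of_isInduced {ξ : U F M Set.univ →+ Additive (𝓞 (FR F Fbar M))ˣ}
    {κ : H0 F Fbar M Set.univ →+ Additive (ModPow Fˣ M)} (hκ : IsInduced ξ κ)
    {c : H0 F Fbar M Set.univ} {x : U F M Set.univ} (hx : Represents x c) {a : Fˣ}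
    (ha : QuotientGroup.mk a = (κ c).toMul) :
    ∃ w : (FR F Fbar M)ˣ,
      ((xiField ξ x).toMul : FR F Fbar M) = algebraMap F (FR F Fbar M) a * (w : FR F Fbar M) ^ M := by
  have h := hκ c x hx
  rw [← ha] at h
  obtain ⟨w, hw⟩ := QuotientGroup.eq.1 (h : (QuotientGroup.mk (Units.map
      (algebraMap F (FR F Fbar M)).toMonoidHom a) : ModPow (FR F Fbar M)ˣ M) = _)
  refine ⟨w, ?_⟩
  have := congrArg Units.val ((eq_inv_mul_iff_mul_eq).1 hw)
  exact this.symm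

end Descent

/-! ### Orders at the primes of `F` above `ℓ` -/

section Orders

set_option linter.unusedSectionVars false

open IsDedekindDomain

variable {F : Type*} [Field F] [NumberField F]

/-- The order of an element of `Fˣ` at a prime of `F`, as a homomorphism. -/
def ordHom (v : HeightOneSpectrum (𝓞 F)) : Fˣ →* Multiplicative ℤ :=
  MonoidHom.mk' (fun a => Multiplicative.ofAdd (-WithZero.log (v.valuation F a))) fun a b => by
    rw [Units.val_mul, map_mul, WithZero.log_mul ((map_ne_zero _).2 a.ne_zero)
      ((map_ne_zero _).2 b.ne_zero), neg_add, ofAdd_add]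

/-- The order of an element of `Fˣ` at a prime of `F`. -/
def ordAt (v : HeightOneSpectrum (𝓞 F)) (a : Fˣ) : ℤ := (ordHom v a).toAdd

theorem valuation_eq_exp_ordAt (v : HeightOneSpectrum (𝓞 F)) (a : Fˣ) :
    v.valuation F (a : F) = WithZero.exp (-ordAt v a) := by
  change _ = WithZero.exp (- -WithZero.log (v.valuation F a))
  rw [neg_neg, WithZero.exp_log ((map_ne_zero _).2 a.ne_zero)]

theorem ordAt_eq_iff {v : HeightOneSpectrum (𝓞 F)} {a : Fˣ} {n : ℤ} :
    ordAt v a = n ↔ v.valuation F (a : F) = WithZero.exp (-n) := by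
  rw [valuation_eq_exp_ordAt, WithZero.exp_inj, neg_inj]

theorem ordAt_mul (v : HeightOneSpectrum (𝓞 F)) (a b : Fˣ) :
    ordAt v (a * b) = ordAt v a + ordAt v b := by
  rw [ordAt, map_mul, toAdd_mul]
  rfl

theorem ordAt_pow (v : HeightOneSpectrum (𝓞 F)) (a : Fˣ) (n : ℕ) :
    ordAt v (a ^ n) = n * ordAt v a := by
  rw [ordAt, map_pow, toAdd_pow, nsmul_eq_mul]
  rfl

theorem ordAt_eq_zero_iff {v : HeightOneSpectrum (𝓞 F)} {a : Fˣ} :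
    ordAt v a = 0 ↔ v.valuation F (a : F) = 1 := by
  rw [ordAt_eq_iff, neg_zero, WithZero.exp_zero]

variable (F) in
/-- The primes of `F` above `ℓ`. -/
abbrev PrimesAt (ℓ : ℕ) : Type _ := {v : HeightOneSpectrum (𝓞 F) // (ℓ : 𝓞 F) ∈ v.asIdeal}

theorem finite_primesAt {ℓ : ℕ} (hp : ℓ.Prime) : Finite (PrimesAt F ℓ) := by
  have h0 : Ideal.span {(ℓ : 𝓞 F)} ≠ 0 := by
    rw [Ideal.zero_eq_bot, Ne, Ideal.span_singleton_eq_bot]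
    exact_mod_cast hp.ne_zero
  refine Set.Finite.subset (Ideal.finite_factors h0) fun v hv => ?_
  rw [Set.mem_ofPred_eq, Ideal.dvd_span_singleton]
  exact hv

/-- The Chinese remainder theorem for the primes of `F` above `ℓ`. -/
theorem exists_forall_sub_mem {ℓ : ℕ} (hp : ℓ.Prime) (e : ℕ) (x : PrimesAt F ℓ → 𝓞 F) :
    ∃ y : 𝓞 F, ∀ v : PrimesAt F ℓ, y - x v ∈ v.1.asIdeal ^ e := by
  have := finite_primesAt (F := F) hp
  have := Fintype.ofFinite (PrimesAt F ℓ)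
  obtain ⟨y, hy⟩ := IsDedekindDomain.exists_forall_sub_mem_ideal (s := Finset.univ)
    (fun v : PrimesAt F ℓ => v.1.asIdeal) (fun _ => e) (fun v _ => v.1.prime)
    (fun v _ w _ hvw h => hvw (Subtype.ext (HeightOneSpectrum.ext h))) (fun v => x v)
  exact ⟨y, fun v => hy v (Finset.mem_univ v)⟩

/-- Weak approximation at the primes above `ℓ`: orders can be prescribed. -/
theorem exists_ordAt_eq {ℓ : ℕ} (hp : ℓ.Prime) (n : PrimesAt F ℓ → ℤ) :
    ∃ b : Fˣ, ∀ v : PrimesAt F ℓ, ordAt v.1 b = n v := by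
  classical
  have := finite_primesAt (F := F) hp
  have := Fintype.ofFinite (PrimesAt F ℓ)
  have hex : ∀ v : PrimesAt F ℓ, ∃ p : Fˣ, ∀ w : PrimesAt F ℓ,
      ordAt w.1 p = if w = v then 1 else 0 := by
    intro v
    obtain ⟨t, ht⟩ := v.1.intValuation_exists_uniformizer
    obtain ⟨y, hy⟩ := exists_forall_sub_mem hp 2 (fun w => if w = v then t else 1)
    have hval : ∀ w : PrimesAt F ℓ, w.1.valuation F (algebraMap (𝓞 F) F y) =
        WithZero.exp (-(if w = v then 1 else 0)) := by
      intro w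
      have h1 := hy w
      rw [← w.1.intValuation_le_pow_iff_mem] at h1
      have h2 : w.1.intValuation (if w = v then t else 1) =
          WithZero.exp (-(if w = v then 1 else 0)) := by
        split_ifs with h
        · rw [h]
          exact ht
        · simp
      rw [w.1.valuation_of_algebraMap, ← h2]
      refine Valuation.map_eq_of_sub_lt _ (h1.trans_lt ?_)
      rw [h2, WithZero.exp_lt_exp]
      split_ifs <;> norm_num
    have hy0 : algebraMap (𝓞 F) F y ≠ 0 := by
      intro h0
      have := hval v
      rw [h0, map_zero] at this
      exact WithZero.exp_ne_zero this.symm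
    exact ⟨Units.mk0 _ hy0, fun w => ordAt_eq_iff.2 (hval w)⟩
  choose p hpv using hex
  refine ⟨∏ v, p v ^ n v, fun w => ?_⟩
  rw [ordAt, map_prod, toAdd_prod, Finset.sum_eq_single w]
  · rw [map_zpow, toAdd_zpow]
    change n w • ordAt w.1 (p w) = n w
    rw [hpv w w, if_pos rfl, smul_eq_mul, mul_one]
  · intro v _ hv
    rw [map_zpow, toAdd_zpow]
    change n v • ordAt w.1 (p v) = 0
    rw [hpv v w, if_neg hv.symm, smul_zero]
  · exact fun h => absurd (Finset.mem_univ w) h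

theorem mem_locAt_of_valuation_le_one {ℓ : ℕ} (hp : ℓ.Prime) {d : F}
    (h : ∀ v : PrimesAt F ℓ, v.1.valuation F d ≤ 1) : d ∈ locAt F ℓ := by
  refine mem_locAt_of_forall hp fun Λ hΛ hℓ => ?_
  have h0 : Λ ≠ ⊥ := by
    rintro rfl
    rw [Ideal.mem_bot] at hℓ
    exact hp.ne_zero (by exact_mod_cast hℓ)
  obtain ⟨n, m, hnm⟩ := HeightOneSpectrum.exists_primeCompl_mul_eq_of_integer ⟨Λ, hΛ, h0⟩ d
    (h ⟨⟨Λ, hΛ, h0⟩, hℓ⟩)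
  exact ⟨n, m, m.2, hnm⟩

theorem valuation_le_one_of_mem_locAt {ℓ : ℕ} (v : PrimesAt F ℓ) {d : F} (h : d ∈ locAt F ℓ) :
    v.1.valuation F d ≤ 1 := by
  obtain ⟨a, b, hb, -, rfl⟩ := h
  have hbv : v.1.valuation F (algebraMap (𝓞 F) F b) = 1 :=
    v.1.valuation_eq_one_iff_notMem.2 (notMem_of_isCoprime hb v.2)
  rw [map_div₀, show v.1.valuation F (b : F) = 1 from hbv, div_one]
  exact v.1.valuation_le_one a

variable (F) in
/-- The inclusion of the units of the localization at `ℓ` in `Fˣ`. -/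
def unitIncl (ℓ : ℕ) : (locAt F ℓ)ˣ →* Fˣ := Units.map (locAt F ℓ).subtype.toMonoidHom

theorem coe_unitIncl {ℓ : ℕ} (u : (locAt F ℓ)ˣ) : (unitIncl F ℓ u : F) = ((u : locAt F ℓ) : F) :=
  rfl

/-- The units of the localization at `ℓ` are the elements of order zero at all primes above `ℓ`. -/
theorem mem_range_unitIncl_iff {ℓ : ℕ} (hp : ℓ.Prime) {a : Fˣ} :
    a ∈ (unitIncl F ℓ).range ↔ ∀ v : PrimesAt F ℓ, ordAt v.1 a = 0 := by
  constructor
  · rintro ⟨u, rfl⟩ v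
    rw [ordAt_eq_zero_iff]
    refine le_antisymm (valuation_le_one_of_mem_locAt v (u : locAt F ℓ).2) ?_
    have h1 := valuation_le_one_of_mem_locAt v ((u⁻¹ : (locAt F ℓ)ˣ) : locAt F ℓ).2
    rw [← coe_unitIncl, map_inv, Units.val_inv_eq_inv_val, map_inv₀] at h1
    exact (inv_le_one₀ (zero_lt_iff.2 ((map_ne_zero _).2 (Units.ne_zero _)))).1 h1
  · intro h
    have h1 : ∀ v : PrimesAt F ℓ, v.1.valuation F (a : F) = 1 := fun v => ordAt_eq_zero_iff.1 (h v)
    have ha : (a : F) ∈ locAt F ℓ := mem_locAt_of_valuation_le_one hp fun v => (h1 v).le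
    have ha' : ((a⁻¹ : Fˣ) : F) ∈ locAt F ℓ := mem_locAt_of_valuation_le_one hp fun v => by
      rw [Units.val_inv_eq_inv_val, map_inv₀, h1 v, inv_one]
    exact ⟨⟨⟨a, ha⟩, ⟨_, ha'⟩, Subtype.ext (by simp), Subtype.ext (by simp)⟩, Units.ext rfl⟩

/-- An element whose orders at the primes above `ℓ` are divisible by `M` is the product of a unit
at `ℓ` and an `M`-th power. -/
theorem exists_eq_unit_mul_pow_iff {ℓ : ℕ} (hp : ℓ.Prime) (M : ℕ) {a : Fˣ} :
    (∃ (u : (locAt F ℓ)ˣ) (b : Fˣ), a = unitIncl F ℓ u * b ^ M) ↔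
      ∀ v : PrimesAt F ℓ, (M : ℤ) ∣ ordAt v.1 a := by
  constructor
  · rintro ⟨u, b, rfl⟩ v
    rw [ordAt_mul, (mem_range_unitIncl_iff hp).1 ⟨u, rfl⟩ v, zero_add, ordAt_pow]
    exact dvd_mul_right _ _
  · intro h
    choose n hn using h
    obtain ⟨b, hb⟩ := exists_ordAt_eq hp n
    obtain ⟨u, hu⟩ := (mem_range_unitIncl_iff hp (a := a * (b ^ M)⁻¹)).2 fun v => by
      have h1 := ordAt_mul v.1 (a * (b ^ M)⁻¹) (b ^ M)
      rw [inv_mul_cancel_right, ordAt_pow, hb, hn] at h1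
      omega
    exact ⟨u, b, by rw [hu, inv_mul_cancel_right]⟩

end Orders

/-! ### Integrality of `κ c_r` away from `r` -/

section Away

open IsDedekindDomain

set_option linter.unusedSectionVars false

variable {F : Type*} [Field F] [NumberField F] {Fbar : Type*} [Field Fbar] [Algebra F Fbar]
  [IsAlgClosure F Fbar] {M : ℕ}

theorem galU_eq_self {n : ℕ} (hn : Divides (F := F) (M := M) n Set.univ) {s : SuperDiv F M}
    (hs : ∀ a ∈ T s, n • a = 0) {g : G F Fbar M} (hg : ∀ x ∈ subField F Fbar M n, g x = x)
    (y : U F M s) : galU s g y = y := by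
  have h1 : ∀ a : T s, galT s g a = a := by
    intro a
    refine Subtype.ext ?_
    rw [coe_galT, galExp_smul_eq g hn (hs a a.2) (k := 1), one_smul]
    intro ζ hζ
    rw [zpow_one]
    refine hg _ (IntermediateField.subset_adjoin F _ ?_)
    exact congrArg Units.val hζ
  obtain ⟨y, rfl⟩ := QuotientAddGroup.mk_surjective y
  have h2 : (galA s g : A F M s →+ A F M s) = AddMonoidHom.id _ :=
    FreeAbelianGroup.lift_ext _ _ fun a => by
      change FreeAbelianGroup.map (galT s g) _ = _
      rw [FreeAbelianGroup.map_of_apply, h1]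
      rfl
  exact congrArg QuotientAddGroup.mk (DFunLike.congr_fun h2 y)

theorem nsmul_eq_zero_of_mem_T {r : RDiv F M} {a : AddCircle (1 : ℚ)} (ha : a ∈ T r.toSuper) :
    r.1 • a = 0 := by
  obtain ⟨n, hn, hna⟩ := ha
  have : n ∣ r.1 := by
    rw [← Nat.prod_primeFactors_of_squarefree hn.1]
    refine Finset.prod_primes_dvd _ (fun p hp => (Nat.prime_of_mem_primeFactors hp).prime) ?_
    intro p hp
    obtain ⟨h, hm⟩ := hn.2 p (Nat.prime_of_mem_primeFactors hp) (Nat.dvd_of_mem_primeFactors hp)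
    exact hm
  obtain ⟨k, hk⟩ := this
  rw [hk, mul_comm, mul_smul, hna, smul_zero]

theorem represents_inclU {s : SuperDiv F M} {y : U F M s} {d : H0 F Fbar M s}
    (h : Represents y d) : Represents (inclU s y) (inclH0 Fbar s d) := by
  change _ = inclUM s (d : UM F M s)
  rw [← show (QuotientAddGroup.mk y : UM F M s) = d from h]
  rfl

/-- The values of `ξ` on `U_r` lie in `F_r`. -/
theorem xiField_inclU_mem (r : RDiv F M) {ξ : U F M Set.univ →+ Additive (𝓞 (FR F Fbar M))ˣ}
    (hξ : IsEquivariant ξ) (y : U F M r.toSuper) :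
    ((xiField ξ (inclU r.toSuper y)).toMul : FR F Fbar M) ∈ subField F Fbar M r.1 := by
  refine mem_of_forall_fixed _ fun g hg => ?_
  rw [← xiField_galU hξ, ← inclU_galU,
    galU_eq_self r.2 (fun a ha => nsmul_eq_zero_of_mem_T ha) hg]

/-- The orders of `κ c_r` at the primes not dividing `r` are divisible by `M`, as `F_r / F` is
unramified at these primes and `κ c_r` differs from a unit by an `M`-th power in `F_r`. -/
theorem mem_range_unitClass [IsTotallyReal F] (hM : Odd M)
    {ξ : U F M Set.univ →+ Additive (𝓞 (FR F Fbar M))ˣ} (hξ : IsEquivariant ξ)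
    {κ : H0 F Fbar M Set.univ →+ Additive (ModPow Fˣ M)} (hκ : IsInduced ξ κ) (r : RDiv F M)
    {c : H0 F Fbar M Set.univ} (hc : c ∈ (inclH0 Fbar r.toSuper).range) {ℓ : ℕ} (hp : ℓ.Prime)
    (hℓ : ℓ.Coprime r.1) : (κ c).toMul ∈ (unitClass F M ℓ).range := by
  obtain ⟨d, rfl⟩ := hc
  obtain ⟨y, hy⟩ := QuotientAddGroup.mk_surjective (d : UM F M r.toSuper)
  obtain ⟨a, ha⟩ := QuotientGroup.mk_surjective (κ (inclH0 Fbar r.toSuper d)).toMul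
  obtain ⟨w, hw⟩ := exists_eq_mul_pow_of_isInduced hκ (represents_inclU hy) ha
  set K := subField F Fbar M r.1 with hK
  have := numberField_subField (F := F) (Fbar := Fbar) (M := M) r.2.ne_zero
  have hxK := xiField_inclU_mem r hξ y
  have hwK : (w : FR F Fbar M) ∈ K := by
    refine mem_of_pow_mem hM K ?_
    have h1 : (w : FR F Fbar M) ^ M = ((xiField ξ (inclU r.toSuper y)).toMul : FR F Fbar M) /
        algebraMap F (FR F Fbar M) a := by
      rw [hw, mul_div_cancel_left₀ _ ((map_ne_zero _).2 a.ne_zero)]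
    rw [h1]
    exact div_mem hxK (K.algebraMap_mem a)
  have hdvd : ∀ v : PrimesAt F ℓ, (M : ℤ) ∣ ordAt v.1 a := by
    intro v
    obtain ⟨Q, hQ, hQv⟩ := exists_place_over K v.1.asIdeal
    have hℓQ : (ℓ : 𝓞 K) ∈ Q := by
      have : (ℓ : 𝓞 F) ∈ Q.comap (algebraMap (𝓞 F) (𝓞 K)) := by rw [hQv]; exact v.2
      simpa using this
    have hQ0 : Q ≠ ⊥ := by
      rintro rfl
      rw [Ideal.mem_bot] at hℓQ
      exact hp.ne_zero (by exact_mod_cast hℓQ)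
    let Q' : HeightOneSpectrum (𝓞 K) := ⟨Q, hQ, hQ0⟩
    have h1 := valuation_algebraMap_of_adjoin r.2.ne_zero (adjoin_subField_eq_top r.1) v.1 Q' hQv
      (natCast_notMem_of_coprime hℓ.symm hℓQ) (a : F)
    let xK : K := ⟨_, hxK⟩
    let wK : K := ⟨w, hwK⟩
    have h2 : xK = algebraMap F K a * wK ^ M := Subtype.ext hw
    have hle : ∀ z : (𝓞 (FR F Fbar M)), ∀ hz : (z : FR F Fbar M) ∈ K,
        Q'.valuation K ⟨z, hz⟩ ≤ 1 := by
      intro z hz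
      have hint : IsIntegral ℤ (⟨z, hz⟩ : K) :=
        (isIntegral_algHom_iff (K.val.restrictScalars ℤ) K.val.injective).1 z.2
      exact Q'.valuation_le_one (⟨_, hint⟩ : 𝓞 K)
    have h3 : Q'.valuation K xK = 1 := by
      refine le_antisymm (hle _ hxK) ?_
      have h4 : ((xiField ξ (inclU r.toSuper y)).toMul : FR F Fbar M)⁻¹ =
          (((((ξ (inclU r.toSuper y)).toMul)⁻¹ : (𝓞 (FR F Fbar M))ˣ) : 𝓞 (FR F Fbar M)) :
            FR F Fbar M) := by
        refine inv_eq_of_mul_eq_one_right ?_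
        exact congrArg (fun z : 𝓞 (FR F Fbar M) => (z : FR F Fbar M))
          (ξ (inclU r.toSuper y)).toMul.mul_inv
      have h5 := inv_mem hxK
      rw [h4] at h5
      have h6 := hle _ h5
      have h7 : (⟨_, h5⟩ : K) = xK⁻¹ := Subtype.ext h4.symm
      rw [h7, map_inv₀] at h6
      have hx0 : xK ≠ 0 := fun h => Units.ne_zero _ (congrArg Subtype.val h)
      exact (inv_le_one₀ (zero_lt_iff.2 ((map_ne_zero _).2 hx0))).1 h6
    have hw0 : wK ≠ 0 := fun h => w.ne_zero (congrArg Subtype.val h)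
    rw [h2, map_mul, h1, map_pow, valuation_eq_exp_ordAt,
      ← WithZero.exp_log ((map_ne_zero (Q'.valuation K)).2 hw0), ← WithZero.exp_nsmul,
      ← WithZero.exp_add, ← WithZero.exp_zero, WithZero.exp_inj, nsmul_eq_mul] at h3
    exact ⟨WithZero.log (Q'.valuation K wK), by linarith⟩
  obtain ⟨u, b, hub⟩ := (exists_eq_unit_mul_pow_iff hp M).2 hdvd
  refine ⟨u, ?_⟩
  rw [← ha, hub]
  exact QuotientGroup.eq.2 ⟨b, (inv_mul_cancel_left (unitIncl F ℓ u) (b ^ M)).symm⟩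

end Away

/-! ### Congruences modulo the places above `ℓ` -/

section Congruences

open IsDedekindDomain

set_option linter.unusedSectionVars false

variable (F : Type*) {Ω : Type*} [Field F] [NumberField F] [Field Ω] [Algebra F Ω]
  [Algebra.IsAlgebraic F Ω] (P : Ideal (𝓞 Ω)) [hP : P.IsPrime]

/-- The group of principal units at `P`. Quotients of units that are congruent modulo `P` are
elements of this group. -/
abbrev U1 : Subgroup Ωˣ := (placeRing F P).principalUnitGroup

variable {P}

theorem mem_U1_iff {x : Ωˣ} : x ∈ U1 F P ↔ placeVal F P ((x : Ω) - 1) < 1 :=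
  ValuationSubring.mem_principalUnitGroup_iff _ x

theorem div_mem_U1_iff {x y : Ωˣ} (hy : placeVal F P (y : Ω) = 1) :
    x / y ∈ U1 F P ↔ placeVal F P ((x : Ω) - y) < 1 := by
  rw [mem_U1_iff, Units.val_div_eq_div_val, div_sub_one y.ne_zero, map_div₀, hy, div_one]

theorem div_mem_U1_iff_modEq {ℓ : ℕ} (hℓ : (ℓ : 𝓞 Ω) ∈ P) (hp : ℓ.Prime) {k m : ℕ}
    (hm : m.Coprime ℓ) {x y : Ωˣ} (hx : (x : Ω) = k) (hy : (y : Ω) = m) :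
    x / y ∈ U1 F P ↔ k ≡ m [MOD ℓ] := by
  rw [div_mem_U1_iff F (by rw [hy]; exact placeVal_natCast_eq_one F hℓ hm), hx, hy, Nat.ModEq.comm,
    Nat.modEq_iff_dvd, ← placeVal_intCast_lt_one_iff F hp hℓ]
  push_cast
  rfl

/-- The powers of a primitive root modulo `ℓ` that are principal units. -/
theorem zpow_mem_U1_iff {ℓ : ℕ} (hℓ : (ℓ : 𝓞 Ω) ∈ P) (hp : ℓ.Prime) {k : ℕ}
    (hk : ∀ n : ℕ, k ^ n ≡ 1 [MOD ℓ] ↔ ℓ - 1 ∣ n) {x : Ωˣ} (hx : (x : Ω) = k) (n : ℤ) :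
    x ^ n ∈ U1 F P ↔ ((ℓ - 1 : ℕ) : ℤ) ∣ n := by
  have hnat : ∀ n : ℕ, x ^ n ∈ U1 F P ↔ ℓ - 1 ∣ n := by
    intro n
    rw [← hk, ← div_mem_U1_iff_modEq F hℓ hp (Nat.coprime_one_left ℓ) (x := x ^ n) (y := 1)
      (by rw [Units.val_pow_eq_pow_val, hx]; push_cast; rfl) (by simp), div_one]
  rcases Int.eq_nat_or_neg n with ⟨m, rfl | rfl⟩
  · rw [zpow_natCast, hnat, Int.natCast_dvd_natCast]
  · rw [zpow_neg, inv_mem_iff, zpow_natCast, hnat, dvd_neg, Int.natCast_dvd_natCast]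

/-- A prime `ℓ` that is a uniformizer at the prime of `F` below `P` computes the valuation at `P` of
the elements of `F`. -/
theorem placeVal_algebraMap_eq_zpow [CharZero Ω] {ℓ : ℕ} (hp : ℓ.Prime) (hℓ : (ℓ : 𝓞 Ω) ∈ P)
    (h : (primeBelow F P hp hℓ).valuation F (ℓ : F) = WithZero.exp (-1 : ℤ)) (a : Fˣ) :
    placeVal F P (algebraMap F Ω a) =
      placeVal F P (ℓ : Ω) ^ ordAt (primeBelow F P hp hℓ) a := by
  have hℓ0 : (ℓ : Ω) ≠ 0 := by exact_mod_cast hp.ne_zero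
  have he := placeVal_isEquiv F (primeBelow F P hp hℓ) rfl
  set n := ordAt (primeBelow F P hp hℓ) a with hn
  have h1 : (primeBelow F P hp hℓ).valuation F ((a : F) / (ℓ : F) ^ n) = 1 := by
    rw [map_div₀, map_zpow₀, h, valuation_eq_exp_ordAt, ← hn, ← WithZero.exp_zsmul, smul_eq_mul,
      mul_neg_one]
    exact div_self WithZero.exp_ne_zero
  have h2 := he.eq_one_iff_eq_one.2 h1
  rw [Valuation.comap_apply, map_div₀, map_zpow₀, map_natCast, map_div₀, map_zpow₀,
    div_eq_one_iff_eq (zpow_ne_zero _ ((map_ne_zero _).2 hℓ0))] at h2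
  exact h2

variable {ℓ : ℕ}

variable (Ω) in
/-- The inclusion in `Ωˣ` of the units of the localization of `𝓞 F` at `ℓ`. -/
def unitInclΩ (ℓ : ℕ) : (locAt F ℓ)ˣ →* Ωˣ :=
  (Units.map (algebraMap F Ω).toMonoidHom).comp (unitIncl F ℓ)

variable (Ω) in
theorem coe_unitInclΩ (u : (locAt F ℓ)ˣ) :
    (unitInclΩ F Ω ℓ u : Ω) = algebraMap F Ω ((u : locAt F ℓ) : F) := rfl

variable (ℓ) in
/-- Reduction modulo `ℓ` of the units of the localization of `𝓞 F` at `ℓ`. -/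
def unitRed : (locAt F ℓ)ˣ →* (ResRing F ℓ)ˣ :=
  Units.map (Ideal.Quotient.mk (Ideal.span {(ℓ : locAt F ℓ)})).toMonoidHom

theorem placeVal_unitInclΩ (hℓ : (ℓ : 𝓞 Ω) ∈ P) (u : (locAt F ℓ)ˣ) :
    placeVal F P (unitInclΩ F Ω ℓ u : Ω) = 1 := by
  have h : ∀ w : (locAt F ℓ)ˣ, placeVal F P (unitInclΩ F Ω ℓ w : Ω) ≤ 1 := fun w =>
    placeVal_le_one_of_mem_locAt F hℓ (w : locAt F ℓ).2
  refine le_antisymm (h u) ?_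
  have h1 := h u⁻¹
  rw [map_inv, Units.val_inv_eq_inv_val, map_inv₀] at h1
  exact (inv_le_one₀ (zero_lt_iff.2 ((map_ne_zero _).2 (Units.ne_zero _)))).1 h1

theorem placeVal_sub_lt_one_of_mk_eq (hℓ : (ℓ : 𝓞 Ω) ∈ P) {b c : locAt F ℓ}
    (h : Ideal.Quotient.mk (Ideal.span {(ℓ : locAt F ℓ)}) b = Ideal.Quotient.mk _ c) :
    placeVal F P (algebraMap F Ω b - algebraMap F Ω c) < 1 := by
  rw [Ideal.Quotient.eq] at h
  obtain ⟨t, ht⟩ := Ideal.mem_span_singleton'.1 h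
  have h1 : algebraMap F Ω (b : F) - algebraMap F Ω c = algebraMap F Ω t * ℓ := by
    rw [← map_sub, ← AddSubgroupClass.coe_sub, ← ht]
    simp
  rw [h1, map_mul]
  exact (mul_le_of_le_one_left' (placeVal_le_one_of_mem_locAt F hℓ t.2)).trans_lt
    ((placeVal_natCast_lt_one_iff F).2 hℓ)

theorem mk_eq_of_forall_valuation (hp : ℓ.Prime)
    (hun : ∀ v : PrimesAt F ℓ, v.1.valuation F (ℓ : F) = WithZero.exp (-1 : ℤ)) {b c : locAt F ℓ}
    (h : ∀ v : PrimesAt F ℓ, v.1.valuation F ((b : F) - c) < 1) :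
    Ideal.Quotient.mk (Ideal.span {(ℓ : locAt F ℓ)}) b = Ideal.Quotient.mk _ c := by
  have hℓ0 : (ℓ : F) ≠ 0 := by exact_mod_cast hp.ne_zero
  have hmem : ((b : F) - c) / ℓ ∈ locAt F ℓ := by
    refine mem_locAt_of_valuation_le_one hp fun v => ?_
    have h1 := h v
    rw [map_div₀, hun v, div_le_one₀ WithZero.exp_pos]
    rcases eq_or_ne (v.1.valuation F ((b : F) - c)) 0 with h0 | h0
    · rw [h0]; exact zero_le
    · rw [← WithZero.exp_log h0, ← WithZero.exp_zero, WithZero.exp_lt_exp] at h1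
      rw [← WithZero.exp_log h0, WithZero.exp_le_exp]
      omega
  rw [Ideal.Quotient.eq]
  refine Ideal.mem_span_singleton'.2 ⟨⟨_, hmem⟩, Subtype.ext ?_⟩
  push_cast
  exact div_mul_cancel₀ _ hℓ0

variable (Ω) in
/-- A unit at `ℓ` is trivial modulo `ℓ` if and only if it is a principal unit at all places. -/
theorem unitRed_eq_one_iff [CharZero Ω] (hp : ℓ.Prime)
    (hun : ∀ v : PrimesAt F ℓ, v.1.valuation F (ℓ : F) = WithZero.exp (-1 : ℤ)) (u : (locAt F ℓ)ˣ) :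
    unitRed F ℓ u = 1 ↔ ∀ (P : Ideal (𝓞 Ω)) [P.IsPrime], (ℓ : 𝓞 Ω) ∈ P →
      unitInclΩ F Ω ℓ u ∈ U1 F P := by
  constructor
  · intro h P hP hℓ
    rw [mem_U1_iff, coe_unitInclΩ]
    have h1 : Ideal.Quotient.mk (Ideal.span {(ℓ : locAt F ℓ)}) u = Ideal.Quotient.mk _ 1 :=
      congrArg Units.val h
    have := placeVal_sub_lt_one_of_mk_eq F hℓ h1
    simpa using this
  · intro h
    refine Units.ext ?_
    refine mk_eq_of_forall_valuation F hp hun (b := u) (c := 1) fun v => ?_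
    obtain ⟨P, hP, hPv⟩ := exists_place_over Ω v.1.asIdeal
    have hℓ : (ℓ : 𝓞 Ω) ∈ P := by
      have : (ℓ : 𝓞 F) ∈ P.comap (algebraMap (𝓞 F) (𝓞 Ω)) := by rw [hPv]; exact v.2
      simpa using this
    have h1 := h P hℓ
    rw [mem_U1_iff, coe_unitInclΩ] at h1
    refine ((placeVal_isEquiv F v.1 hPv).lt_one_iff_lt_one).1 ?_
    rw [Valuation.comap_apply, map_sub]
    simpa using h1

theorem exists_mk_eq_integer (q : ResRing F ℓ) :
    ∃ y : 𝓞 F, q = Ideal.Quotient.mk _ (⟨y, algebraMap_mem_locAt F ℓ y⟩ : locAt F ℓ) := by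
  obtain ⟨⟨_, n, d, hd, hd0, rfl⟩, rfl⟩ := Ideal.Quotient.mk_surjective q
  have hd' := hd
  obtain ⟨s, t, hst⟩ := hd
  refine ⟨n * s, Ideal.Quotient.eq.2 (Ideal.mem_span_singleton'.2
    ⟨⟨(n * t : 𝓞 F) / d, n * t, d, hd', hd0, rfl⟩, Subtype.ext ?_⟩)⟩
  have h1 : (s : F) * d + t * ℓ = 1 := by
    have := congrArg (fun z : 𝓞 F => (z : F)) hst
    simpa using this
  change ((n : F) * t) / d * (((ℓ : locAt F ℓ)) : F) = n / d - n * s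
  rw [show (((ℓ : locAt F ℓ)) : F) = (ℓ : F) by simp]
  field_simp
  linear_combination (n : F) * h1

end Congruences

/-! ### Primes of residue degree one -/

section ResidueDegree

open IsDedekindDomain

variable {F : Type*} [Field F] [NumberField F]

/-- At a prime of residue degree one the residue field is the prime field. -/
theorem card_quotient_eq_and_exists_natCast {ℓ : ℕ} (hp : ℓ.Prime) (v : HeightOneSpectrum (𝓞 F))
    (hℓ : (ℓ : 𝓞 F) ∈ v.asIdeal) (h : v.asIdeal.inertiaDeg ℤ = 1) :
    Nat.card (𝓞 F ⧸ v.asIdeal) = ℓ ∧ ∀ y : 𝓞 F, ∃ m : ℕ, y - m ∈ v.asIdeal := by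
  have hprime : (Ideal.span {(ℓ : ℤ)}).IsPrime :=
    (Ideal.span_singleton_prime (by simpa using hp.ne_zero)).2 (Nat.prime_iff_prime_int.1 hp)
  have hmax : (Ideal.span {(ℓ : ℤ)}).IsMaximal :=
    hprime.isMaximal (by simpa using hp.ne_zero)
  have hover : v.asIdeal.LiesOver (Ideal.span {(ℓ : ℤ)}) := by
    refine ⟨hmax.eq_of_le (Ideal.IsPrime.comap (algebraMap ℤ (𝓞 F))).ne_top ?_⟩
    rw [Ideal.span_singleton_le_iff_mem]
    simpa using hℓ
  rw [Ideal.inertiaDeg_eq_of_isMaximal (Ideal.span {(ℓ : ℤ)}) v.asIdeal] at h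
  let : Field (ℤ ⧸ Ideal.span {(ℓ : ℤ)}) := Ideal.Quotient.field _
  have hs := (finrank_eq_one_iff_of_nonzero' (1 : 𝓞 F ⧸ v.asIdeal) one_ne_zero).1 h
  constructor
  · have : Module.Finite (ℤ ⧸ Ideal.span {(ℓ : ℤ)}) (𝓞 F ⧸ v.asIdeal) :=
      Module.finite_of_finrank_eq_succ h
    rw [Module.natCard_eq_pow_finrank (K := ℤ ⧸ Ideal.span {(ℓ : ℤ)}), h, pow_one,
      Nat.card_congr (Int.quotientSpanNatEquivZMod ℓ).toEquiv, Nat.card_zmod]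
  · intro y
    obtain ⟨c, hc⟩ := hs (Ideal.Quotient.mk _ y)
    obtain ⟨n, rfl⟩ := Ideal.Quotient.mk_surjective c
    have hc' : Ideal.Quotient.mk v.asIdeal y = Ideal.Quotient.mk v.asIdeal (n : 𝓞 F) := by
      rw [← hc, Algebra.smul_def, mul_one]
      simp
    have hℓ0 : (ℓ : ℤ) ≠ 0 := by exact_mod_cast hp.ne_zero
    refine ⟨(n % ℓ).toNat, ?_⟩
    have h1 : (((n % ℓ).toNat : ℕ) : 𝓞 F) = n - ℓ * (n / ℓ : ℤ) := by
      have : (((n % ℓ).toNat : ℕ) : ℤ) = n - ℓ * (n / ℓ) := by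
        rw [Int.toNat_of_nonneg (Int.emod_nonneg _ hℓ0), Int.emod_def]
      exact_mod_cast congrArg (fun z : ℤ => (z : 𝓞 F)) this
    rw [h1, sub_sub_eq_add_sub, add_sub_right_comm]
    exact v.asIdeal.add_mem (Ideal.Quotient.eq.1 hc') (v.asIdeal.mul_mem_right _ hℓ)

end ResidueDegree

/-! ### Tame inertia: quotients `y / σ y` modulo principal units -/

section Inertia

set_option linter.unusedSectionVars false

variable {F : Type*} [Field F] [NumberField F] {Fbar : Type*} [Field Fbar] [Algebra F Fbar]
  [IsAlgClosure F Fbar] {M : ℕ}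

/-- A generator of the inertia group at `ℓ` acts on the `ℓ`-th roots of unity by raising to the
power `k`, for a primitive root `k` modulo `ℓ`. -/
theorem exists_primitiveRoot_modulo (ℓ : RPrime F M) {σ : G F Fbar M}
    (hσ : Subgroup.zpowers σ = inertiaGroup F Fbar M ℓ.1) {ζ : FR F Fbar M}
    (hζ : IsPrimitiveRoot ζ ℓ.1) :
    ∃ k : ℕ, σ ζ = ζ ^ k ∧ (∀ n : ℕ, k ^ n ≡ 1 [MOD ℓ.1] ↔ ℓ.1 - 1 ∣ n) ∧
      ∀ m : ℕ, m.Coprime ℓ.1 → ∃ i : ℕ, k ^ i ≡ m [MOD ℓ.1] := by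
  have hp : Fact ℓ.1.Prime := ⟨ℓ.2.1⟩
  set χ := hζ.autToPow F with hχ
  have hspec : ∀ g : G F Fbar M, ζ ^ ((χ g : (ZMod ℓ.1)ˣ) : ZMod ℓ.1).val = g ζ := fun g =>
    hζ.autToPow_spec F g
  have hgen : ∀ u : (ZMod ℓ.1)ˣ, u ∈ Subgroup.zpowers (χ σ) := by
    intro u
    obtain ⟨g, hg, hgζ⟩ := exists_mem_inertiaGroup ℓ hζ
      (hζ.pow_of_coprime _ (ZMod.val_coe_unit_coprime u))
    rw [← hσ] at hg
    obtain ⟨i, rfl⟩ := hg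
    refine ⟨i, ?_⟩
    have h1 := hspec (σ ^ i)
    rw [hgζ] at h1
    have h2 := hζ.pow_inj (ZMod.val_lt _) (ZMod.val_lt _) h1
    have h3 : χ (σ ^ i) = u := Units.ext (ZMod.val_injective _ h2)
    rw [← h3, map_zpow]
  have hcast : (((((χ σ : (ZMod ℓ.1)ˣ) : ZMod ℓ.1).val : ℕ)) : ZMod ℓ.1) = (χ σ : (ZMod ℓ.1)ˣ) :=
    ZMod.natCast_zmod_val _
  refine ⟨((χ σ : (ZMod ℓ.1)ˣ) : ZMod ℓ.1).val, (hspec σ).symm, fun n => ?_, fun m hm => ?_⟩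
  · rw [← ZMod.natCast_eq_natCast_iff, Nat.cast_pow, hcast, Nat.cast_one, ← Units.val_pow_eq_pow_val,
      Units.val_eq_one, ← orderOf_dvd_iff_pow_eq_one, orderOf_eq_card_of_forall_mem_zpowers hgen,
      Nat.card_eq_fintype_card, ZMod.card_units_eq_totient, Nat.totient_prime ℓ.2.1]
  · obtain ⟨i, hi⟩ := mem_powers_iff_mem_zpowers.2 (hgen (ZMod.unitOfCoprime m hm))
    refine ⟨i, ?_⟩
    rw [← ZMod.natCast_eq_natCast_iff, Nat.cast_pow, hcast, ← Units.val_pow_eq_pow_val]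
    exact (congrArg Units.val hi).trans (ZMod.coe_unitOfCoprime m hm)

theorem coprime_of_pow_modEq_iff {ℓ k : ℕ} (hk : ∀ n : ℕ, k ^ n ≡ 1 [MOD ℓ] ↔ ℓ - 1 ∣ n)
    (hℓ : 1 < ℓ) : k.Coprime ℓ := by
  have h1 := ((hk (ℓ - 1)).2 dvd_rfl).gcd_eq
  rw [Nat.gcd_one_left] at h1
  exact Nat.Coprime.coprime_dvd_left (dvd_pow_self k (by omega)) h1

/-- The action of `σ` on the units of `F_𝐫`. -/
abbrev galUnits (σ : G F Fbar M) : (FR F Fbar M)ˣ →* (FR F Fbar M)ˣ :=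
  Units.map (MonoidHomClass.toMonoidHom σ)

variable {P : Ideal (𝓞 (FR F Fbar M))} [hP : P.IsPrime] {ℓ : ℕ}

theorem sub_mem_of_mem_inertiaGroup (hp : ℓ.Prime) (hℓ : (ℓ : 𝓞 (FR F Fbar M)) ∈ P)
    {σ : G F Fbar M} (hσ : σ ∈ inertiaGroup F Fbar M ℓ) (x : 𝓞 (FR F Fbar M)) :
    RingOfIntegers.mapAlgEquiv σ x - x ∈ P :=
  mem_inertiaGroup_iff.1 hσ P (mem_placesAbove hp P hℓ) x

theorem div_galUnits_mem_U1 (hp : ℓ.Prime) (hℓ : (ℓ : 𝓞 (FR F Fbar M)) ∈ P)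
    {σ : G F Fbar M} (hσ : σ ∈ inertiaGroup F Fbar M ℓ) {t : (FR F Fbar M)ˣ}
    (ht : placeVal F P (t : FR F Fbar M) = 1) : t / galUnits σ t ∈ U1 F P := by
  rw [← inv_mem_iff, inv_div, div_mem_U1_iff F ht]
  exact placeVal_sub_lt_one_of_inertia F σ (sub_mem_of_mem_inertiaGroup hp hℓ hσ) ht.le

theorem placeVal_map_le_of_le (hp : ℓ.Prime) (hℓ : (ℓ : 𝓞 (FR F Fbar M)) ∈ P)
    {σ : G F Fbar M} (hσ : σ ∈ inertiaGroup F Fbar M ℓ) {x y : (FR F Fbar M)}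
    (h : placeVal F P x ≤ placeVal F P y) : placeVal F P (σ x) ≤ placeVal F P (σ y) := by
  rcases eq_or_ne y 0 with rfl | hy
  · rw [map_zero] at h
    rw [(map_eq_zero (placeVal F P)).1 (le_antisymm h zero_le)]
  have hv : 0 < placeVal F P y := zero_lt_iff.2 ((map_ne_zero _).2 hy)
  have hv' : 0 < placeVal F P (σ y) := zero_lt_iff.2 ((map_ne_zero _).2 ((map_ne_zero σ).2 hy))
  have h1 : placeVal F P (x / y) ≤ 1 := by
    rw [map_div₀]
    exact (div_le_one₀ hv).2 h
  have h2 := placeVal_sub_lt_one_of_inertia F σ (sub_mem_of_mem_inertiaGroup hp hℓ hσ) h1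
  have h3 : placeVal F P (σ (x / y)) ≤ 1 := by
    rw [← sub_add_cancel (σ (x / y)) (x / y)]
    exact (Valuation.map_add _ _ _).trans (max_le h2.le h1)
  rw [map_div₀ σ, map_div₀] at h3
  exact (div_le_one₀ hv').1 h3

/-- Elements of the inertia group preserve the valuation. They preserve the order between valuations
of elements, so the valuations along a finite orbit, which increase or decrease, are constant. -/
theorem placeVal_map_eq (hp : ℓ.Prime) (hℓ : (ℓ : 𝓞 (FR F Fbar M)) ∈ P)
    {σ : G F Fbar M} (hσ : σ ∈ inertiaGroup F Fbar M ℓ) {n : ℕ} (hn : n ≠ 0) {x : FR F Fbar M}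
    (hx : x ∈ subField F Fbar M n) : placeVal F P (σ x) = placeVal F P x := by
  have := finiteDimensional_subField (F := F) (Fbar := Fbar) (M := M) hn
  set K := subField F Fbar M n
  obtain ⟨N, hN, hNx⟩ : ∃ N : ℕ, 0 < N ∧ (σ ^ N) x = x := by
    refine ⟨Nat.card (K ≃ₐ[F] K), Nat.card_pos, ?_⟩
    have h1 : AlgEquiv.restrictNormalHom K (σ ^ Nat.card (K ≃ₐ[F] K)) = 1 := by
      rw [map_pow, pow_card_eq_one']
    have h2 := AlgEquiv.restrictNormal_commutes (σ ^ Nat.card (K ≃ₐ[F] K)) K ⟨x, hx⟩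
    have h3 : (σ ^ Nat.card (K ≃ₐ[F] K)).restrictNormal K = 1 := h1
    rw [h3] at h2
    exact h2.symm
  have hpow : ∀ i : ℕ, (σ ^ (i + 1)) x = σ ((σ ^ i) x) := fun i => by
    rw [pow_succ', AlgEquiv.mul_apply]
  obtain ⟨N, rfl⟩ := Nat.exists_eq_succ_of_ne_zero hN.ne'
  have hle : ∀ {y : FR F Fbar M}, placeVal F P y ≤ placeVal F P (σ y) →
      ∀ i : ℕ, placeVal F P y ≤ placeVal F P ((σ ^ i) y) := by
    intro y h i
    induction i with
    | zero => exact le_rfl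
    | succ i ih =>
      rw [pow_succ', AlgEquiv.mul_apply]
      exact h.trans (placeVal_map_le_of_le hp hℓ hσ ih)
  have hge : ∀ {y : FR F Fbar M}, placeVal F P (σ y) ≤ placeVal F P y →
      ∀ i : ℕ, placeVal F P ((σ ^ i) y) ≤ placeVal F P y := by
    intro y h i
    induction i with
    | zero => exact le_rfl
    | succ i ih =>
      rw [pow_succ', AlgEquiv.mul_apply]
      exact (placeVal_map_le_of_le hp hℓ hσ ih).trans h
  have hback : (σ ^ N) (σ x) = x := by rw [← AlgEquiv.mul_apply, ← pow_succ, hNx]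
  rcases le_total (placeVal F P x) (placeVal F P (σ x)) with h | h
  · refine le_antisymm ?_ h
    have h1 := hle (placeVal_map_le_of_le hp hℓ hσ h) N
    rwa [hback] at h1
  · refine le_antisymm h ?_
    have h1 := hge (placeVal_map_le_of_le hp hℓ hσ h) N
    rwa [hback] at h1

/-- The element `1 - ζ`, for `ζ` a primitive `ℓ`-th root of unity; it is the uniformizer in which
orders at the places above `ℓ` are measured. -/
def cyclUnif (hp : ℓ.Prime) {ζ : FR F Fbar M} (hζ : IsPrimitiveRoot ζ ℓ) : (FR F Fbar M)ˣ :=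
  Units.mk0 (1 - ζ) (one_sub_ne_zero hp hζ)

theorem cyclUnif_div_galUnits_mul_mem_U1 (hp : ℓ.Prime) (hℓ : (ℓ : 𝓞 (FR F Fbar M)) ∈ P)
    {σ : G F Fbar M} {ζ : FR F Fbar M} (hζ : IsPrimitiveRoot ζ ℓ) {k : ℕ} (hk : σ ζ = ζ ^ k)
    (hkℓ : k.Coprime ℓ) {κ : (FR F Fbar M)ˣ} (hκ : (κ : FR F Fbar M) = k) :
    cyclUnif hp hζ / galUnits σ (cyclUnif hp hζ) * κ ∈ U1 F P := by
  have hκ1 : placeVal F P (κ : FR F Fbar M) = 1 := by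
    rw [hκ]
    exact placeVal_natCast_eq_one F hℓ hkℓ
  have h1 : placeVal F P (ζ) ≤ 1 :=
    (valuation_eq_one_of_pow_eq_one (placeVal F P) hp.ne_zero hζ.pow_eq_one).le
  have h2 : cyclUnif hp hζ / galUnits σ (cyclUnif hp hζ) * κ =
      (galUnits σ (cyclUnif hp hζ) / cyclUnif hp hζ / κ)⁻¹ := by
    rw [inv_div, div_div_eq_mul_div, mul_comm, mul_div_assoc]
  rw [h2, inv_mem_iff, div_mem_U1_iff F hκ1, Units.val_div_eq_div_val]
  have h3 : ((galUnits σ (cyclUnif hp hζ) : (FR F Fbar M)ˣ) : FR F Fbar M) =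
      (∑ i ∈ Finset.range k, ζ ^ i) * (1 - ζ) := by
    rw [geom_sum_mul_neg]
    change σ (1 - ζ) = _
    rw [map_sub, map_one, hk]
  have h4 : ((galUnits σ (cyclUnif hp hζ) : (FR F Fbar M)ˣ) : FR F Fbar M) /
      (cyclUnif hp hζ : (FR F Fbar M)ˣ) - κ = ∑ i ∈ Finset.range k, -(1 - ζ ^ i) := by
    rw [h3, show ((cyclUnif hp hζ : (FR F Fbar M)ˣ) : FR F Fbar M) = 1 - ζ from rfl,
      mul_div_cancel_right₀ _ (one_sub_ne_zero hp hζ), hκ]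
    simp
  rw [h4]
  refine Valuation.map_sum_lt _ one_ne_zero fun i _ => ?_
  rw [Valuation.map_neg]
  exact (valuation_one_sub_pow_le _ h1 i).trans_lt
    (valuation_one_sub_lt_one hp hζ ((placeVal_natCast_lt_one_iff F).2 hℓ))

/-- The tame character: if `y` has the valuation of `(1 - ζ_ℓ) ^ n`, then `y / σ y` is congruent to
`k ^ (-n)`, where `σ` raises the `ℓ`-th roots of unity to the power `k`. -/
theorem div_galUnits_mul_zpow_mem_U1 (hp : ℓ.Prime) (hℓ : (ℓ : 𝓞 (FR F Fbar M)) ∈ P)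
    {σ : G F Fbar M} (hσ : σ ∈ inertiaGroup F Fbar M ℓ) {ζ : FR F Fbar M}
    (hζ : IsPrimitiveRoot ζ ℓ) {k : ℕ} (hk : σ ζ = ζ ^ k)
    (hkℓ : k.Coprime ℓ) {κ : (FR F Fbar M)ˣ} (hκ : (κ : FR F Fbar M) = k) {y : (FR F Fbar M)ˣ}
    {n : ℤ} (hy : placeVal F P (y : FR F Fbar M) = placeVal F P (1 - ζ) ^ n) :
    y / galUnits σ y * κ ^ n ∈ U1 F P := by
  have hπ : placeVal F P (1 - ζ) ≠ 0 := (map_ne_zero _).2 (one_sub_ne_zero hp hζ)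
  have h1 : placeVal F P ((y / cyclUnif hp hζ ^ n : (FR F Fbar M)ˣ) : FR F Fbar M) = 1 := by
    rw [Units.val_div_eq_div_val, Units.val_zpow_eq_zpow_val, map_div₀, map_zpow₀, hy]
    exact div_self (zpow_ne_zero _ hπ)
  have h2 := (U1 F P).mul_mem (div_galUnits_mem_U1 hp hℓ hσ h1)
    ((U1 F P).zpow_mem (cyclUnif_div_galUnits_mul_mem_U1 hp hℓ hζ hk hkℓ hκ) n)
  convert h2 using 1
  rw [map_div, map_zpow, mul_zpow, div_zpow, div_div_div_eq, ← mul_assoc, ← mul_div_mul_comm]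
  congr 1
  rw [div_eq_div_iff_mul_eq_mul]
  simp only [mul_comm, mul_left_comm, mul_assoc]

/-- If `x ^ N_ℓ = a`, with `x` at level `ℓ`, then the order of `x` at a place above `ℓ` is that of
`a` at the prime of `F` below it, in terms of the uniformizer `1 - ζ_ℓ`. -/
theorem placeVal_eq_zpow_of_norm (ℓ : RPrime F M) (hℓ : (ℓ.1 : 𝓞 (FR F Fbar M)) ∈ P)
    {σ : G F Fbar M} (hσ : σ ∈ inertiaGroup F Fbar M ℓ.1) {ζ : FR F Fbar M}
    (hζ : IsPrimitiveRoot ζ ℓ.1) {x : FR F Fbar M} (hx : x ∈ subField F Fbar M ℓ.1) {a : Fˣ}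
    (ha : algebraMap F (FR F Fbar M) a = ∏ i ∈ Finset.range (ℓ.1 - 1), (σ ^ i) x) :
    placeVal F P x = placeVal F P (1 - ζ) ^ ordAt (primeBelow F P ℓ.2.1 hℓ) a := by
  have h1 : ∀ i : ℕ, placeVal F P ((σ ^ i) x) = placeVal F P x := by
    intro i
    induction i with
    | zero => rfl
    | succ i ih =>
      rw [pow_succ', AlgEquiv.mul_apply,
        placeVal_map_eq ℓ.2.1 hℓ hσ ℓ.2.1.ne_zero (map_mem_of_normal _ _ hx), ih]
  have h2 := placeVal_algebraMap_eq_zpow F ℓ.2.1 hℓ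
    (valuation_natCast_RPrime ℓ _ (natCast_mem_primeBelow F P ℓ.2.1 hℓ)) a
  rw [ha, map_prod, Finset.prod_congr rfl fun i _ => h1 i, Finset.prod_const, Finset.card_range,
    ← valuation_one_sub_pow_eq ℓ.2.1 hζ, ← zpow_natCast (placeVal F P (1 - ζ)), ← zpow_mul,
    mul_comm, zpow_mul, zpow_natCast] at h2
  exact (pow_left_inj₀ zero_le zero_le (Nat.sub_ne_zero_of_lt ℓ.2.1.one_lt)).1 h2

end Inertia

/-! ### Fractional ideals of the localization at `ℓ` -/

section Principal

set_option linter.unusedSectionVars false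

open IsDedekindDomain

variable {F : Type*} [Field F] [NumberField F] {ℓ : ℕ}

/-- An element of `F` integral at `ℓ` with denominator prime to `ℓ` lies in an ideal of the
localization if and only if its numerator does. -/
theorem mem_ideal_locAt_iff (m : Ideal (locAt F ℓ)) {a b : 𝓞 F} (hb : IsCoprime b (ℓ : 𝓞 F))
    (hb0 : (b : F) ≠ 0) (h : (a : F) / b ∈ locAt F ℓ) :
    (⟨(a : F) / b, h⟩ : locAt F ℓ) ∈ m ↔ (⟨a, algebraMap_mem_locAt F ℓ a⟩ : locAt F ℓ) ∈ m := by
  have h1 : (⟨a, algebraMap_mem_locAt F ℓ a⟩ : locAt F ℓ) =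
      ⟨b, algebraMap_mem_locAt F ℓ b⟩ * ⟨(a : F) / b, h⟩ :=
    Subtype.ext (mul_div_cancel₀ _ hb0).symm
  have h2 : (⟨(a : F) / b, h⟩ : locAt F ℓ) =
      ⟨((1 : 𝓞 F) : F) / b, 1, b, hb, hb0, rfl⟩ * ⟨a, algebraMap_mem_locAt F ℓ a⟩ := by
    refine Subtype.ext ?_
    change (a : F) / b = ((1 : 𝓞 F) : F) / b * a
    rw [show ((1 : 𝓞 F) : F) = 1 from rfl]
    field_simp
  constructor
  · intro hm
    rw [h1]
    exact m.mul_mem_left _ hm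
  · intro hm
    rw [h2]
    exact m.mul_mem_left _ hm

/-- The localization at `ℓ` is semilocal. -/
theorem finite_maximal_locAt (hp : ℓ.Prime) : {m : Ideal (locAt F ℓ) | m.IsMaximal}.Finite := by
  let ι : 𝓞 F →+* locAt F ℓ :=
    (algebraMap (𝓞 F) F).codRestrict (locAt F ℓ) fun a => algebraMap_mem_locAt F ℓ a
  have hfin : Finite (PrimesAt F ℓ) := finite_primesAt hp
  refine Set.Finite.of_injOn (f := fun m : Ideal (locAt F ℓ) => m.comap ι)
    (t := insert ⊥ (Set.range fun v : PrimesAt F ℓ => v.1.asIdeal)) ?_ ?_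
    ((Set.finite_range _).insert _)
  · intro m hm
    have hm' : m.IsPrime := Ideal.IsMaximal.isPrime hm
    rcases eq_or_ne (m.comap ι) ⊥ with h0 | h0
    · exact Or.inl h0
    refine Or.inr ⟨⟨⟨m.comap ι, hm'.comap ι, h0⟩, ?_⟩, rfl⟩
    by_contra hℓ
    have hmax : (m.comap ι).IsMaximal := (hm'.comap ι).isMaximal h0
    obtain ⟨y, b, hb, hyb⟩ := hmax.exists_inv hℓ
    have hbℓ : IsCoprime b (ℓ : 𝓞 F) := ⟨1, y, by rw [one_mul, add_comm, hyb]⟩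
    have hb0 : (b : F) ≠ 0 := by
      intro h
      obtain ⟨Q, hQ, hQℓ⟩ := exists_prime_natCast_mem F hp
      refine notMem_of_isCoprime hbℓ hQℓ ?_
      rw [show b = 0 from RingOfIntegers.ext h]
      exact Q.zero_mem
    have h1 := (mem_ideal_locAt_iff m hbℓ hb0 ⟨b, b, hbℓ, hb0, rfl⟩).2 hb
    refine hm'.one_notMem ?_
    rwa [show (1 : locAt F ℓ) = ⟨(b : F) / b, b, b, hbℓ, hb0, rfl⟩ from
      Subtype.ext (div_self hb0).symm]
  · intro m _ m' _ h
    refine Ideal.ext fun z => ?_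
    obtain ⟨z, a, b, hb, hb0, rfl⟩ := z
    exact (mem_ideal_locAt_iff m hb hb0 _).trans ((SetLike.ext_iff.1 h a).trans
      (mem_ideal_locAt_iff m' hb hb0 _).symm)

theorem toPrincipalIdeal_locAt_surjective (hp : ℓ.Prime) :
    Function.Surjective (toPrincipalIdeal (locAt F ℓ) F) := by
  intro I
  have h1 := FractionalIdeal.isPrincipal.of_finite_maximals_of_inv le_rfl
    (finite_maximal_locAt (F := F) hp) (I : FractionalIdeal (locAt F ℓ)⁰ F) _ I.mul_inv
  obtain ⟨x, hx⟩ := (FractionalIdeal.isPrincipal_iff _).1 h1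
  have hx0 : x ≠ 0 := by
    rintro rfl
    rw [FractionalIdeal.spanSingleton_zero] at hx
    exact I.ne_zero hx
  exact ⟨Units.mk0 x hx0, toPrincipalIdeal_eq_iff.2 hx.symm⟩

theorem toPrincipalIdeal_locAt_eq_one_iff (a : Fˣ) :
    toPrincipalIdeal (locAt F ℓ) F a = 1 ↔ a ∈ (unitIncl F ℓ).range := by
  rw [toPrincipalIdeal_eq_iff, Units.val_one, ← FractionalIdeal.spanSingleton_one, eq_comm,
    FractionalIdeal.spanSingleton_eq_spanSingleton]
  constructor
  · rintro ⟨u, hu⟩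
    refine ⟨u, Units.ext ?_⟩
    rw [← hu, Units.smul_def, Algebra.smul_def, mul_one]
    rfl
  · rintro ⟨u, rfl⟩
    refine ⟨u, ?_⟩
    rw [Units.smul_def, Algebra.smul_def, mul_one]
    rfl

theorem bracket_surjective (hp : ℓ.Prime) (M : ℕ) : Function.Surjective (bracket F M ℓ) := by
  intro J
  obtain ⟨I, rfl⟩ := QuotientGroup.mk_surjective J
  obtain ⟨a, rfl⟩ := toPrincipalIdeal_locAt_surjective hp I
  exact ⟨QuotientGroup.mk a, rfl⟩

theorem bracket_mk_eq_one_iff (hp : ℓ.Prime) (M : ℕ) (a : Fˣ) :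
    bracket F M ℓ (QuotientGroup.mk a) = 1 ↔ ∀ v : PrimesAt F ℓ, (M : ℤ) ∣ ordAt v.1 a := by
  rw [← exists_eq_unit_mul_pow_iff hp M]
  change (QuotientGroup.mk (toPrincipalIdeal (locAt F ℓ) F a) : ModPow (FracGroup F ℓ) M) = 1 ↔ _
  rw [QuotientGroup.eq_one_iff]
  constructor
  · rintro ⟨I, hI⟩
    obtain ⟨b, rfl⟩ := toPrincipalIdeal_locAt_surjective hp I
    obtain ⟨u, hu⟩ := (toPrincipalIdeal_locAt_eq_one_iff (ℓ := ℓ) (a / b ^ M)).1 (by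
      rw [map_div, map_pow, ← hI]
      exact div_self' _)
    exact ⟨u, b, by rw [hu, div_mul_cancel]⟩
  · rintro ⟨u, b, rfl⟩
    refine ⟨toPrincipalIdeal (locAt F ℓ) F b, ?_⟩
    rw [map_mul, (toPrincipalIdeal_locAt_eq_one_iff _).2 ⟨u, rfl⟩, one_mul, map_pow]
    rfl

end Principal

/-! ### The isomorphism `exp_ℓ` -/

section Exp

open IsDedekindDomain

set_option linter.unusedSectionVars false

variable {F : Type*} [Field F] [NumberField F] {Fbar : Type*} [Field Fbar] [Algebra F Fbar]
  [IsAlgClosure F Fbar] {M : ℕ}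

theorem mul_div_of_RPrime (ℓ : RPrime F M) : M * ((ℓ.1 - 1) / M) = ℓ.1 - 1 :=
  Nat.mul_div_cancel' ((Nat.modEq_iff_dvd' ℓ.2.1.one_lt.le).1 ℓ.2.2.2.1.symm)

theorem div_ne_zero_of_RPrime (ℓ : RPrime F M) : (ℓ.1 - 1) / M ≠ 0 := by
  intro h
  have h1 := mul_div_of_RPrime ℓ
  have h2 := ℓ.2.1.one_lt
  rw [h] at h1
  omega

theorem dvd_div_mul_iff (ℓ : RPrime F M) (n : ℤ) :
    ((ℓ.1 - 1 : ℕ) : ℤ) ∣ ((ℓ.1 - 1) / M : ℕ) * n ↔ (M : ℤ) ∣ n := by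
  have h1 : ((ℓ.1 - 1 : ℕ) : ℤ) = ((ℓ.1 - 1) / M : ℕ) * M := by
    rw [← Nat.cast_mul, mul_comm, mul_div_of_RPrime]
  rw [h1]
  exact mul_dvd_mul_iff_left (by exact_mod_cast div_ne_zero_of_RPrime ℓ)

theorem exists_unit_of_integer {ℓ : ℕ} (hp : ℓ.Prime) {y : 𝓞 F}
    (hy : ∀ v : PrimesAt F ℓ, y ∉ v.1.asIdeal) :
    ∃ u : (locAt F ℓ)ˣ, ((u : locAt F ℓ) : F) = y := by
  have hloc : (y : F)⁻¹ ∈ locAt F ℓ := mem_locAt_of_valuation_le_one hp fun v => by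
    rw [map_inv₀, show v.1.valuation F (y : F) = 1 from
      v.1.valuation_eq_one_iff_notMem.2 (hy v), inv_one]
  rcases eq_or_ne (y : F) 0 with h0 | h0
  · obtain ⟨P, hP, h⟩ := exists_prime_natCast_mem F hp
    have hPb : P ≠ ⊥ := by
      rintro rfl
      exact hp.ne_zero (by exact_mod_cast (Ideal.mem_bot.1 h))
    refine absurd ?_ (hy ⟨⟨P, hP, hPb⟩, h⟩)
    rw [show y = 0 from RingOfIntegers.ext h0]
    exact P.zero_mem
  · exact ⟨⟨⟨y, algebraMap_mem_locAt F ℓ y⟩, ⟨_, hloc⟩, Subtype.ext (mul_inv_cancel₀ h0),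
      Subtype.ext (inv_mul_cancel₀ h0)⟩, rfl⟩

theorem unitInclΩ_div_mem_U1 {Ω : Type*} [Field Ω] [Algebra F Ω] [Algebra.IsAlgebraic F Ω]
    {P : Ideal (𝓞 Ω)} [hP : P.IsPrime] {ℓ : ℕ} (hp : ℓ.Prime) (hℓ : (ℓ : 𝓞 Ω) ∈ P)
    {u : (locAt F ℓ)ˣ} {y : 𝓞 F} (hu : ((u : locAt F ℓ) : F) = y) {n : ℕ} (hn : n.Coprime ℓ)
    (hy : y - n ∈ (primeBelow F P hp hℓ).asIdeal) {t : Ωˣ} (ht : (t : Ω) = n) :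
    unitInclΩ F Ω ℓ u / t ∈ U1 F P := by
  rw [div_mem_U1_iff F (by rw [ht]; exact placeVal_natCast_eq_one F hℓ hn), coe_unitInclΩ, hu, ht]
  have h1 : algebraMap (𝓞 F) (𝓞 Ω) (y - n) ∈ P := hy
  rw [← placeVal_integer_lt_one_iff F] at h1
  convert h1 using 2
  rw [map_sub, map_natCast]
  rfl

/-- The homomorphism that describes `exp_ℓ` on generators of ideals: it sends `a` to a unit
congruent to `k ^ (-((ℓ - 1) / M) ord_v a)` at every prime `v` above `ℓ`. -/
theorem exists_tameHom (ℓ : RPrime F M) {k : ℕ}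
    (hk : ∀ n : ℕ, k ^ n ≡ 1 [MOD ℓ.1] ↔ ℓ.1 - 1 ∣ n) :
    ∃ B : Fˣ →* (locAt F ℓ.1)ˣ, ∀ (P : Ideal (𝓞 (FR F Fbar M))) [P.IsPrime]
      (hℓ : (ℓ.1 : 𝓞 (FR F Fbar M)) ∈ P) (κ : (FR F Fbar M)ˣ), (κ : FR F Fbar M) = k → ∀ a : Fˣ,
        unitInclΩ F (FR F Fbar M) ℓ.1 (B a) *
          κ ^ (((ℓ.1 - 1) / M : ℕ) * ordAt (primeBelow F P ℓ.2.1 hℓ) a) ∈ U1 F P := by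
  classical
  have hp := ℓ.2.1
  have hkℓ := coprime_of_pow_modEq_iff hk hp.one_lt
  have := finite_primesAt (F := F) hp
  have := Fintype.ofFinite (PrimesAt F ℓ.1)
  set m := (ℓ.1 - 1) / M with hm
  have hmle : m ≤ ℓ.1 - 1 := Nat.div_le_self _ _
  -- the exponent `ℓ - 1 - m` stands for `-m`
  let e : PrimesAt F ℓ.1 → PrimesAt F ℓ.1 → ℕ := fun v w => if w = v then k ^ (ℓ.1 - 1 - m) else 1
  have hecop : ∀ v w, (e v w).Coprime ℓ.1 := by
    intro v w
    dsimp only [e]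
    split_ifs
    · exact hkℓ.pow_left _
    · exact Nat.coprime_one_left _
  have hη : ∀ v : PrimesAt F ℓ.1, ∃ (η : (locAt F ℓ.1)ˣ) (y : 𝓞 F),
      ((η : locAt F ℓ.1) : F) = y ∧ ∀ w : PrimesAt F ℓ.1, y - (e v w : ℕ) ∈ w.1.asIdeal := by
    intro v
    obtain ⟨y, hy⟩ := exists_forall_sub_mem hp 1 (fun w => ((e v w : ℕ) : 𝓞 F))
    simp only [pow_one] at hy
    obtain ⟨u, hu⟩ := exists_unit_of_integer hp (y := y) fun w hw => by
      have h1 := w.1.asIdeal.sub_mem hw (hy w)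
      rw [sub_sub_cancel] at h1
      exact natCast_notMem_of_coprime (hecop v w) w.2 h1
    exact ⟨u, y, hu, hy⟩
  choose η y hηy hy using hη
  refine ⟨∏ v : PrimesAt F ℓ.1, (zpowersHom _ (η v)).comp (ordHom v.1), ?_⟩
  intro P hP hℓ κ hκ a
  let w : PrimesAt F ℓ.1 := ⟨primeBelow F P hp hℓ, natCast_mem_primeBelow F P hp hℓ⟩
  have hηP : ∀ v : PrimesAt F ℓ.1,
      unitInclΩ F (FR F Fbar M) ℓ.1 (η v) * κ ^ (if w = v then m else 0) ∈ U1 F P := by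
    intro v
    have h1 := unitInclΩ_div_mem_U1 hp hℓ (hηy v) (hecop v w) (hy v w)
      (t := if w = v then κ ^ (ℓ.1 - 1 - m) else 1) (by
        dsimp only [e]
        split_ifs <;> simp [hκ])
    split_ifs at h1 ⊢ with h
    · have h2 : κ ^ (ℓ.1 - 1) ∈ U1 F P := by
        rw [← zpow_natCast]
        exact (zpow_mem_U1_iff F hℓ hp hk hκ _).2 dvd_rfl
      have h3 := (U1 F P).mul_mem h1 h2
      have h4 : κ ^ (ℓ.1 - 1) / κ ^ (ℓ.1 - 1 - m) = κ ^ m := by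
        rw [div_eq_iff_eq_mul, ← pow_add, Nat.add_sub_cancel' hmle]
      rwa [div_mul_eq_mul_div, mul_div_assoc, h4] at h3
    · simpa using h1
  have h1 : unitInclΩ F (FR F Fbar M) ℓ.1
      ((∏ v : PrimesAt F ℓ.1, (zpowersHom _ (η v)).comp (ordHom v.1)) a) *
        κ ^ ((m : ℤ) * ordAt w.1 a) =
      ∏ v : PrimesAt F ℓ.1,
        (unitInclΩ F (FR F Fbar M) ℓ.1 (η v) * κ ^ (if w = v then m else 0)) ^ ordAt v.1 a := by
    simp only [mul_zpow, Finset.prod_mul_distrib]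
    congr 1
    · rw [MonoidHom.finsetProd_apply, map_prod]
      refine Finset.prod_congr rfl fun v _ => ?_
      rw [MonoidHom.comp_apply, zpowersHom_apply, map_zpow]
      rfl
    · rw [Finset.prod_eq_single w]
      · rw [if_pos rfl, zpow_mul, zpow_natCast]
      · intro v _ hv
        rw [if_neg hv.symm, pow_zero, one_zpow]
      · exact fun h => absurd (Finset.mem_univ w) h
  change _ * κ ^ ((m : ℤ) * ordAt w.1 a) ∈ _
  rw [h1]
  exact (U1 F P).prod_mem fun v _ => (U1 F P).zpow_mem (hηP v) _

/-- The order at all primes of `F` above `ℓ`, in terms of the places above `ℓ`. -/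
theorem forall_primesAt_iff (ℓ : RPrime F M) (p : HeightOneSpectrum (𝓞 F) → Prop) :
    (∀ v : PrimesAt F ℓ.1, p v.1) ↔ ∀ (P : Ideal (𝓞 (FR F Fbar M))) [P.IsPrime]
      (hℓ : (ℓ.1 : 𝓞 (FR F Fbar M)) ∈ P), p (primeBelow F P ℓ.2.1 hℓ) := by
  constructor
  · intro h P _ hℓ
    exact h ⟨_, natCast_mem_primeBelow F P ℓ.2.1 hℓ⟩
  · intro h v
    obtain ⟨P, hP, hPv⟩ := exists_place_over (FR F Fbar M) v.1.asIdeal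
    have hℓ : (ℓ.1 : 𝓞 (FR F Fbar M)) ∈ P := by
      have : (ℓ.1 : 𝓞 F) ∈ P.comap (algebraMap (𝓞 F) (𝓞 (FR F Fbar M))) := by rw [hPv]; exact v.2
      simpa using this
    rw [show v.1 = primeBelow F P ℓ.2.1 hℓ from HeightOneSpectrum.ext hPv.symm]
    exact h P hℓ

variable {ℓ : RPrime F M} {k : ℕ} (hk : ∀ n : ℕ, k ^ n ≡ 1 [MOD ℓ.1] ↔ ℓ.1 - 1 ∣ n)
  {B : Fˣ →* (locAt F ℓ.1)ˣ} {κ : (FR F Fbar M)ˣ} (hκ : (κ : FR F Fbar M) = k)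
  (hB : ∀ (P : Ideal (𝓞 (FR F Fbar M))) [P.IsPrime] (hℓ : (ℓ.1 : 𝓞 (FR F Fbar M)) ∈ P) (a : Fˣ),
    unitInclΩ F (FR F Fbar M) ℓ.1 (B a) *
      κ ^ (((ℓ.1 - 1) / M : ℕ) * ordAt (primeBelow F P ℓ.2.1 hℓ) a) ∈ U1 F P)

include hk hκ hB

theorem unitRed_tameHom_eq_one_iff (a : Fˣ) :
    unitRed F ℓ.1 (B a) = 1 ↔ ∀ v : PrimesAt F ℓ.1, (M : ℤ) ∣ ordAt v.1 a := by
  rw [unitRed_eq_one_iff F (FR F Fbar M) ℓ.2.1 (fun v => valuation_natCast_RPrime ℓ v.1 v.2),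
    forall_primesAt_iff (Fbar := Fbar) ℓ fun v => (M : ℤ) ∣ ordAt v a]
  refine forall_congr' fun P => forall_congr' fun hP => forall_congr' fun hℓ => ?_
  rw [← dvd_div_mul_iff ℓ, ← zpow_mem_U1_iff F hℓ ℓ.2.1 hk hκ]
  exact ⟨fun h => ((U1 F P).mul_mem_cancel_left h).1 (hB P hℓ a),
    fun h => ((U1 F P).mul_mem_cancel_right h).1 (hB P hℓ a)⟩

theorem unitRed_tameHom_pow (a : Fˣ) : unitRed F ℓ.1 (B a) ^ M = 1 := by
  rw [← map_pow, ← map_pow, unitRed_tameHom_eq_one_iff hk hκ hB]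
  intro v
  rw [ordAt_pow]
  exact dvd_mul_right _ _

/-- Every `M`-torsion class modulo `ℓ` is congruent to a power of `k ^ ((ℓ - 1) / M)` at each prime
above `ℓ`, as the residue fields are prime fields. -/
theorem exists_unitRed_tameHom_eq (hgen : ∀ m : ℕ, m.Coprime ℓ.1 → ∃ i : ℕ, k ^ i ≡ m [MOD ℓ.1])
    {q : (ResRing F ℓ.1)ˣ} (hq : q ^ M = 1) : ∃ a : Fˣ, unitRed F ℓ.1 (B a) = q := by
  have hp := ℓ.2.1
  have hun := fun v : PrimesAt F ℓ.1 => valuation_natCast_RPrime ℓ v.1 v.2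
  obtain ⟨y, hy⟩ := exists_mk_eq_integer F (q : ResRing F ℓ.1)
  obtain ⟨y', hy'⟩ := exists_mk_eq_integer F ((q⁻¹ : (ResRing F ℓ.1)ˣ) : ResRing F ℓ.1)
  have hyv : ∀ v : PrimesAt F ℓ.1, y ∉ v.1.asIdeal := by
    intro v hv
    have h1 : Ideal.Quotient.mk (Ideal.span {(ℓ.1 : locAt F ℓ.1)})
        (⟨(y * y' : 𝓞 F), algebraMap_mem_locAt F ℓ.1 (y * y')⟩ : locAt F ℓ.1) =
        Ideal.Quotient.mk _ 1 := by
      rw [map_one, ← q.mul_inv, hy, hy', ← map_mul]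
      rfl
    obtain ⟨t, ht⟩ := Ideal.mem_span_singleton'.1 (Ideal.Quotient.eq.1 h1)
    have h2 : v.1.valuation F ((y * y' : 𝓞 F) - 1 : F) < 1 := by
      have h3 : ((y * y' : 𝓞 F) - 1 : F) = (t : F) * (ℓ.1 : F) := by
        have := congrArg (fun z : locAt F ℓ.1 => (z : F)) ht.symm
        refine this.trans ?_
        simp
      rw [h3, map_mul, hun v]
      refine (mul_le_of_le_one_left' (valuation_le_one_of_mem_locAt v t.2)).trans_lt ?_
      rw [← WithZero.exp_zero, WithZero.exp_lt_exp]
      norm_num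
    have h4 : v.1.valuation F (algebraMap (𝓞 F) F (y * y' - 1)) < 1 := by
      rw [map_sub, map_one]
      exact h2
    rw [v.1.valuation_lt_one_iff_mem] at h4
    have h5 := v.1.asIdeal.sub_mem (v.1.asIdeal.mul_mem_right y' hv) h4
    rw [sub_sub_cancel] at h5
    exact v.1.isPrime.one_notMem h5
  obtain ⟨u, hu⟩ := exists_unit_of_integer hp hyv
  have huq : unitRed F ℓ.1 u = q := by
    refine Units.ext ?_
    rw [hy]
    exact congrArg _ (Subtype.ext hu)
  have hres : ∀ v : PrimesAt F ℓ.1, ∃ i : ℕ, y - (k ^ i : ℕ) ∈ v.1.asIdeal := by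
    intro v
    obtain ⟨m, hm⟩ := (card_quotient_eq_and_exists_natCast hp v.1 v.2
      (ℓ.2.2.2.2 _ v.1.isPrime v.2).2).2 y
    have hmℓ : m.Coprime ℓ.1 := by
      rw [Nat.coprime_comm, hp.coprime_iff_not_dvd]
      rintro ⟨c, rfl⟩
      have h1 := v.1.asIdeal.add_mem hm (v.1.asIdeal.mul_mem_right (c : 𝓞 F) v.2)
      rw [← Nat.cast_mul, sub_add_cancel] at h1
      exact hyv v h1
    obtain ⟨i, hi⟩ := hgen m hmℓ
    refine ⟨i, ?_⟩
    obtain ⟨c, hc⟩ := (Nat.modEq_iff_dvd).1 hi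
    have h2 : ((m : 𝓞 F)) - (k ^ i : ℕ) = ℓ.1 * (c : 𝓞 F) := by
      exact_mod_cast congrArg (fun z : ℤ => (z : 𝓞 F)) hc
    have h3 := v.1.asIdeal.add_mem hm (v.1.asIdeal.mul_mem_right (c : 𝓞 F) v.2)
    rwa [← h2, sub_add_sub_cancel] at h3
  choose i hi using hres
  have hkℓ := coprime_of_pow_modEq_iff hk hp.one_lt
  have huP : ∀ (P : Ideal (𝓞 (FR F Fbar M))) [P.IsPrime] (hℓ : (ℓ.1 : 𝓞 (FR F Fbar M)) ∈ P),
      unitInclΩ F (FR F Fbar M) ℓ.1 u /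
        κ ^ (i ⟨primeBelow F P hp hℓ, natCast_mem_primeBelow F P hp hℓ⟩) ∈ U1 F P :=
    fun P _ hℓ => unitInclΩ_div_mem_U1 hp hℓ hu (hkℓ.pow_left _)
      (hi ⟨primeBelow F P hp hℓ, natCast_mem_primeBelow F P hp hℓ⟩) (by simp [hκ])
  have hdvd : ∀ v : PrimesAt F ℓ.1, ∃ j : ℤ, (i v : ℤ) = ((ℓ.1 - 1) / M : ℕ) * j := by
    intro v
    obtain ⟨P, hP, hPv⟩ := exists_place_over (FR F Fbar M) v.1.asIdeal
    have hℓ : (ℓ.1 : 𝓞 (FR F Fbar M)) ∈ P := by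
      have : (ℓ.1 : 𝓞 F) ∈ P.comap (algebraMap (𝓞 F) (𝓞 (FR F Fbar M))) := by rw [hPv]; exact v.2
      simpa using this
    have hv : v = ⟨primeBelow F P hp hℓ, natCast_mem_primeBelow F P hp hℓ⟩ :=
      Subtype.ext (HeightOneSpectrum.ext hPv.symm)
    have h1 := huP P hℓ
    rw [← hv] at h1
    have h2 : unitRed F ℓ.1 (u ^ M) = 1 := by rw [map_pow, huq, hq]
    have h3 := (unitRed_eq_one_iff F (FR F Fbar M) hp hun _).1 h2 P hℓ
    have h4 := (U1 F P).div_mem h3 ((U1 F P).pow_mem h1 M)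
    rw [map_pow, div_pow, div_div_cancel, ← pow_mul, ← zpow_natCast,
      zpow_mem_U1_iff F hℓ hp hk hκ, Int.natCast_dvd_natCast, ← mul_div_of_RPrime ℓ,
      mul_comm] at h4
    have hM0 : 0 < M := Nat.pos_of_ne_zero fun h => by
      have h5 := mul_div_of_RPrime ℓ
      have h6 := hp.one_lt
      rw [mul_eq_zero_of_left h] at h5
      omega
    obtain ⟨j, hj⟩ := Nat.dvd_of_mul_dvd_mul_right hM0 h4
    exact ⟨j, by exact_mod_cast hj⟩
  choose j hj using hdvd
  obtain ⟨a, ha⟩ := exists_ordAt_eq hp fun v => -j v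
  refine ⟨a, ?_⟩
  rw [← huq, ← div_eq_one, ← map_div, unitRed_eq_one_iff F (FR F Fbar M) hp hun]
  intro P hP hℓ
  have h1 := huP P hℓ
  have h2 := hB P hℓ a
  rw [ha ⟨primeBelow F P hp hℓ, natCast_mem_primeBelow F P hp hℓ⟩, mul_neg, ← hj, zpow_neg,
    zpow_natCast, ← div_eq_mul_inv] at h2
  have h3 := (U1 F P).div_mem h2 h1
  rwa [div_div_div_cancel_right, ← map_div] at h3

/-- The isomorphism `exp_ℓ` exists: the homomorphisms `a ↦ [a]_ℓ` and `a ↦ B a mod ℓ` are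
surjective with the same kernel. -/
theorem exists_exp (hgen : ∀ m : ℕ, m.Coprime ℓ.1 → ∃ i : ℕ, k ^ i ≡ m [MOD ℓ.1]) :
    ∃ e : ModPow (FracGroup F ℓ.1) M ≃* ResTors F M ℓ.1, ∀ a : Fˣ,
      ((e (bracket F M ℓ.1 (QuotientGroup.mk a)) : (ResRing F ℓ.1)ˣ)) = unitRed F ℓ.1 (B a) := by
  let f : Fˣ →* ResTors F M ℓ.1 := ((unitRed F ℓ.1).comp B).codRestrict _ fun a =>
    unitRed_tameHom_pow hk hκ hB a
  let g : Fˣ →* ModPow (FracGroup F ℓ.1) M := (bracket F M ℓ.1).comp (QuotientGroup.mk' _)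
  have hf : Function.Surjective f := by
    rintro ⟨q, hq⟩
    obtain ⟨a, ha⟩ := exists_unitRed_tameHom_eq hk hκ hB hgen hq
    exact ⟨a, Subtype.ext ha⟩
  have hg : Function.Surjective g :=
    (bracket_surjective ℓ.2.1 M).comp (QuotientGroup.mk'_surjective _)
  have hker : g.ker = f.ker := by
    ext a
    rw [MonoidHom.mem_ker, MonoidHom.mem_ker]
    exact ((bracket_mk_eq_one_iff ℓ.2.1 M a).trans
      (unitRed_tameHom_eq_one_iff hk hκ hB a).symm).trans
        ⟨fun h => Subtype.ext h, fun h => congrArg Subtype.val h⟩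
  refine ⟨(QuotientGroup.quotientKerEquivOfSurjective g hg).symm.trans
    ((QuotientGroup.quotientMulEquivOfEq hker).trans
      (QuotientGroup.quotientKerEquivOfSurjective f hf)), fun a => ?_⟩
  have h1 : (QuotientGroup.quotientKerEquivOfSurjective g hg).symm
      (bracket F M ℓ.1 (QuotientGroup.mk a)) = QuotientGroup.mk a := by
    rw [MulEquiv.symm_apply_eq]
    rfl
  rw [MulEquiv.trans_apply, h1]
  rfl

/-- The isomorphism of `exists_exp` is the map `exp_ℓ`. -/
theorem isExp_of_tameHom {σ : G F Fbar M} (hσ : σ ∈ inertiaGroup F Fbar M ℓ.1) {ζ : FR F Fbar M}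
    (hζ : IsPrimitiveRoot ζ ℓ.1) (hσζ : σ ζ = ζ ^ k)
    {e : ModPow (FracGroup F ℓ.1) M ≃* ResTors F M ℓ.1} (he : ∀ a : Fˣ,
      ((e (bracket F M ℓ.1 (QuotientGroup.mk a)) : (ResRing F ℓ.1)ˣ)) = unitRed F ℓ.1 (B a)) :
    IsExp ℓ σ e := by
  intro x a b hx ha hb
  have hp := ℓ.2.1
  set K := subField F Fbar M ℓ.1 with hK
  have := numberField_subField (F := F) (Fbar := Fbar) (M := M) hp.ne_zero
  rw [he] at hb
  have hσx : σ (x : FR F Fbar M) ∈ K := map_mem_of_normal K σ hx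
  let d : K := (⟨x, hx⟩ / ⟨σ x, hσx⟩) ^ ((ℓ.1 - 1) / M) - algebraMap F K b
  have hd : algebraMap K (FR F Fbar M) d =
      ((x : FR F Fbar M) / σ x) ^ ((ℓ.1 - 1) / M) - algebraMap F (FR F Fbar M) b := rfl
  have hval : ∀ (P : Ideal (𝓞 (FR F Fbar M))) [P.IsPrime], (ℓ.1 : 𝓞 (FR F Fbar M)) ∈ P →
      placeVal F P (algebraMap K (FR F Fbar M) d) < 1 := by
    intro P hP hℓ
    have hkℓ := coprime_of_pow_modEq_iff hk hp.one_lt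
    have h1 := div_galUnits_mul_zpow_mem_U1 hp hℓ hσ hζ hσζ hkℓ hκ (y := x)
      (placeVal_eq_zpow_of_norm ℓ hℓ hσ hζ hx ha)
    have h2 := (U1 F P).div_mem ((U1 F P).pow_mem h1 ((ℓ.1 - 1) / M)) (hB P hℓ a)
    rw [mul_pow, ← zpow_natCast (κ ^ _), ← zpow_mul, mul_comm (ordAt _ a), mul_div_mul_right_eq_div,
      div_mem_U1_iff F (placeVal_unitInclΩ F hℓ _)] at h2
    have h3 := placeVal_sub_lt_one_of_mk_eq F hℓ hb
    rw [hd]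
    have h4 : ((x : FR F Fbar M) / σ x) ^ ((ℓ.1 - 1) / M) - algebraMap F (FR F Fbar M) b =
        ((((x / galUnits σ x) ^ ((ℓ.1 - 1) / M) : (FR F Fbar M)ˣ) : FR F Fbar M) -
          unitInclΩ F (FR F Fbar M) ℓ.1 (B a)) -
        (algebraMap F (FR F Fbar M) b - algebraMap F (FR F Fbar M) ((B a : locAt F ℓ.1) : F)) := by
      rw [coe_unitInclΩ, sub_sub_sub_cancel_right, Units.val_pow_eq_pow_val,
        Units.val_div_eq_div_val]
      rfl
    rw [h4]
    exact (Valuation.map_sub _ _ _).trans_lt (max_lt h2 h3)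
  obtain ⟨w, hw, hwd⟩ := mem_radicalAt_of_placeVal_lt_one F hp hval
  exact ⟨w, hw, by rw [hwd, hd]⟩

end Exp

/-! ### The recursion at the primes dividing `r` -/

section Recursion

open IsDedekindDomain

set_option linter.unusedSectionVars false

variable {F : Type*} [Field F] [NumberField F] {Fbar : Type*} [Field Fbar] [Algebra F Fbar]
  [IsAlgClosure F Fbar] {M : ℕ}

/-- As `ℓ` splits completely in `F`, a Frobenius `φ` at `ℓ` is congruent to the `ℓ`-th power. -/
theorem pow_div_galUnits_mem_U1 (ℓ : RPrime F M) {P : Ideal (𝓞 (FR F Fbar M))} [hP : P.IsPrime]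
    (hℓ : (ℓ.1 : 𝓞 (FR F Fbar M)) ∈ P) {φ : G F Fbar M} (hφ : IsFrob ℓ.1 φ)
    {w : (FR F Fbar M)ˣ} (hw : placeVal F P (w : FR F Fbar M) = 1) :
    w ^ ℓ.1 / galUnits φ w ∈ U1 F P := by
  have hp := ℓ.2.1
  have hcard : Nat.card (𝓞 F ⧸ P.under (𝓞 F)) = ℓ.1 :=
    (card_quotient_eq_and_exists_natCast hp (primeBelow F P hp hℓ)
      (natCast_mem_primeBelow F P hp hℓ) (ℓ.2.2.2.2 _ (primeBelow F P hp hℓ).isPrime (natCast_mem_primeBelow F P hp hℓ)).2).1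
  have hint : ∀ (x : 𝓞 (FR F Fbar M)) (t : (FR F Fbar M)ˣ), (t : FR F Fbar M) = x → x ∉ P →
      t ^ ℓ.1 / galUnits φ t ∈ U1 F P := by
    intro x t ht hx
    have hv : placeVal F P ((t ^ ℓ.1 : (FR F Fbar M)ˣ) : FR F Fbar M) = 1 := by
      rw [Units.val_pow_eq_pow_val, map_pow, ht, (placeVal_integer_eq_one_iff F).2 hx, one_pow]
    rw [← inv_mem_iff, inv_div, div_mem_U1_iff F hv]
    have h1 := hφ P (mem_placesAbove hp P hℓ) x
    rw [hcard, ← placeVal_integer_lt_one_iff F] at h1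
    convert h1 using 2
    rw [Units.val_pow_eq_pow_val, ht]
    change φ (t : FR F Fbar M) - _ = _
    rw [ht]
    rfl
  obtain ⟨n, d, hd, h⟩ := (placeVal_le_one_iff F).1 hw.le
  have hd1 : placeVal F P (d : FR F Fbar M) = 1 := (placeVal_integer_eq_one_iff F).2 hd
  have hn1 : placeVal F P (n : FR F Fbar M) = 1 := by
    rw [← h, map_mul, hw, hd1, one_mul]
  have hn : n ∉ P := (placeVal_integer_eq_one_iff F).1 hn1
  have hd0 : (d : FR F Fbar M) ≠ 0 := fun h => by rw [h, map_zero] at hd1; exact zero_ne_one hd1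
  have hn0 : (n : FR F Fbar M) ≠ 0 := fun h => by rw [h, map_zero] at hn1; exact zero_ne_one hn1
  have h1 : w = Units.mk0 _ hn0 / Units.mk0 _ hd0 := by
    rw [eq_div_iff_mul_eq']
    exact Units.ext h
  rw [h1, div_pow, map_div, div_div_div_comm]
  exact (U1 F P).div_mem (hint n _ rfl hn) (hint d _ rfl hd)

variable {ℓ : RPrime F M} {k : ℕ} (hk : ∀ n : ℕ, k ^ n ≡ 1 [MOD ℓ.1] ↔ ℓ.1 - 1 ∣ n)
  {B : Fˣ →* (locAt F ℓ.1)ˣ} {t : (FR F Fbar M)ˣ} (ht : (t : FR F Fbar M) = k)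
  (hB : ∀ (P : Ideal (𝓞 (FR F Fbar M))) [P.IsPrime] (hℓ : (ℓ.1 : 𝓞 (FR F Fbar M)) ∈ P) (a : Fˣ),
    unitInclΩ F (FR F Fbar M) ℓ.1 (B a) *
      t ^ (((ℓ.1 - 1) / M : ℕ) * ordAt (primeBelow F P ℓ.2.1 hℓ) a) ∈ U1 F P)

include hk ht hB

/-- The relation `D_ℓ c = c'` implies `exp_ℓ [κ c]_ℓ = ν_ℓ (κ c')`. If `ξ x = a z ^ M` and
`ξ y = b w ^ M` for representatives `x` and `y` of `c` and `c'`, then the two quotients by `M` in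
the definition of `D_ℓ` have images `σ z / z` and `b ^ ((ℓ - 1) / M) w ^ ℓ / φ w`; these are
congruent modulo the places above `ℓ`, where `w ^ ℓ ≡ φ w` and `σ z / z` is given by the tame
character. -/
theorem unitRed_tameHom_eq_nu [IsTotallyReal F] (hM : Odd M) {σ : G F Fbar M}
    (hσ : σ ∈ inertiaGroup F Fbar M ℓ.1) {ζ : FR F Fbar M} (hζ : IsPrimitiveRoot ζ ℓ.1)
    (hσζ : σ ζ = ζ ^ k) {ξ : U F M Set.univ →+ Additive (𝓞 (FR F Fbar M))ˣ}
    (hξ : IsEquivariant ξ)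
    (hξI : ∀ x ∈ Isub ℓ, RadCongr (FR F Fbar M) ℓ.1
      (((ξ x).toMul : 𝓞 (FR F Fbar M)) : FR F Fbar M) 1)
    {κ : H0 F Fbar M Set.univ →+ Additive (ModPow Fˣ M)} (hκ : IsInduced ξ κ)
    {c : H0 F Fbar M Set.univ} {d : H0 F Fbar M (Set.univ \ {ℓ})} (hD : IsD ℓ σ c d) {a : Fˣ}
    (ha : QuotientGroup.mk a = (κ c).toMul) {b : (locAt F ℓ.1)ˣ}
    (hb : unitClass F M ℓ.1 b = (κ (inclH0 Fbar _ d)).toMul) :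
    unitRed F ℓ.1 (B a) = nu F M ℓ.1 b := by
  have hp := ℓ.2.1
  obtain ⟨φ, hφ, x, y, hx, hy, u, v, hu, hv, huv⟩ := hD
  set m := (ℓ.1 - 1) / M with hm
  have hMm : M * m = ℓ.1 - 1 := mul_div_of_RPrime ℓ
  obtain ⟨z, hz⟩ := exists_eq_mul_pow_of_isInduced hκ hx ha
  obtain ⟨w, hw⟩ := exists_eq_mul_pow_of_isInduced hκ (represents_inclU hy)
    (a := unitIncl F ℓ.1 b) hb
  have ha0 : algebraMap F (FR F Fbar M) a ≠ 0 := (map_ne_zero _).2 a.ne_zero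
  have hb0 : (unitInclΩ F (FR F Fbar M) ℓ.1 b : FR F Fbar M) ≠ 0 := Units.ne_zero _
  have hb' : algebraMap F (FR F Fbar M) (unitIncl F ℓ.1 b) =
    unitInclΩ F (FR F Fbar M) ℓ.1 b := rfl
  have hu1 : (xiField ξ u).toMul = galUnits σ z / z := by
    refine Units.ext (eq_of_pow_eq_pow hM ?_)
    rw [← xiField_nsmul, hu, xiField_sub, xiField_galU hξ, hz, map_mul, map_pow, AlgEquiv.commutes,
      mul_div_mul_left _ _ ha0, Units.val_div_eq_div_val, div_pow]
    rfl
  have hv1 : (xiField ξ (inclU _ v)).toMul =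
      unitInclΩ F (FR F Fbar M) ℓ.1 b ^ m * (w ^ ℓ.1 / galUnits φ w) := by
    refine Units.ext (eq_of_pow_eq_pow hM ?_)
    have h1 : M • inclU _ v = ℓ.1 • inclU _ y - galU Set.univ φ (inclU _ y) := by
      rw [← map_nsmul, hv, map_sub, map_nsmul, inclU_galU]
    have h2 : (unitInclΩ F (FR F Fbar M) ℓ.1 b : FR F Fbar M) ^ ℓ.1 =
        (unitInclΩ F (FR F Fbar M) ℓ.1 b : FR F Fbar M) ^ (M * m) *
          unitInclΩ F (FR F Fbar M) ℓ.1 b := by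
      rw [← pow_succ, hMm, Nat.sub_add_cancel hp.one_lt.le]
    have hw0 : φ (w : FR F Fbar M) ≠ 0 := (map_ne_zero φ).2 w.ne_zero
    rw [← xiField_nsmul, h1, xiField_sub, xiField_nsmul, xiField_galU hξ, hw, map_mul, map_pow,
      AlgEquiv.commutes, hb', Units.val_mul, Units.val_div_eq_div_val, Units.val_pow_eq_pow_val,
      Units.val_pow_eq_pow_val, mul_pow, h2]
    change _ = (_ * (_ / φ (w : FR F Fbar M))) ^ M
    rw [mul_pow, div_pow, ← mul_div_assoc,
      div_eq_div_iff (mul_ne_zero hb0 (pow_ne_zero _ hw0)) (pow_ne_zero _ hw0)]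
    ring
  have hun := fun v : PrimesAt F ℓ.1 => valuation_natCast_RPrime ℓ v.1 v.2
  have hnu : nu F M ℓ.1 b = unitRed F ℓ.1 (b ^ m) := (map_pow (unitRed F ℓ.1) b m).symm
  rw [hnu, ← div_eq_one, ← map_div, unitRed_eq_one_iff F (FR F Fbar M) hp hun]
  intro P hP hℓ
  have hξ1 : ∀ s : U F M Set.univ, placeVal F P ((xiField ξ s).toMul : FR F Fbar M) = 1 :=
    fun s => placeVal_unit F (ξ s).toMul
  set n := ordAt (primeBelow F P hp hℓ) a with hn
  have hM0 : M ≠ 0 := hM.pos.ne'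
  have hw1 : placeVal F P (w : FR F Fbar M) = 1 := by
    have h1 := congrArg (placeVal F P) hw
    rw [hξ1, map_mul, hb', placeVal_unitInclΩ F hℓ, one_mul, map_pow] at h1
    exact (pow_eq_one_iff_of_nonneg zero_le hM0).1 h1.symm
  have hz1 : placeVal F P (z : FR F Fbar M) = placeVal F P (1 - ζ) ^ (-(m * n : ℤ)) := by
    have h1 := congrArg (placeVal F P) hz
    have hπ : placeVal F P (1 - ζ) ≠ 0 := (map_ne_zero _).2 (one_sub_ne_zero hp hζ)
    rw [hξ1, map_mul, map_pow, placeVal_algebraMap_eq_zpow F hp hℓ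
      (valuation_natCast_RPrime ℓ _ (natCast_mem_primeBelow F P hp hℓ)), ← hn,
      ← valuation_one_sub_pow_eq hp hζ, ← hMm, mul_comm M, pow_mul, ← zpow_natCast _ M, ← zpow_mul,
      mul_comm (M : ℤ), zpow_mul, zpow_natCast, ← mul_pow] at h1
    have h2 := (pow_eq_one_iff_of_nonneg zero_le hM0).1 h1.symm
    rw [zpow_neg, zpow_mul, zpow_natCast]
    exact eq_inv_of_mul_eq_one_right h2
  have h1 := div_galUnits_mul_zpow_mem_U1 hp hℓ hσ hζ hσζ (coprime_of_pow_modEq_iff hk hp.one_lt) ht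
    hz1
  have h2 : (xiField ξ u).toMul / (xiField ξ (inclU _ v)).toMul ∈ U1 F P := by
    obtain ⟨r, hr, hr'⟩ := hξI _ huv
    rw [mem_U1_iff, Units.val_div_eq_div_val, ← xiField_sub, coe_xiField, hr']
    exact placeVal_lt_one_of_mem_radicalAt F hℓ hr
  have h3 := pow_div_galUnits_mem_U1 ℓ hℓ hφ hw1
  have h4 := (U1 F P).mul_mem ((U1 F P).mul_mem (hB P hℓ a) h1) ((U1 F P).mul_mem h2 h3)
  rw [hu1, hv1] at h4
  convert h4 using 1
  rw [map_div, map_pow, zpow_neg, ← hn, div_mul_eq_div_div, div_mul_cancel, mul_mul_mul_comm,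
    mul_inv_cancel, mul_one, mul_assoc, ← mul_div_assoc, div_mul_div_cancel, div_self',
    mul_one_div]

end Recursion
end
end Kolyvagin

theorem proposition3p2 (F : Type*) [Field F] [NumberField F] [IsAbelianGalois ℚ F]
    [IsTotallyReal F] (Fbar : Type*) [Field Fbar] [Algebra F Fbar] [IsAlgClosure F Fbar]
    (M : ℕ) (hM : Odd M)
    (σ : Kolyvagin.RPrime F M → Kolyvagin.G F Fbar M)
    (hσ : ∀ ℓ : Kolyvagin.RPrime F M,
      Subgroup.zpowers (σ ℓ) = Kolyvagin.inertiaGroup F Fbar M ℓ.1)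
    (ξ : Kolyvagin.U F M Set.univ →+ Additive (𝓞 (Kolyvagin.FR F Fbar M))ˣ)
    (hξ : Kolyvagin.IsEquivariant ξ)
    (hξI : ∀ ℓ : Kolyvagin.RPrime F M, ∀ x ∈ Kolyvagin.Isub ℓ,
      Kolyvagin.RadCongr (Kolyvagin.FR F Fbar M) ℓ.1
        (((ξ x).toMul : 𝓞 (Kolyvagin.FR F Fbar M)) : Kolyvagin.FR F Fbar M) 1) :
    (∃! κ : Kolyvagin.H0 F Fbar M Set.univ →+ Additive (Kolyvagin.ModPow Fˣ M),
      Kolyvagin.IsInduced ξ κ) ∧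
    ∀ κ : Kolyvagin.H0 F Fbar M Set.univ →+ Additive (Kolyvagin.ModPow Fˣ M),
      Kolyvagin.IsInduced ξ κ →
      ∀ c : Kolyvagin.RDiv F M → Kolyvagin.H0 F Fbar M Set.univ,
        Kolyvagin.UniversalKolyvaginRecursion σ c →
        Kolyvagin.KolyvaginRecursion σ (fun r => (κ (c r)).toMul) := by
  refine ⟨Kolyvagin.existsUnique_isInduced ξ hM hξ, fun κ hκ c hc => ⟨fun r ℓ hp hℓ =>
    Kolyvagin.mem_range_unitClass hM hξ hκ r (hc.1 r) hp hℓ, fun ℓ => ?_⟩⟩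
  have hσℓ : σ ℓ ∈ Kolyvagin.inertiaGroup F Fbar M ℓ.1 := by
    rw [← hσ ℓ]
    exact Subgroup.mem_zpowers _
  obtain ⟨ζ, hζ⟩ := Kolyvagin.exists_isPrimitiveRoot (F := F) (Fbar := Fbar) ℓ
  obtain ⟨k, hσζ, hk, hgen⟩ := Kolyvagin.exists_primitiveRoot_modulo ℓ (hσ ℓ) hζ
  have hk0 : (k : Kolyvagin.FR F Fbar M) ≠ 0 := by
    rw [Nat.cast_ne_zero]
    rintro rfl
    have h := Kolyvagin.coprime_of_pow_modEq_iff hk ℓ.2.1.one_lt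
    rw [Nat.coprime_zero_left] at h
    exact ℓ.2.1.one_lt.ne' h
  obtain ⟨B, hB⟩ := Kolyvagin.exists_tameHom (Fbar := Fbar) ℓ hk
  have hB' := fun P hP hℓ a => @hB P hP hℓ (Units.mk0 _ hk0) rfl a
  obtain ⟨e, he⟩ := Kolyvagin.exists_exp hk (Units.val_mk0 hk0) hB' hgen
  refine ⟨e, Kolyvagin.isExp_of_tameHom hk (Units.val_mk0 hk0) hB' hσℓ hζ hσζ he,
    fun r r' hr b hb => ?_⟩
  obtain ⟨d, hd, hdc⟩ := hc.2 r r' ℓ hr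
  obtain ⟨a, ha⟩ := QuotientGroup.mk_surjective (κ (c r)).toMul
  change (e (Kolyvagin.bracket F M ℓ.1 (κ (c r)).toMul) : (Kolyvagin.ResRing F ℓ.1)ˣ) = _
  change _ = (κ (c r')).toMul at hb
  rw [← ha, he]
  rw [← hdc] at hb
  exact Kolyvagin.unitRed_tameHom_eq_nu hk (Units.val_mk0 hk0) hB' hM hσℓ hζ hσζ hξ (hξI ℓ) hκ hd
    ha hb
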